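/- Let $m\ge 3$ and let $\mathcal D=\mathbb R^2\setminus\bigcup_{i=1}^m\mathcal O_i$ be a billiard table, where each $\mathcal O_i$ is a compact convex set with non-empty interior, whose boundary is a simple closed real-analytic curve of length $\ell_i$ with everywhere positive curvature, parametrized counterclockwise by arc length by an $\ell_i$-periodic map $\Upsilon_i$, and where the convex hull of any two of the obstacles is disjoint from each of the others (non-eclipse condition). A collision on $\mathcal O_i$ is described by the coordinates $(s,r)$, $s\in\mathbb R/\ell_i\mathbb Z$, $r=\sin\varphi\in[-1,1]$, where $\Upsilon_i(s)$ is the point of impact and $\varphi$ is the oriented angle from the normal pointing into $\mathcal D$ to the outgoing velocity. Let $\mathcal F$ be the (partially defined) billiard map. Fix $i\ne j$ and a $2$-periodic orbit $(ij)$, with points $(0,0)$ on $\mathcal O_i$ (origin of the arc-length parameter) and $(b,0)$ on $\mathcal O_j$, so that $(0,0)$ is a fixed point of $T:=\mathcal F^2$. For a real-analytic function $\Delta(z)=\lambda+\sum_{k\ge1}a_kz^k$ near $0$ with $0<\lambda<1$, set $N_\Delta(\xi,\eta)=(\Delta(\xi\eta)\,\xi,\ \Delta(\xi\eta)^{-1}\eta)$.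 A conjugacy from $T$ to $N_\Delta$ is a pair $(U,R)$, where $U\subset\{|s|<\ell_i/2,\ |r|<1\}$ is an open neighborhood of $(0,0)$ on which $T$ is defined, and $R\colon U\to\mathbb R^2$ is real-analytic and injective, with $R(0,0)=(0,0)$ and $R^*(d\xi\wedge d\eta)=ds\wedge dr$, such that $\Delta$ is analytic and non-zero at $\xi\eta$ for every $(\xi,\eta)\in R(U)$, and $R\circ T=N_\Delta\circ R$ at all points of $U\cap T^{-1}(U)$. If there is such a conjugacy, $N_\Delta$ is called a Birkhoff normal form of $T$ at $(0,0)$. Then: 1. $T$ has a Birkhoff normal form $N=N_\Delta$ at $(0,0)$, and the germ of $\Delta$ at $0$ is unique; hence the Birkhoff invariants $(a_k)_{k\ge1}$ of $T$ at $(0,0)$ are well defined. 2. If the Birkhoff invariants $(a_k)_{k\ge 1}$ are not all equal to zero, then there is a conjugacy $(U_0,R_0)$ from $T=\mathcal F^2$ to $N$ such that $$R_0\big(U_0\cap\{(s,0):\ s\ge0\}\big)=R_0(U_0)\cap\{(\xi,\xi):\ \xi\ge0\},$$ and it is unique: any two such conjugacies $(U_1,R_1)$ and $(U_2,R_2)$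 coincide on the connected component of $U_1\cap U_2$ that contains $(0,0)$. -/

import Mathlib

open Set Filter Topology
open scoped Nat

/-- The Euclidean plane. -/
abbrev Plane : Type := EuclideanSpace ℝ (Fin 2)

/-- A billiard table `ℝ² \ ⋃ O i` with `m` obstacles. Each obstacle is a compact convex set
whose boundary is a simple closed real analytic curve, parametrized by arc length
(counterclockwise) by `Υ i`, with everywhere positive curvature (strict convexity);
the obstacles satisfy the non-eclipse condition. -/
structure BilliardTable (m : ℕ) where
  /-- the obstacles -/
  O : Fin m → Set Plane
  /-- the lengths of their boundaries -/
  ℓ : Fin m → ℝ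
  /-- the arc-length parametrizations of their boundaries, lifted to the universal cover
  `ℝ` of the circle `ℝ / ℓ i ℤ` -/
  Υ : Fin m → ℝ → Plane
  isCompact : ∀ i, IsCompact (O i)
  convex : ∀ i, Convex ℝ (O i)
  nonempty_interior : ∀ i, (interior (O i)).Nonempty
  length_pos : ∀ i, 0 < ℓ i
  analytic : ∀ i, AnalyticOnNhd ℝ (Υ i) univ
  periodic : ∀ i, Function.Periodic (Υ i) (ℓ i)
  simple : ∀ i, InjOn (Υ i) (Ico 0 (ℓ i))
  range_eq : ∀ i, range (Υ i) = frontier (O i)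
  unit_speed : ∀ i s, ‖deriv (Υ i) s‖ = 1
  /-- the signed curvature is positive -/
  curvature_pos : ∀ i s,
    0 < deriv (Υ i) s 0 * deriv (deriv (Υ i)) s 1 - deriv (Υ i) s 1 * deriv (deriv (Υ i)) s 0
  non_eclipse : ∀ i j k, i ≠ j → k ≠ i → k ≠ j →
    Disjoint (convexHull ℝ (O i ∪ O j)) (O k)

/-- Coordinates of a collision: the label of the obstacle, the arc-length parameter `s` of the
point of impact, and `r = sin φ`, where `φ` is the oriented angle from the normal of the
obstacle to the outgoing velocity. The number `s` stands for its class modulo the length of the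
boundary of the obstacle. -/
structure Collision (m : ℕ) where
  idx : Fin m
  s : ℝ
  r : ℝ

namespace BilliardTable

variable {m : ℕ}

/-- The point of impact. -/
noncomputable def point (D : BilliardTable m) (x : Collision m) : Plane :=
  D.Υ x.idx x.s

/-- The unit tangent vector at the point of impact. -/
noncomputable def tangent (D : BilliardTable m) (x : Collision m) : Plane :=
  deriv (D.Υ x.idx) x.s

/-- The unit normal vector at the point of impact that points into the table: the tangent
vector rotated by `-π/2`, as the boundaries of the obstacles are run through
counterclockwise. -/
noncomputable def normal (D : BilliardTable m) (x : Collision m) : Plane :=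
  !₂[D.tangent x 1, -(D.tangent x 0)]

/-- The outgoing velocity: the unit vector that makes with the normal an oriented angle
`φ ∈ [-π/2, π/2]` with `sin φ = r`. -/
noncomputable def velocity (D : BilliardTable m) (x : Collision m) : Plane :=
  Real.sqrt (1 - x.r ^ 2) • D.normal x + x.r • D.tangent x

/-- `D.Bounce x y`: the billiard map of `D` is defined at `x` and maps `x` to `y`. The
ball leaves `x` along a straight line, `y` is located at its first return to the obstacles, and
the velocity is reflected there. -/
def Bounce (D : BilliardTable m) (x y : Collision m) : Prop :=
  |x.r| ≤ 1 ∧ |y.r| ≤ 1 ∧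
  (∃ t : ℝ, 0 < t ∧ D.point y = D.point x + t • D.velocity x ∧
    ∀ u ∈ Ioo 0 t, ∀ k, D.point x + u • D.velocity x ∉ D.O k) ∧
  D.velocity y = D.velocity x - (2 * inner ℝ (D.velocity x) (D.normal y)) • D.normal y

/-- The graph, in the coordinates `(s, r)` on the `i`-th obstacle, of the square of the
billiard map. -/
def SquareMap (D : BilliardTable m) (i : Fin m) (p p' : ℝ × ℝ) : Prop :=
  ∃ y : Collision m, D.Bounce ⟨i, p.1, p.2⟩ y ∧ D.Bounce y ⟨i, p'.1, p'.2⟩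

end BilliardTable

/-- The map `(ξ, η) ↦ (Δ(ξη) ξ, Δ(ξη)⁻¹ η)`. -/
noncomputable def normalForm (Δ : ℝ → ℝ) (q : ℝ × ℝ) : ℝ × ℝ :=
  (Δ (q.1 * q.2) * q.1, (Δ (q.1 * q.2))⁻¹ * q.2)

/-- The coefficient of `z ^ k` in the Taylor expansion of `Δ` at `0`. -/
noncomputable def birkhoffInvariant (Δ : ℝ → ℝ) (k : ℕ) : ℝ :=
  iteratedDeriv k Δ 0 / (k ! : ℝ)

namespace BilliardTable

variable {m : ℕ}

/-- `R` is an analytic symplectic change of coordinates, from an open neighborhood `U` of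
`(0, 0)` in the collision space of the `i`-th obstacle to a neighborhood of `(0, 0)` in `ℝ²`,
which conjugates the square of the billiard map to `normalForm Δ`. -/
structure IsConjugacy (D : BilliardTable m) (i : Fin m) (Δ : ℝ → ℝ)
    (U : Set (ℝ × ℝ)) (R : ℝ × ℝ → ℝ × ℝ) : Prop where
  isOpen : IsOpen U
  zero_mem : (0, 0) ∈ U
  /-- on `U`, the pair `(s, r)` is a system of coordinates of the collision space -/
  chart : ∀ p ∈ U, |p.1| < D.ℓ i / 2 ∧ |p.2| < 1
  /-- the square of the billiard map is defined on `U` -/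
  defined : ∀ p ∈ U, ∃ p', D.SquareMap i p p'
  analytic : AnalyticOnNhd ℝ R U
  injOn : InjOn R U
  map_zero : R (0, 0) = (0, 0)
  /-- `R` pulls the form `dξ ∧ dη` back to `ds ∧ dr` -/
  symplectic : ∀ p ∈ U, (fderiv ℝ R p).det = 1
  /-- `normalForm Δ` is defined and analytic on `R(U)` -/
  target : ∀ p ∈ U, AnalyticAt ℝ Δ ((R p).1 * (R p).2) ∧ Δ ((R p).1 * (R p).2) ≠ 0
  conj : ∀ p ∈ U, ∀ p' ∈ U, D.SquareMap i p p' → R p' = normalForm Δ (R p)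

/-- `normalForm Δ` is a Birkhoff normal form of the square of the billiard map at the point
`(0, 0)` of the `i`-th obstacle: `Δ(z) = λ + a₁ z + a₂ z² + ⋯` near `0`, with `0 < λ < 1`, and
there is an analytic symplectic conjugacy near `(0, 0)`. -/
def IsBirkhoffNormalForm (D : BilliardTable m) (i : Fin m) (Δ : ℝ → ℝ) : Prop :=
  AnalyticAt ℝ Δ 0 ∧ 0 < Δ 0 ∧ Δ 0 < 1 ∧ ∃ U R, D.IsConjugacy i Δ U R

/-- A conjugacy that maps the half-axis `{(s, 0), s ≥ 0}` of its domain onto the half-line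
`{(ξ, ξ), ξ ≥ 0}` of its image. -/
def IsCanonicalConjugacy (D : BilliardTable m) (i : Fin m) (Δ : ℝ → ℝ)
    (U : Set (ℝ × ℝ)) (R : ℝ × ℝ → ℝ × ℝ) : Prop :=
  D.IsConjugacy i Δ U R ∧
    R '' (U ∩ {p | ∃ s : ℝ, 0 ≤ s ∧ p = (s, 0)}) =
      R '' U ∩ {q | ∃ ξ : ℝ, 0 ≤ ξ ∧ q = (ξ, ξ)}

end BilliardTable

/-! The time reversal I(s, r) = (s, -r) conjugates T to its inverse, and this symmetry carries the
whole proof. Let L be the length of the chord between a point of one curve and a point of the other.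
The tangential components of the chord's direction are -∂₁L and ∂₂L, so the equality of mixed
derivatives makes T symplectic, and positive curvature makes it hyperbolic, with eigenvalues λ and
λ⁻¹, 0 < λ < 1 (`exists_reversible_map`, `exists_reversible_map_of_curves`). Supporting lines and
the non-eclipse condition ensure that the chords are genuine billiard trajectories
(`BilliardTable.bounce_of_inner_pos`, `BilliardTable.exists_squareMap`).

Existence of the normal form. In linear eigencoordinates I becomes the swap of the two variables. A
parametrization p ↦ (θ(p), θ(swap p)) is sought that conjugates N to T; if f is the first component
of T, this requires θ(N p) = f(θ(p), θ(swap p)), and reversibility then gives the second component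
for free (`exists_conjugacy_of_reversible`). Give xⁱyʲ the weight i - j. Composition with N
multiplies the part of weight k by uᵏ, with u = Δ(xy), so for f = λx + g the equation splits into
uᵏθₖ = λθₖ + Fₖ, where F = g(θ, θ ∘ swap). Weight 1 is resonant: normalizing θ₁ = εx turns its
equation into the definition of u. In every other weight the equation can be solved for θₖ with
uniformly bounded coefficients, because |u| is close to λ. There are thus no small divisors, and θ
is the fixed point of a contraction in a Banach algebra of convergent series
(`AbsSeries.exists_fixedPoint`).

Symplecticity. The Jacobian of the parametrization Ψ is invariant under N, hence a function j(xy). A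
map Q(x, y) = (α(xy)x, α(xy)y) has Jacobian (wα(w)²)' at w = xy, so α can be chosen to give Q the
same Jacobian; then R = Q ∘ Ψ⁻¹ is symplectic (`exists_symplectic_conjugacy`). It still turns I into
the swap, so it maps the fixed line r = 0 of I into the fixed line of the swap, which is the
diagonal.

Uniqueness. Two conjugacies differ by a symplectic map that intertwines two normal forms.
Equivariant functions are of a single weight (`AbsSeries.exists_isHomog_of_equivariant`), so this
map is (F(xy)x, G(xy)y) with FG = 1, and the germs of Δ agree (`normalForm_intertwiner`). If both
conjugacies send the half-axis into the half-diagonal, then F = G ≥ 0 along a set accumulating at 0;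
so F = 1 there, and everywhere near 0 by analyticity. -/

/-- The space of real double sequences `a (i, j)` with `∑ |a (i, j)| < ∞`, to be thought of as
the power series in two variables that converge absolutely on the closed unit bidisc. -/
def AbsSeries : Type := lp (fun _ : ℕ × ℕ => ℝ) 1

/-! ### The Banach algebra of absolutely convergent double series -/

namespace AbsSeries

noncomputable instance : NormedAddCommGroup AbsSeries :=
  inferInstanceAs (NormedAddCommGroup (lp (fun _ : ℕ × ℕ => ℝ) 1))

noncomputable instance : NormedSpace ℝ AbsSeries :=
  inferInstanceAs (NormedSpace ℝ (lp (fun _ : ℕ × ℕ => ℝ) 1))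

instance : CompleteSpace AbsSeries :=
  inferInstanceAs (CompleteSpace (lp (fun _ : ℕ × ℕ => ℝ) 1))

/-- The coefficient of a series at a given index. -/
noncomputable def coeff (a : AbsSeries) (d : ℕ × ℕ) : ℝ := a.1 d

/-- The monomial with coefficient `1` at the index `d`. -/
noncomputable def mono (d : ℕ × ℕ) : AbsSeries := lp.single 1 d (1 : ℝ)

theorem hasSum_norm_coeff (a : AbsSeries) : HasSum (fun d => |a.coeff d|) ‖a‖ := by
  have := lp.hasSum_norm (p := 1) (by simp) (f := (a : lp (fun _ : ℕ × ℕ => ℝ) 1))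
  simp only [ENNReal.toReal_one, Real.rpow_one] at this
  exact this

theorem norm_mono (d : ℕ × ℕ) : ‖mono d‖ = 1 := by
  exact (lp.norm_single (p := 1) (E := fun _ : ℕ × ℕ => ℝ) (by simp) d 1).trans norm_one

theorem hasSum_mono (a : AbsSeries) : HasSum (fun d => a.coeff d • mono d) a := by
  have := lp.hasSum_single (p := 1) (by simp) (a : lp (fun _ : ℕ × ℕ => ℝ) 1)
  have h : (fun d => a.coeff d • mono d) =
      fun d => lp.single (E := fun _ : ℕ × ℕ => ℝ) 1 d (a.coeff d) := by
    funext d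
    have h := lp.single_smul (p := 1) (E := fun _ : ℕ × ℕ => ℝ) d (a.coeff d) (1 : ℝ)
    rw [smul_eq_mul, mul_one] at h
    exact h.symm
  rw [h]
  exact this

theorem coeff_mono (d e : ℕ × ℕ) : (mono d).coeff e = if d = e then 1 else 0 := by
  change Pi.single (M := fun _ : ℕ × ℕ => ℝ) d 1 e = _
  rw [Pi.single_apply]; simp [eq_comm]

@[simp] theorem coeff_add (a b : AbsSeries) (d : ℕ × ℕ) :
    (a + b).coeff d = a.coeff d + b.coeff d := rfl

@[simp] theorem coeff_zero (d : ℕ × ℕ) : (0 : AbsSeries).coeff d = 0 := rfl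

@[simp] theorem coeff_smul (c : ℝ) (a : AbsSeries) (d : ℕ × ℕ) :
    (c • a).coeff d = c * a.coeff d := rfl

theorem ext_coeff {a b : AbsSeries} (h : ∀ d, a.coeff d = b.coeff d) : a = b :=
  lp.ext (funext h)

variable {E G : Type*} [NormedAddCommGroup E] [NormedSpace ℝ E]
  [NormedAddCommGroup G] [NormedSpace ℝ G]

theorem summable_norm_coeff_smul {w : ℕ × ℕ → E} {K : ℝ} (hw : ∀ d, ‖w d‖ ≤ K) (a : AbsSeries) :
    Summable fun d => ‖a.coeff d • w d‖ := by
  refine Summable.of_nonneg_of_le (fun _ => norm_nonneg _) (fun d => ?_)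
    (a.hasSum_norm_coeff.summable.mul_right K)
  rw [norm_smul, Real.norm_eq_abs]
  exact mul_le_mul_of_nonneg_left (hw d) (abs_nonneg _)

/-- The monomials span a dense subspace. Most identities between operators on series are reduced by
this to identities between exponents. -/
theorem clm_ext {S T : AbsSeries →L[ℝ] E} (h : ∀ d, S (mono d) = T (mono d)) : S = T := by
  ext a
  have h1 := a.hasSum_mono.mapL S
  have h2 := a.hasSum_mono.mapL T
  simp only [map_smul, h] at h1 h2
  exact h1.unique h2

variable [CompleteSpace E] [CompleteSpace G]

theorem summable_coeff_smul {w : ℕ × ℕ → E} {K : ℝ} (hw : ∀ d, ‖w d‖ ≤ K) (a : AbsSeries) :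
    Summable fun d => a.coeff d • w d :=
  (summable_norm_coeff_smul hw a).of_norm

open Classical in
/-- The continuous linear map that maps the monomials to a given bounded family. -/
noncomputable def lift (w : ℕ × ℕ → E) : AbsSeries →L[ℝ] E :=
  if h : ∃ K : ℝ, ∀ d, ‖w d‖ ≤ K then
    LinearMap.mkContinuous
      { toFun := fun a => ∑' d, a.coeff d • w d
        map_add' := fun a b => by
          obtain ⟨K, hK⟩ := h
          rw [← Summable.tsum_add (summable_coeff_smul hK a) (summable_coeff_smul hK b)]
          simp [add_smul]
        map_smul' := fun c a => by
          obtain ⟨K, hK⟩ := h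
          rw [RingHom.id_apply, ← Summable.tsum_const_smul _ (summable_coeff_smul hK a)]
          simp [mul_smul] } h.choose fun a => by
        have hK := h.choose_spec
        refine (norm_tsum_le_tsum_norm (summable_norm_coeff_smul hK a)).trans ?_
        rw [mul_comm, ← a.hasSum_norm_coeff.tsum_eq, ← tsum_mul_right]
        refine Summable.tsum_le_tsum (fun d => ?_) (summable_norm_coeff_smul hK a)
          (a.hasSum_norm_coeff.summable.mul_right _)
        rw [norm_smul, Real.norm_eq_abs]
        exact mul_le_mul_of_nonneg_left (hK d) (abs_nonneg _)
  else 0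

theorem lift_apply {w : ℕ × ℕ → E} {K : ℝ} (hw : ∀ d, ‖w d‖ ≤ K) (a : AbsSeries) :
    lift w a = ∑' d, a.coeff d • w d := by
  rw [lift, dif_pos ⟨K, hw⟩]; rfl

theorem hasSum_lift {w : ℕ × ℕ → E} {K : ℝ} (hw : ∀ d, ‖w d‖ ≤ K) (a : AbsSeries) :
    HasSum (fun d => a.coeff d • w d) (lift w a) := by
  rw [lift_apply hw]; exact (summable_coeff_smul hw a).hasSum

theorem norm_lift_le {w : ℕ × ℕ → E} {K : ℝ} (hw : ∀ d, ‖w d‖ ≤ K) (a : AbsSeries) :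
    ‖lift w a‖ ≤ K * ‖a‖ := by
  rw [lift_apply hw]
  refine (norm_tsum_le_tsum_norm (summable_norm_coeff_smul hw a)).trans ?_
  rw [mul_comm, ← a.hasSum_norm_coeff.tsum_eq, ← tsum_mul_right]
  refine Summable.tsum_le_tsum (fun d => ?_) (summable_norm_coeff_smul hw a)
    (a.hasSum_norm_coeff.summable.mul_right _)
  rw [norm_smul, Real.norm_eq_abs]
  exact mul_le_mul_of_nonneg_left (hw d) (abs_nonneg _)

theorem lift_mono {w : ℕ × ℕ → E} {K : ℝ} (hw : ∀ d, ‖w d‖ ≤ K) (d : ℕ × ℕ) :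
    lift w (mono d) = w d := by
  rw [lift_apply hw, tsum_eq_single d]
  · simp [coeff_mono]
  · intro e he; simp [coeff_mono, he.symm]

theorem clm_lift {w : ℕ × ℕ → E} {K : ℝ} (hw : ∀ d, ‖w d‖ ≤ K) (S : E →L[ℝ] G) (a : AbsSeries) :
    S (lift w a) = lift (fun d => S (w d)) a := by
  have hw' : ∀ d, ‖S (w d)‖ ≤ ‖S‖ * K := fun d =>
    (S.le_opNorm _).trans (mul_le_mul_of_nonneg_left (hw d) (norm_nonneg _))
  have h1 := (hasSum_lift hw a).mapL S
  simp only [map_smul] at h1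
  exact h1.unique (hasSum_lift hw' a)

/-- Translation of the coefficients, that is, multiplication by a monomial. -/
noncomputable def shift (d : ℕ × ℕ) : AbsSeries →L[ℝ] AbsSeries := lift fun e => mono (d + e)

theorem shift_mono (d e : ℕ × ℕ) : shift d (mono e) = mono (d + e) :=
  lift_mono (K := 1) (fun _ => (norm_mono _).le) e

theorem norm_shift_le (d : ℕ × ℕ) : ‖shift d‖ ≤ 1 :=
  ContinuousLinearMap.opNorm_le_bound _ zero_le_one
    fun a => norm_lift_le (fun _ => (norm_mono _).le) a

/-- The multiplication of power series, as a continuous bilinear map. -/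
noncomputable def mulL : AbsSeries →L[ℝ] AbsSeries →L[ℝ] AbsSeries := lift shift

theorem mulL_mono (d e : ℕ × ℕ) : mulL (mono d) (mono e) = mono (d + e) := by
  rw [mulL, lift_mono norm_shift_le, shift_mono]

noncomputable instance : Mul AbsSeries := ⟨fun a b => mulL a b⟩

noncomputable instance : One AbsSeries := ⟨mono 0⟩

theorem mul_def (a b : AbsSeries) : a * b = mulL a b := rfl

theorem one_def : (1 : AbsSeries) = mono 0 := rfl

theorem mulL_comm : mulL.flip = mulL :=
  clm_ext fun d => clm_ext fun e => by
    rw [ContinuousLinearMap.flip_apply, mulL_mono, mulL_mono, add_comm]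

noncomputable instance : NormedCommRing AbsSeries :=
  { (inferInstance : NormedAddCommGroup AbsSeries) with
    mul := (· * ·)
    one := 1
    left_distrib := fun a b c => map_add (mulL a) b c
    right_distrib := fun a b c => by simp only [mul_def, map_add, add_apply]
    zero_mul := fun a => by simp only [mul_def, map_zero, zero_apply]
    mul_zero := fun a => by simp only [mul_def, map_zero]
    mul_comm := fun a b => by
      rw [mul_def, mul_def, ← ContinuousLinearMap.flip_apply, mulL_comm]
    one_mul := fun a => by
      have : mulL (mono 0) = ContinuousLinearMap.id ℝ AbsSeries :=
        clm_ext fun e => by rw [mulL_mono, zero_add]; rfl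
      change mulL (mono 0) a = a
      rw [this]; rfl
    mul_one := fun a => by
      have : mulL.flip (mono 0) = ContinuousLinearMap.id ℝ AbsSeries :=
        clm_ext fun e => by rw [ContinuousLinearMap.flip_apply, mulL_mono, add_zero]; rfl
      change mulL.flip (mono 0) a = a
      rw [this]; rfl
    mul_assoc := fun a b c => by
      -- Associativity holds for monomials; each of the three variables is freed in turn by density.
      have key : ∀ d e, (mulL (mulL (mono d) (mono e))) = (mulL (mono d)) ∘L (mulL (mono e)) :=
        fun d e => clm_ext fun f => by
          simp [mulL_mono, add_assoc]
      have key2 : ∀ d, mulL ∘L mulL (mono d) =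
          (ContinuousLinearMap.compL ℝ AbsSeries AbsSeries AbsSeries (mulL (mono d))) ∘L mulL :=
        fun d => clm_ext fun e => key d e
      have key3 : ∀ b c : AbsSeries, (mulL.flip c) ∘L (mulL.flip b) = mulL.flip (mulL b c) :=
        fun b c => clm_ext fun d => congrArg (fun S => S b c) (key2 d)
      exact congrArg (fun S => S a) (key3 b c)
    norm_mul_le := fun a b => by
      have : ‖mulL a‖ ≤ 1 * ‖a‖ := norm_lift_le norm_shift_le a
      exact ((mulL a).le_opNorm b).trans
        (mul_le_mul_of_nonneg_right (by simpa using this) (norm_nonneg _)) }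

noncomputable instance : NormOneClass AbsSeries := ⟨norm_mono 0⟩

noncomputable instance : Algebra ℝ AbsSeries :=
  Algebra.ofModule (fun c a b => by simp only [mul_def, map_smul, smul_apply])
    (fun c a b => by simp only [mul_def, map_smul])

noncomputable instance : NormedAlgebra ℝ AbsSeries :=
  { norm_smul_le := fun c a => norm_smul_le c a }

theorem map_mul_of_mono {R : Type*} [NormedCommRing R] [NormedAlgebra ℝ R]
    {S : AbsSeries →L[ℝ] R} (h : ∀ d e, S (mono (d + e)) = S (mono d) * S (mono e))
    (a b : AbsSeries) : S (a * b) = S a * S b := by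
  have h1 : ∀ d, S ∘L mulL (mono d) = (ContinuousLinearMap.mul ℝ R (S (mono d))) ∘L S :=
    fun d => clm_ext fun e => by simp [mulL_mono, h]
  have h2 : S ∘L mulL.flip b = (ContinuousLinearMap.mul ℝ R).flip (S b) ∘L S :=
    clm_ext fun d => congrArg (fun S => S b) (h1 d)
  exact congrArg (fun S => S a) h2

end AbsSeries

/-! ### Substitution and evaluation -/

namespace AbsSeries

section Subst

set_option linter.unusedSectionVars false

variable {R : Type*} [NormedCommRing R] [NormedAlgebra ℝ R] [NormOneClass R] [CompleteSpace R]

/-- The substitution of two elements of norm at most `1` of a Banach algebra into a series. -/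
noncomputable def subst (x y : R) : AbsSeries →L[ℝ] R := lift fun d => x ^ d.1 * y ^ d.2

theorem norm_pow_mul_pow_le {x y : R} {M : ℝ} (hx : ‖x‖ ≤ M) (hy : ‖y‖ ≤ M) (d : ℕ × ℕ) :
    ‖x ^ d.1 * y ^ d.2‖ ≤ M ^ (d.1 + d.2) := by
  rw [pow_add]
  refine (norm_mul_le _ _).trans (mul_le_mul ?_ ?_ (norm_nonneg _) ?_)
  · exact (norm_pow_le _ _).trans (pow_le_pow_left₀ (norm_nonneg _) hx _)
  · exact (norm_pow_le _ _).trans (pow_le_pow_left₀ (norm_nonneg _) hy _)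
  · exact pow_nonneg ((norm_nonneg _).trans hx) _

theorem norm_pow_mul_pow_le_one {x y : R} (hx : ‖x‖ ≤ 1) (hy : ‖y‖ ≤ 1) (d : ℕ × ℕ) :
    ‖x ^ d.1 * y ^ d.2‖ ≤ 1 := by
  simpa using norm_pow_mul_pow_le hx hy d

theorem subst_mono {x y : R} (hx : ‖x‖ ≤ 1) (hy : ‖y‖ ≤ 1) (d : ℕ × ℕ) :
    subst x y (mono d) = x ^ d.1 * y ^ d.2 :=
  lift_mono (norm_pow_mul_pow_le_one hx hy) d

theorem hasSum_subst {x y : R} (hx : ‖x‖ ≤ 1) (hy : ‖y‖ ≤ 1) (a : AbsSeries) :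
    HasSum (fun d => a.coeff d • (x ^ d.1 * y ^ d.2)) (subst x y a) :=
  hasSum_lift (norm_pow_mul_pow_le_one hx hy) a

theorem subst_mul {x y : R} (hx : ‖x‖ ≤ 1) (hy : ‖y‖ ≤ 1) (a b : AbsSeries) :
    subst x y (a * b) = subst x y a * subst x y b := by
  refine map_mul_of_mono (fun d e => ?_) a b
  simp only [subst_mono hx hy, Prod.fst_add, Prod.snd_add, pow_add]
  ring

theorem subst_one {x y : R} (hx : ‖x‖ ≤ 1) (hy : ‖y‖ ≤ 1) : subst x y (1 : AbsSeries) = 1 := by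
  rw [one_def, subst_mono hx hy]; simp

theorem subst_pow {x y : R} (hx : ‖x‖ ≤ 1) (hy : ‖y‖ ≤ 1) (a : AbsSeries) (n : ℕ) :
    subst x y (a ^ n) = subst x y a ^ n := by
  induction n with
  | zero => simpa using subst_one hx hy
  | succ n ih => rw [pow_succ, pow_succ, subst_mul hx hy, ih]

theorem norm_subst_le {x y : R} (hx : ‖x‖ ≤ 1) (hy : ‖y‖ ≤ 1) (a : AbsSeries) :
    ‖subst x y a‖ ≤ ‖a‖ := by
  exact (norm_lift_le (norm_pow_mul_pow_le_one hx hy) a).trans_eq (one_mul _)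

theorem subst_subst {x y : R} (hx : ‖x‖ ≤ 1) (hy : ‖y‖ ≤ 1) {a b : AbsSeries} (ha : ‖a‖ ≤ 1)
    (hb : ‖b‖ ≤ 1) (f : AbsSeries) :
    subst x y (subst a b f) = subst (subst x y a) (subst x y b) f := by
  rw [subst, subst, clm_lift (norm_pow_mul_pow_le_one ha hb)]
  change lift (fun d => subst x y (a ^ d.1 * b ^ d.2)) f = _
  simp only [subst_mul hx hy, subst_pow hx hy]
  rfl

/-- A series all of whose terms have degree at least two. -/
def OrderTwo (f : AbsSeries) : Prop := ∀ d : ℕ × ℕ, d.1 + d.2 < 2 → f.coeff d = 0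

theorem OrderTwo.norm_lift_le {f : AbsSeries} (hf : OrderTwo f) {w : ℕ × ℕ → R} {K K' : ℝ}
    (hw : ∀ d, ‖w d‖ ≤ K) (hw' : ∀ d : ℕ × ℕ, 2 ≤ d.1 + d.2 → ‖w d‖ ≤ K') (hK' : 0 ≤ K') :
    ‖lift w f‖ ≤ K' * ‖f‖ := by
  have : lift w f = lift (fun d => if 2 ≤ d.1 + d.2 then w d else 0) f := by
    rw [lift_apply hw, lift_apply (K := K')]
    · refine tsum_congr fun d => ?_
      split_ifs with h
      · rfl
      · rw [hf d (by omega)]; simp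
    · intro d
      split_ifs with h
      · exact hw' d h
      · simpa using hK'
  rw [this]
  refine AbsSeries.norm_lift_le (fun d => ?_) f
  split_ifs with h
  · exact hw' d h
  · simpa using hK'

/-- The source of smallness in the fixed point argument: on a ball of radius M the nonlinearity is
of size M², and by `OrderTwo.norm_subst_sub_le` its Lipschitz constant is of size M. -/
theorem OrderTwo.norm_subst_le {f : AbsSeries} (hf : OrderTwo f) {x y : R} {M : ℝ} (hM : M ≤ 1)
    (hx : ‖x‖ ≤ M) (hy : ‖y‖ ≤ M) : ‖subst x y f‖ ≤ M ^ 2 * ‖f‖ := by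
  have hM0 : 0 ≤ M := (norm_nonneg _).trans hx
  refine hf.norm_lift_le (norm_pow_mul_pow_le_one (hx.trans hM) (hy.trans hM)) (fun d hd => ?_)
    (by positivity)
  exact (norm_pow_mul_pow_le hx hy d).trans (pow_le_pow_of_le_one hM0 hM hd)

theorem norm_pow_sub_pow_le {x x' : R} {M D : ℝ} (hx : ‖x‖ ≤ M) (hx' : ‖x'‖ ≤ M)
    (hD : ‖x - x'‖ ≤ D) (n : ℕ) : ‖x ^ n - x' ^ n‖ ≤ n * M ^ (n - 1) * D := by
  have hM0 : 0 ≤ M := (norm_nonneg _).trans hx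
  have hD0 : 0 ≤ D := (norm_nonneg _).trans hD
  induction n with
  | zero => simp
  | succ n ih =>
    have : x ^ (n + 1) - x' ^ (n + 1) = (x ^ n - x' ^ n) * x + x' ^ n * (x - x') := by ring
    rw [this]
    have h1 : ‖(x ^ n - x' ^ n) * x‖ ≤ n * M ^ (n - 1) * D * M :=
      (norm_mul_le _ _).trans (mul_le_mul ih hx (norm_nonneg _) (by positivity))
    have h2 : ‖x' ^ n * (x - x')‖ ≤ M ^ n * D :=
      (norm_mul_le _ _).trans (mul_le_mul ((norm_pow_le _ _).trans
        (pow_le_pow_left₀ (norm_nonneg _) hx' _)) hD (norm_nonneg _) (by positivity))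
    refine (norm_add_le _ _).trans ((add_le_add h1 h2).trans (le_of_eq ?_))
    rcases n with _ | n
    · simp
    · simp only [Nat.add_sub_cancel]; push_cast; ring

theorem norm_pow_mul_pow_sub_le {x y x' y' : R} {M D : ℝ} (hx : ‖x‖ ≤ M) (hy : ‖y‖ ≤ M)
    (hx' : ‖x'‖ ≤ M) (hy' : ‖y'‖ ≤ M) (hD : ‖x - x'‖ ≤ D) (hD' : ‖y - y'‖ ≤ D) (d : ℕ × ℕ) :
    ‖x ^ d.1 * y ^ d.2 - x' ^ d.1 * y' ^ d.2‖ ≤ (d.1 + d.2 : ℕ) * M ^ (d.1 + d.2 - 1) * D := by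
  have hM0 : 0 ≤ M := (norm_nonneg _).trans hx
  have hD0 : 0 ≤ D := (norm_nonneg _).trans hD
  obtain ⟨i, j⟩ := d
  have : x ^ i * y ^ j - x' ^ i * y' ^ j = (x ^ i - x' ^ i) * y ^ j + x' ^ i * (y ^ j - y' ^ j) := by
    ring
  simp only [this]
  have h1 : ‖(x ^ i - x' ^ i) * y ^ j‖ ≤ i * M ^ (i - 1) * D * M ^ j :=
    (norm_mul_le _ _).trans (mul_le_mul (norm_pow_sub_pow_le hx hx' hD i)
      ((norm_pow_le _ _).trans (pow_le_pow_left₀ (norm_nonneg _) hy _)) (norm_nonneg _)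
      (by positivity))
  have h2 : ‖x' ^ i * (y ^ j - y' ^ j)‖ ≤ M ^ i * (j * M ^ (j - 1) * D) :=
    (norm_mul_le _ _).trans (mul_le_mul ((norm_pow_le _ _).trans
      (pow_le_pow_left₀ (norm_nonneg _) hx' _)) (norm_pow_sub_pow_le hy hy' hD' j)
      (norm_nonneg _) (by positivity))
  refine (norm_add_le _ _).trans ((add_le_add h1 h2).trans (le_of_eq ?_))
  rcases i with _ | i <;> rcases j with _ | j
  · simp
  · simp
  · simp
  · have e : i + 1 + (j + 1) - 1 = i + j + 1 := by omega
    rw [e]; simp only [Nat.add_sub_cancel]; push_cast; ring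

theorem nat_mul_half_pow_le (n : ℕ) (hn : 2 ≤ n) {M : ℝ} (hM0 : 0 ≤ M) (hM : M ≤ 1 / 2) :
    n * M ^ (n - 1) ≤ 2 * M := by
  induction n, hn using Nat.le_induction with
  | base => simp
  | succ n hn ih =>
    have hn' : (2 : ℝ) ≤ n := by exact_mod_cast hn
    have e : M ^ (n + 1 - 1) = M ^ (n - 1) * M := by rw [← pow_succ]; congr 1; omega
    rw [e]
    have h0 : 0 ≤ M ^ (n - 1) := by positivity
    have : ((n + 1 : ℕ) : ℝ) * M ≤ n := by push_cast; nlinarith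
    nlinarith

theorem OrderTwo.norm_subst_sub_le {f : AbsSeries} (hf : OrderTwo f) {x y x' y' : R} {M D : ℝ}
    (hM : M ≤ 1 / 2) (hx : ‖x‖ ≤ M) (hy : ‖y‖ ≤ M)
    (hx' : ‖x'‖ ≤ M) (hy' : ‖y'‖ ≤ M) (hD : ‖x - x'‖ ≤ D) (hD' : ‖y - y'‖ ≤ D) :
    ‖subst x y f - subst x' y' f‖ ≤ 2 * M * D * ‖f‖ := by
  have hM0 : 0 ≤ M := (norm_nonneg _).trans hx
  have hD0 : 0 ≤ D := (norm_nonneg _).trans hD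
  have h1 : M ≤ 1 := by linarith
  have b1 := norm_pow_mul_pow_le_one (hx.trans h1) (hy.trans h1)
  have b2 := norm_pow_mul_pow_le_one (hx'.trans h1) (hy'.trans h1)
  have b3 : ∀ d : ℕ × ℕ, ‖x ^ d.1 * y ^ d.2 - x' ^ d.1 * y' ^ d.2‖ ≤ 1 + 1 := fun d =>
    (norm_sub_le _ _).trans (add_le_add (b1 d) (b2 d))
  have e : subst x y f - subst x' y' f =
      lift (fun d => x ^ d.1 * y ^ d.2 - x' ^ d.1 * y' ^ d.2) f := by
    refine HasSum.unique ?_ (hasSum_lift b3 f)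
    have := (hasSum_lift b1 f).sub (hasSum_lift b2 f)
    simp only [← smul_sub] at this
    exact this
  rw [e]
  refine hf.norm_lift_le b3 (fun d hd => ?_) (by positivity)
  refine (norm_pow_mul_pow_sub_le hx hy hx' hy' hD hD' d).trans ?_
  exact mul_le_mul_of_nonneg_right (nat_mul_half_pow_le _ hd hM0 hM) hD0

end Subst

/-- The value of a series at a point of the closed unit bidisc. -/
noncomputable def ev (p : ℝ × ℝ) : AbsSeries →L[ℝ] ℝ := subst p.1 p.2

theorem norm_fst_le_one {p : ℝ × ℝ} (hp : ‖p‖ ≤ 1) : ‖p.1‖ ≤ 1 := (norm_fst_le p).trans hp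
theorem norm_snd_le_one {p : ℝ × ℝ} (hp : ‖p‖ ≤ 1) : ‖p.2‖ ≤ 1 := (norm_snd_le p).trans hp

theorem ev_mono {p : ℝ × ℝ} (hp : ‖p‖ ≤ 1) (d : ℕ × ℕ) : ev p (mono d) = p.1 ^ d.1 * p.2 ^ d.2 :=
  subst_mono (norm_fst_le_one hp) (norm_snd_le_one hp) d

theorem hasSum_ev {p : ℝ × ℝ} (hp : ‖p‖ ≤ 1) (a : AbsSeries) :
    HasSum (fun d => a.coeff d * (p.1 ^ d.1 * p.2 ^ d.2)) (ev p a) :=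
  hasSum_subst (norm_fst_le_one hp) (norm_snd_le_one hp) a

theorem ev_mul {p : ℝ × ℝ} (hp : ‖p‖ ≤ 1) (a b : AbsSeries) : ev p (a * b) = ev p a * ev p b :=
  subst_mul (norm_fst_le_one hp) (norm_snd_le_one hp) a b

theorem ev_pow {p : ℝ × ℝ} (hp : ‖p‖ ≤ 1) (a : AbsSeries) (n : ℕ) : ev p (a ^ n) = ev p a ^ n :=
  subst_pow (norm_fst_le_one hp) (norm_snd_le_one hp) a n

theorem abs_ev_le {p : ℝ × ℝ} (hp : ‖p‖ ≤ 1) (a : AbsSeries) : |ev p a| ≤ ‖a‖ :=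
  norm_subst_le (norm_fst_le_one hp) (norm_snd_le_one hp) a

theorem ev_lift {w : ℕ × ℕ → AbsSeries} {K : ℝ} (hw : ∀ d, ‖w d‖ ≤ K) (p : ℝ × ℝ) (a : AbsSeries) :
    ev p (lift w a) = lift (fun d => ev p (w d)) a := clm_lift hw _ a

/-- The coefficient of a series at a given index, as a continuous linear map. -/
noncomputable def coeffL (d : ℕ × ℕ) : AbsSeries →L[ℝ] ℝ := lift fun e => if e = d then 1 else 0

theorem coeffL_apply (d : ℕ × ℕ) (a : AbsSeries) : coeffL d a = a.coeff d := by
  have hw : ∀ e : ℕ × ℕ, ‖(if e = d then (1 : ℝ) else 0)‖ ≤ 1 := fun e => by split_ifs <;> simp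
  rw [coeffL, lift_apply hw, tsum_eq_single d]
  · simp
  · intro e he; simp [he]

theorem coeff_lift {w : ℕ × ℕ → AbsSeries} {K : ℝ} (hw : ∀ d, ‖w d‖ ≤ K) (a : AbsSeries)
    (e : ℕ × ℕ) : HasSum (fun d => a.coeff d * (w d).coeff e) ((lift w a).coeff e) := by
  have := (hasSum_lift hw a).mapL (coeffL e)
  simpa only [map_smul, coeffL_apply, smul_eq_mul] using this

theorem coeff_zero_eq_ev (a : AbsSeries) : a.coeff 0 = ev 0 a := by
  rw [← coeffL_apply]
  refine congrArg (fun S => S a) (clm_ext (S := coeffL 0) (T := ev 0) fun d => ?_)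
  rw [coeffL_apply, coeff_mono, ev_mono (by simp)]
  obtain ⟨i, j⟩ := d
  rcases i with _ | i <;> rcases j with _ | j <;> simp

/-! ### The grading by weight -/

/-- The weight of the monomial `x ^ i * y ^ j` is `i - j`. -/
def wt (d : ℕ × ℕ) : ℤ := d.1 - d.2

theorem wt_add (d e : ℕ × ℕ) : wt (d + e) = wt d + wt e := by
  simp only [wt, Prod.fst_add, Prod.snd_add]; push_cast; ring

/-- All terms of the series are of weight `k`. -/
def IsHomog (k : ℤ) (a : AbsSeries) : Prop := ∀ d, wt d ≠ k → a.coeff d = 0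

theorem isHomog_mono (d : ℕ × ℕ) : IsHomog (wt d) (mono d) := fun e he => by
  rw [coeff_mono, if_neg]; rintro rfl; exact he rfl

theorem IsHomog.lift {k : ℤ} {w : ℕ × ℕ → AbsSeries} {K : ℝ} (hw : ∀ d, ‖w d‖ ≤ K)
    (h : ∀ d, IsHomog k (w d)) (a : AbsSeries) : IsHomog k (lift w a) := fun e he => by
  have := coeff_lift hw a e
  simp only [fun d => h d e he, mul_zero] at this
  exact this.unique hasSum_zero

theorem IsHomog.add {k : ℤ} {a b : AbsSeries} (ha : IsHomog k a) (hb : IsHomog k b) :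
    IsHomog k (a + b) := fun d hd => by rw [coeff_add, ha d hd, hb d hd, add_zero]

theorem IsHomog.smul {k : ℤ} {a : AbsSeries} (ha : IsHomog k a) (c : ℝ) :
    IsHomog k (c • a) := fun d hd => by rw [coeff_smul, ha d hd, mul_zero]

theorem isHomog_zero (k : ℤ) : IsHomog k 0 := fun d _ => by
  rw [← coeffL_apply, map_zero]

theorem isHomog_one : IsHomog 0 1 := isHomog_mono 0

theorem IsHomog.mul {k l : ℤ} {a b : AbsSeries} (ha : IsHomog k a) (hb : IsHomog l b) :
    IsHomog (k + l) (a * b) := fun f hf => by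
  have h1 := a.hasSum_mono.mapL (coeffL f ∘L mulL.flip b)
  have h2 : ∀ d, (coeffL f ∘L mulL.flip b) (a.coeff d • mono d) = 0 := fun d => by
    by_cases hd : wt d = k
    · have h3 := b.hasSum_mono.mapL (coeffL f ∘L mulL (mono d))
      have h4 : ∀ e, (coeffL f ∘L mulL (mono d)) (b.coeff e • mono e) = 0 := fun e => by
        by_cases he : wt e = l
        · rw [map_smul, ContinuousLinearMap.comp_apply, mulL_mono, coeffL_apply, coeff_mono,
            if_neg, smul_zero]
          rintro rfl
          exact hf (by rw [wt_add, hd, he])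
        · rw [hb e he, zero_smul, map_zero]
      simp only [h4] at h3
      rw [map_smul]
      have := h3.unique hasSum_zero
      simp only [ContinuousLinearMap.comp_apply, ContinuousLinearMap.flip_apply] at this ⊢
      rw [this, smul_zero]
    · rw [ha d hd, zero_smul, map_zero]
  simp only [h2] at h1
  have := h1.unique hasSum_zero
  rw [← coeffL_apply]
  exact this

theorem IsHomog.pow {a : AbsSeries} (ha : IsHomog 0 a) (n : ℕ) : IsHomog 0 (a ^ n) := by
  induction n with
  | zero => rw [pow_zero]; exact isHomog_one
  | succ n ih => rw [pow_succ]; simpa using ih.mul ha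

/-- The normal form acts on each point as (x, y) ↦ (tx, t⁻¹y), with t depending on xy only. Since
xⁱyʲ picks up the factor tⁱ⁻ʲ, the weights diagonalize composition with it. -/
theorem IsHomog.ev_scale {k : ℤ} {a : AbsSeries} (ha : IsHomog k a) {p : ℝ × ℝ} (hp : ‖p‖ ≤ 1)
    {t : ℝ} (ht : t ≠ 0) (hq : ‖(t * p.1, t⁻¹ * p.2)‖ ≤ 1) :
    ev (t * p.1, t⁻¹ * p.2) a = t ^ k * ev p a := by
  have h := (hasSum_ev hp a).mul_left (t ^ k)
  refine HasSum.unique ?_ h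
  convert! hasSum_ev hq a using 2 with d
  by_cases hd : wt d = k
  · have : t ^ k = t ^ d.1 * (t⁻¹) ^ d.2 := by
      rw [← hd, wt, zpow_sub₀ ht, zpow_natCast, zpow_natCast, inv_pow, div_eq_mul_inv]
    simp only [this, mul_pow]; ring
  · rw [ha d hd]; ring

theorem IsHomog.ev_eq_of_mul_eq {a : AbsSeries} (ha : IsHomog 0 a) {p q : ℝ × ℝ} (hp : ‖p‖ ≤ 1)
    (hq : ‖q‖ ≤ 1) (h : p.1 * p.2 = q.1 * q.2) : ev p a = ev q a := by
  refine HasSum.unique (hasSum_ev hp a) ?_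
  convert! hasSum_ev hq a using 2 with d
  by_cases hd : wt d = 0
  · have : d.1 = d.2 := by simp only [wt] at hd; omega
    rw [this, ← mul_pow, ← mul_pow, h]
  · rw [ha d hd]; ring

/-- Exchange of the two variables. -/
noncomputable def swapL : AbsSeries →L[ℝ] AbsSeries := lift fun d => mono d.swap

theorem norm_swapL_le (a : AbsSeries) : ‖swapL a‖ ≤ ‖a‖ := by
  simpa [swapL] using norm_lift_le (fun d => (norm_mono d.swap).le) a

theorem ev_swapL {p : ℝ × ℝ} (hp : ‖p‖ ≤ 1) (a : AbsSeries) : ev p (swapL a) = ev p.swap a := by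
  have hp' : ‖p.swap‖ ≤ 1 := by rwa [Prod.norm_def, Prod.fst_swap, Prod.snd_swap, max_comm]
  refine congrArg (fun S => S a) (clm_ext (S := ev p ∘L swapL) (T := ev p.swap) fun d => ?_)
  rw [ContinuousLinearMap.comp_apply, swapL, lift_mono (fun d => (norm_mono d.swap).le),
    ev_mono hp, ev_mono hp']
  simp [mul_comm]

open Classical in
/-- The part of weight `k` of a series. -/
noncomputable def part (k : ℤ) : AbsSeries →L[ℝ] AbsSeries :=
  lift fun d => if wt d = k then mono d else 0

open Classical in
theorem norm_part_aux (k : ℤ) (d : ℕ × ℕ) : ‖if wt d = k then mono d else 0‖ ≤ 1 := by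
  split_ifs
  · exact (norm_mono d).le
  · simp

theorem norm_part_le (k : ℤ) (a : AbsSeries) : ‖part k a‖ ≤ ‖a‖ := by
  simpa [part] using norm_lift_le (norm_part_aux k) a

theorem part_mono_of_eq {k : ℤ} {d : ℕ × ℕ} (h : wt d = k) : part k (mono d) = mono d := by
  rw [part, lift_mono (norm_part_aux k), if_pos h]

theorem part_mono_of_ne {k : ℤ} {d : ℕ × ℕ} (h : wt d ≠ k) : part k (mono d) = 0 := by
  rw [part, lift_mono (norm_part_aux k), if_neg h]

theorem coeff_part (k : ℤ) (a : AbsSeries) (e : ℕ × ℕ) :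
    (part k a).coeff e = if wt e = k then a.coeff e else 0 := by
  refine (coeff_lift (norm_part_aux k) a e).unique ?_
  convert! hasSum_ite_eq e (if wt e = k then a.coeff e else 0) using 2 with d
  by_cases hde : d = e
  · subst hde
    rw [if_pos rfl]
    split_ifs
    · simp [coeff_mono]
    · rw [coeff_zero, mul_zero]
  · rw [if_neg hde]
    split_ifs
    · simp [coeff_mono, hde]
    · rw [coeff_zero, mul_zero]

theorem isHomog_part (k : ℤ) (a : AbsSeries) : IsHomog k (part k a) := fun d hd => by
  rw [coeff_part, if_neg hd]

theorem IsHomog.part_eq {k : ℤ} {a : AbsSeries} (ha : IsHomog k a) : part k a = a :=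
  ext_coeff fun d => by
    rw [coeff_part]; split_ifs with h
    · rfl
    · exact (ha d h).symm

theorem IsHomog.part_eq_zero {k l : ℤ} {a : AbsSeries} (ha : IsHomog k a) (hkl : k ≠ l) :
    part l a = 0 :=
  ext_coeff fun d => by
    rw [coeff_part, ← coeffL_apply d 0, map_zero]; split_ifs with h
    · exact ha d (by rw [h]; exact hkl.symm)
    · rfl

theorem hasSum_part (a : AbsSeries) : HasSum (fun k => part k a) a := by
  have h := a.hasSum_mono.tsum_fiberwise wt
  convert! h using 2 with k
  rw [part, lift_apply (norm_part_aux k), tsum_subtype (wt ⁻¹' {k}) fun d => a.coeff d • mono d]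
  refine tsum_congr fun d => ?_
  simp only [indicator, mem_preimage, mem_singleton_iff]
  split_ifs <;> simp

theorem part_mul {k : ℤ} {b : AbsSeries} (hb : IsHomog 0 b) (a : AbsSeries) :
    part k (b * a) = b * part k a := by
  refine congrArg (fun S => S a)
    (clm_ext (S := part k ∘L mulL b) (T := mulL b ∘L part k) fun d => ?_)
  have hd : IsHomog (wt d) (b * mono d) := by simpa using hb.mul (isHomog_mono d)
  simp only [ContinuousLinearMap.comp_apply, ← mul_def]
  by_cases h : wt d = k
  · rw [part_mono_of_eq h, ← h, hd.part_eq]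
  · rw [part_mono_of_ne h, hd.part_eq_zero h, mul_zero]

end AbsSeries

/-! ### The fixed point problem for the semiconjugacy -/

namespace AbsSeries

/-- The operator that multiplies the part of weight `k` of a series by `α k * u ^ |k|`. -/
noncomputable def prop (u : AbsSeries) (α : ℤ → ℝ) : AbsSeries →L[ℝ] AbsSeries :=
  lift fun d => α (wt d) • (u ^ (wt d).natAbs * mono d)

theorem norm_prop_aux {u : AbsSeries} {α : ℤ → ℝ} {q K : ℝ} (hu : ‖u‖ ≤ q)
    (hα : ∀ k, |α k| * q ^ k.natAbs ≤ K) (d : ℕ × ℕ) :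
    ‖α (wt d) • (u ^ (wt d).natAbs * mono d)‖ ≤ K := by
  rw [norm_smul, Real.norm_eq_abs]
  refine (mul_le_mul_of_nonneg_left ?_ (abs_nonneg _)).trans (hα (wt d))
  refine (norm_mul_le _ _).trans ?_
  rw [norm_mono, mul_one]
  exact (norm_pow_le _ _).trans (pow_le_pow_left₀ (norm_nonneg _) hu _)

theorem norm_prop_le {u : AbsSeries} {α : ℤ → ℝ} {q K : ℝ} (hu : ‖u‖ ≤ q)
    (hα : ∀ k, |α k| * q ^ k.natAbs ≤ K) (a : AbsSeries) : ‖prop u α a‖ ≤ K * ‖a‖ :=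
  norm_lift_le (norm_prop_aux hu hα) a

/-- The constant does not depend on n, as q(1 - q)⁻¹ + 1 = (1 - q)⁻¹ closes the induction. This
uniformity is needed because `prop` involves all powers of u at once. -/
theorem norm_pow_sub_pow_le' {u u' : AbsSeries} {q : ℝ} (hq : q < 1) (hu : ‖u‖ ≤ q) (hu' : ‖u'‖ ≤ q)
    (n : ℕ) : ‖u ^ n - u' ^ n‖ ≤ (1 - q)⁻¹ * ‖u - u'‖ := by
  have hq0 : 0 ≤ q := (norm_nonneg _).trans hu
  have h1q : 0 < 1 - q := by linarith
  induction n with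
  | zero => simp; positivity
  | succ n ih =>
    have e : u ^ (n + 1) - u' ^ (n + 1) = u * (u ^ n - u' ^ n) + (u - u') * u' ^ n := by ring
    rw [e]
    have h1 : ‖u * (u ^ n - u' ^ n)‖ ≤ q * ((1 - q)⁻¹ * ‖u - u'‖) :=
      (norm_mul_le _ _).trans (mul_le_mul hu ih (norm_nonneg _) hq0)
    have h2 : ‖(u - u') * u' ^ n‖ ≤ ‖u - u'‖ * 1 :=
      (norm_mul_le _ _).trans (mul_le_mul_of_nonneg_left ((norm_pow_le _ _).trans
        ((pow_le_pow_left₀ (norm_nonneg _) hu' _).trans (pow_le_one₀ hq0 hq.le))) (norm_nonneg _))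
    refine (norm_add_le _ _).trans ((add_le_add h1 h2).trans (le_of_eq ?_))
    field_simp
    ring

theorem norm_prop_sub_le {u u' : AbsSeries} {α : ℤ → ℝ} {q κ : ℝ} (hq : q < 1) (hu : ‖u‖ ≤ q)
    (hu' : ‖u'‖ ≤ q) (hα : ∀ k, |α k| ≤ κ) (a : AbsSeries) :
    ‖prop u α a - prop u' α a‖ ≤ κ * ((1 - q)⁻¹ * ‖u - u'‖) * ‖a‖ := by
  have hq0 : 0 ≤ q := (norm_nonneg _).trans hu
  have hα' : ∀ k, |α k| * q ^ k.natAbs ≤ κ := fun k =>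
    (mul_le_of_le_one_right (abs_nonneg _) (pow_le_one₀ hq0 hq.le)).trans (hα k)
  have hb : ∀ d, ‖α (wt d) • (u ^ (wt d).natAbs * mono d) -
      α (wt d) • (u' ^ (wt d).natAbs * mono d)‖ ≤ κ * ((1 - q)⁻¹ * ‖u - u'‖) := fun d => by
    rw [← smul_sub, ← sub_mul, norm_smul, Real.norm_eq_abs]
    refine mul_le_mul (hα _) ((norm_mul_le _ _).trans ?_) (norm_nonneg _)
      ((abs_nonneg _).trans (hα 0))
    rw [norm_mono, mul_one]
    exact norm_pow_sub_pow_le' hq hu hu' _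
  have e : prop u α a - prop u' α a = lift (fun d => α (wt d) • (u ^ (wt d).natAbs * mono d) -
      α (wt d) • (u' ^ (wt d).natAbs * mono d)) a := by
    refine HasSum.unique ?_ (hasSum_lift hb a)
    have := (hasSum_lift (norm_prop_aux hu hα') a).sub (hasSum_lift (norm_prop_aux hu' hα') a)
    simp only [← smul_sub] at this ⊢
    exact this
  rw [e]
  exact norm_lift_le hb a

theorem part_prop {u : AbsSeries} (hu0 : IsHomog 0 u) {α : ℤ → ℝ} {q K : ℝ} (hu : ‖u‖ ≤ q)
    (hα : ∀ k, |α k| * q ^ k.natAbs ≤ K) (k : ℤ) (a : AbsSeries) :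
    part k (prop u α a) = α k • (u ^ k.natAbs * part k a) := by
  refine congrArg (fun S => S a) (clm_ext (S := part k ∘L prop u α)
    (T := α k • (mulL (u ^ k.natAbs) ∘L part k)) fun d => ?_)
  simp only [ContinuousLinearMap.comp_apply, smul_apply, ← mul_def]
  rw [prop, lift_mono (norm_prop_aux hu hα), map_smul, part_mul (hu0.pow _)]
  by_cases h : wt d = k
  · rw [h]
  · rw [part_mono_of_ne h]; simp

/-- The operator that maps `x * b` to `b` for a series `b` of weight `0`, and that vanishes on the
monomials whose weight is not `1`. -/
noncomputable def divX : AbsSeries →L[ℝ] AbsSeries :=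
  lift fun d => if wt d = 1 then mono (d.2, d.2) else 0

theorem norm_divX_aux (d : ℕ × ℕ) : ‖if wt d = 1 then mono (d.2, d.2) else 0‖ ≤ 1 := by
  split_ifs
  · exact (norm_mono _).le
  · simp

theorem norm_divX_le (a : AbsSeries) : ‖divX a‖ ≤ ‖a‖ := by
  simpa [divX] using norm_lift_le norm_divX_aux a

theorem isHomog_divX (a : AbsSeries) : IsHomog 0 (divX a) :=
  IsHomog.lift norm_divX_aux (fun d => by
    split_ifs
    · simpa [wt] using isHomog_mono (d.2, d.2)
    · exact isHomog_zero 0) a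

theorem mono_mul_divX (a : AbsSeries) : mono (1, 0) * divX a = part 1 a := by
  refine congrArg (fun S => S a) (clm_ext (S := mulL (mono (1, 0)) ∘L divX) (T := part 1)
    fun d => ?_)
  rw [ContinuousLinearMap.comp_apply, divX, lift_mono norm_divX_aux]
  split_ifs with h
  · rw [part_mono_of_eq h, mulL_mono]
    congr 1
    ext
    · simp only [wt] at h; simp; omega
    · simp
  · rw [part_mono_of_ne h, map_zero]

theorem exists_small {B s : ℝ} (hB : 0 ≤ B) (hs : 0 < s) :
    ∃ ε : ℝ, 0 < ε ∧ ε ≤ 1 / 4 ∧ ε * B ≤ s := by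
  refine ⟨min (1 / 4) (s / (B + 1)), by positivity, min_le_left _ _, ?_⟩
  have : min (1 / 4) (s / (B + 1)) * (B + 1) ≤ s := by
    rw [← le_div_iff₀ (by positivity)]; exact min_le_right _ _
  have h2 : 0 < min (1 / 4) (s / (B + 1)) := by positivity
  nlinarith

theorem eq_of_zero_weight {l : ℝ} (hl : 1 - l ≠ 0) {a b : AbsSeries} (h : a = (1 - l)⁻¹ • b) :
    a = l • a + b := by
  have : b = (1 - l) • a := by rw [h, smul_inv_smul₀ hl]
  rw [this, ← add_smul]; simp

theorem eq_of_pos_weight {l : ℝ} (hl : l ≠ 0) {a b c : AbsSeries} (h : a = l⁻¹ • c + -(l⁻¹ • b)) :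
    c = l • a + b := by
  rw [h, smul_add, smul_neg, smul_inv_smul₀ hl, smul_inv_smul₀ hl]; abel

-- The equation uᵏθₖ = lθₖ + Fₖ is solved for the occurrence of θₖ with a bounded coefficient: θₖ =
-- l⁻¹(uᵏθₖ - Fₖ) for k ≥ 2, θ₀ = (1 - l)⁻¹F₀, and θₖ = u^|k|(lθₖ + Fₖ) for k < 0. In weight 1, θ₁ =
-- εx is imposed and the equation defines u. Negative weights are multiplied through by u^|k|, so
-- that u is never inverted in the algebra.
set_option maxHeartbeats 1000000 in
theorem exists_fixedPoint {f : AbsSeries} (hf : OrderTwo f) {l : ℝ} (hl0 : 0 < l) (hl1 : l < 1) :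
    ∃ (ε : ℝ) (θ u : AbsSeries), 0 < ε ∧ ‖θ‖ ≤ 1 ∧ ‖u‖ < 1 ∧ IsHomog 0 u ∧ θ.coeff 0 = 0 ∧
      part 1 θ = ε • mono (1, 0) ∧
      (∀ k : ℤ, 0 ≤ k → u ^ k.natAbs * part k θ =
        l • part k θ + part k (subst θ (swapL θ) f)) ∧
      ∀ k : ℤ, k < 0 → part k θ =
        u ^ k.natAbs * (l • part k θ + part k (subst θ (swapL θ) f)) := by
  obtain ⟨q, hlq, hq1, hq2⟩ : ∃ q : ℝ, l < q ∧ q < 1 ∧ q ^ 2 < l := by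
    have h1 : l < √l := by
      rw [Real.lt_sqrt hl0.le]; nlinarith
    obtain ⟨q, h2, h3⟩ := exists_between h1
    have hq : q ^ 2 < l := by
      have := Real.sq_sqrt hl0.le
      nlinarith [Real.sqrt_nonneg l]
    exact ⟨q, h2, by nlinarith, hq⟩
  have hq0 : 0 < q := hl0.trans hlq
  set τ : ℝ := q ^ 2 / l with hτ
  have hτ1 : τ < 1 := by rwa [hτ, div_lt_one hl0]
  have hτ0 : 0 < τ := by positivity
  have hlqτ : l * q ≤ τ := by
    rw [hτ, le_div_iff₀ hl0]
    have : l * l ≤ q * 1 := mul_le_mul hlq.le hl1.le hl0.le hq0.le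
    nlinarith
  -- Coefficients of the solved equations: α k multiplies u^|k|θₖ, γ k multiplies u^|k|Fₖ, and β k
  -- multiplies Fₖ. All three vanish at k = 1.
  set α : ℤ → ℝ := fun k => if 2 ≤ k then l⁻¹ else if k < 0 then l else 0 with hα
  set β : ℤ → ℝ := fun k => if 2 ≤ k then -l⁻¹ else if k = 0 then (1 - l)⁻¹ else 0 with hβ
  set γ : ℤ → ℝ := fun k => if k < 0 then 1 else 0 with hγ
  have h1l : 0 < 1 - l := by linarith
  set κ : ℝ := l⁻¹ + (1 - l)⁻¹ + 1 with hκ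
  have hli : 0 < l⁻¹ := by positivity
  have h1li : 0 < (1 - l)⁻¹ := by positivity
  have hκ0 : 0 < κ := by positivity
  have hακ : ∀ k, |α k| ≤ κ := fun k => by
    simp only [hα]; split_ifs
    · rw [abs_of_pos hli]; linarith
    · rw [abs_of_pos hl0]; linarith
    · simpa using hκ0.le
  have hβκ : ∀ k, |β k| ≤ κ := fun k => by
    simp only [hβ]; split_ifs
    · rw [abs_neg, abs_of_pos hli]; linarith
    · rw [abs_of_pos h1li]; linarith
    · simpa using hκ0.le
  have hγκ : ∀ k, |γ k| ≤ κ := fun k => by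
    simp only [hγ]; split_ifs
    · rw [abs_one]; linarith
    · simpa using hκ0.le
  have hατ : ∀ k : ℤ, |α k| * q ^ k.natAbs ≤ τ := fun k => by
    simp only [hα]; split_ifs with h1 h2
    · rw [abs_of_pos hli, hτ, div_eq_inv_mul]
      exact mul_le_mul_of_nonneg_left (pow_le_pow_of_le_one hq0.le hq1.le (by omega)) hli.le
    · rw [abs_of_pos hl0]
      refine le_trans (mul_le_mul_of_nonneg_left ?_ hl0.le) hlqτ
      calc q ^ k.natAbs ≤ q ^ 1 := pow_le_pow_of_le_one hq0.le hq1.le (by omega)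
        _ = q := pow_one q
    · simpa using hτ0.le
  have hγq : ∀ k : ℤ, |γ k| * q ^ k.natAbs ≤ κ := fun k =>
    (mul_le_of_le_one_right (abs_nonneg _) (pow_le_one₀ hq0.le hq1.le)).trans (hγκ k)
  have hβq : ∀ k : ℤ, |β k| * 1 ^ k.natAbs ≤ κ := fun k => by simpa using hβκ k
  set C := ‖f‖ with hC
  have hC0 : 0 ≤ C := norm_nonneg _
  set K := (1 - q)⁻¹ with hK
  have hK0 : 0 < K := by rw [hK]; exact inv_pos.2 (by linarith)
  -- The bound by q - l keeps ‖u‖ ≤ q; the bound by (1 - τ)/2 keeps the Lipschitz constant of the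
  -- fixed point map below (1 + τ)/2 < 1.
  obtain ⟨ε, hε0, hε4, hεs⟩ := exists_small
    (B := 4 * C + (8 * κ * K * C + 8 * κ * C + 16 * κ * K * C ^ 2))
    (s := min (q - l) ((1 - τ) / 2)) (by positivity) (lt_min (by linarith) (by linarith))
  have hεu : 4 * ε * C ≤ q - l := by
    have := hεs.trans (min_le_left _ _)
    have h2 : 0 ≤ ε * (8 * κ * K * C + 8 * κ * C + 16 * κ * K * C ^ 2) := by positivity
    nlinarith
  have hετ : ε * (8 * κ * K * C + 8 * κ * C + 16 * κ * K * C ^ 2) ≤ (1 - τ) / 2 := by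
    have := hεs.trans (min_le_right _ _)
    have h2 : 0 ≤ ε * (4 * C) := by positivity
    nlinarith
  -- the maps of the fixed point problem
  set X : AbsSeries := ε • mono (1, 0) with hX
  have hXn : ‖X‖ = ε := by rw [hX, norm_smul, norm_mono, mul_one, Real.norm_eq_abs, abs_of_pos hε0]
  set F : AbsSeries → AbsSeries := fun θ => subst θ (swapL θ) f with hF
  set U : AbsSeries → AbsSeries := fun θ => l • (1 : AbsSeries) + ε⁻¹ • divX (F θ) with hU
  set G : AbsSeries → AbsSeries := fun θ =>
    X + prop (U θ) α θ + prop (U θ) γ (F θ) + prop 1 β (F θ) with hG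
  set D : Set AbsSeries := Metric.closedBall X ε ∩ (ev 0) ⁻¹' {0} with hD
  have hDn : ∀ θ ∈ D, ‖θ‖ ≤ 2 * ε := fun θ hθ => by
    have h1 : ‖θ - X‖ ≤ ε := by simpa [dist_eq_norm] using hθ.1
    have := norm_add_le (θ - X) X
    rw [sub_add_cancel] at this
    linarith
  have hDs : ∀ θ ∈ D, ‖swapL θ‖ ≤ 2 * ε := fun θ hθ => (norm_swapL_le θ).trans (hDn θ hθ)
  have hFn : ∀ θ ∈ D, ‖F θ‖ ≤ 4 * ε ^ 2 * C := fun θ hθ => by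
    have := hf.norm_subst_le (M := 2 * ε) (by linarith) (hDn θ hθ) (hDs θ hθ)
    refine this.trans (le_of_eq ?_); ring
  have hFl : ∀ θ ∈ D, ∀ ψ ∈ D, ‖F θ - F ψ‖ ≤ 4 * ε * C * ‖θ - ψ‖ := fun θ hθ ψ hψ => by
    have := hf.norm_subst_sub_le (M := 2 * ε) (D := ‖θ - ψ‖) (by linarith) (hDn θ hθ) (hDs θ hθ)
      (hDn ψ hψ) (hDs ψ hψ) le_rfl (by rw [← map_sub]; exact norm_swapL_le _)
    refine this.trans (le_of_eq ?_); ring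
  have hUq : ∀ θ ∈ D, ‖U θ‖ ≤ q := fun θ hθ => by
    have h1 : ‖l • (1 : AbsSeries)‖ = l := by
      rw [norm_smul, norm_one, mul_one, Real.norm_eq_abs, abs_of_pos hl0]
    have h2 : ‖ε⁻¹ • divX (F θ)‖ ≤ ε⁻¹ * (4 * ε ^ 2 * C) := by
      rw [norm_smul, Real.norm_eq_abs, abs_of_pos (inv_pos.2 hε0)]
      exact mul_le_mul_of_nonneg_left ((norm_divX_le _).trans (hFn θ hθ)) (inv_pos.2 hε0).le
    have h3 : ε⁻¹ * (4 * ε ^ 2 * C) = 4 * ε * C := by field_simp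
    have := norm_add_le (l • (1 : AbsSeries)) (ε⁻¹ • divX (F θ))
    simp only [hU]
    linarith
  have hUl : ∀ θ ∈ D, ∀ ψ ∈ D, ‖U θ - U ψ‖ ≤ 4 * C * ‖θ - ψ‖ := fun θ hθ ψ hψ => by
    have e : U θ - U ψ = ε⁻¹ • divX (F θ - F ψ) := by
      simp only [hU, map_sub, smul_sub]; abel
    rw [e, norm_smul, Real.norm_eq_abs, abs_of_pos (inv_pos.2 hε0)]
    have := mul_le_mul_of_nonneg_left ((norm_divX_le _).trans (hFl θ hθ ψ hψ)) (inv_pos.2 hε0).le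
    refine this.trans (le_of_eq ?_)
    field_simp
  have hU0 : ∀ θ, IsHomog 0 (U θ) := fun θ =>
    (isHomog_one.smul l).add ((isHomog_divX _).smul _)
  have hwX : wt (1, 0) = 1 := by simp [wt]
  have hXh : IsHomog 1 X := by
    have := (isHomog_mono (1, 0)).smul ε
    rwa [hwX] at this
  -- As α 1 = 0, the linear part acts on θ - X, of norm at most ε, instead of θ, of norm up to 2ε.
  -- Hence the ball of radius ε around X can be mapped into itself.
  have hpX : ∀ θ ∈ D, prop (U θ) α X = 0 := fun θ hθ => by
    rw [hX, map_smul, prop, lift_mono (norm_prop_aux (hUq θ hθ) hατ), hwX]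
    simp [hα]
  have hpart : ∀ θ ∈ D, ∀ k, part k (G θ) = part k X + α k • (U θ ^ k.natAbs * part k θ) +
      γ k • (U θ ^ k.natAbs * part k (F θ)) + β k • part k (F θ) := fun θ hθ k => by
    simp only [hG, map_add]
    rw [part_prop (hU0 θ) (hUq θ hθ) hατ, part_prop (hU0 θ) (hUq θ hθ) hγq,
      part_prop isHomog_one (q := 1) norm_one.le hβq, one_pow, one_mul]
  have hn0 : ‖(0 : ℝ × ℝ)‖ ≤ 1 := by simp
  have hev : ∀ a : AbsSeries, ev 0 (part 0 a) = ev 0 a := fun a => by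
    rw [← coeff_zero_eq_ev, ← coeff_zero_eq_ev, coeff_part, if_pos (by simp [wt])]
  have hmaps : MapsTo G D D := fun θ hθ => by
    constructor
    · rw [Metric.mem_closedBall, dist_eq_norm]
      have e : G θ - X = prop (U θ) α (θ - X) + prop (U θ) γ (F θ) + prop 1 β (F θ) := by
        rw [map_sub, hpX θ hθ]; simp only [hG]; abel
      have h1 : ‖θ - X‖ ≤ ε := by simpa [dist_eq_norm] using hθ.1
      have h2 := (norm_prop_le (hUq θ hθ) hατ (θ - X)).trans
        (mul_le_mul_of_nonneg_left h1 hτ0.le)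
      have h3 := (norm_prop_le (hUq θ hθ) hγq (F θ)).trans
        (mul_le_mul_of_nonneg_left (hFn θ hθ) hκ0.le)
      have h4 := (norm_prop_le (q := 1) norm_one.le hβq (F θ)).trans
        (mul_le_mul_of_nonneg_left (hFn θ hθ) hκ0.le)
      have h5 : 0 ≤ ε * (8 * κ * K * C + 16 * κ * K * C ^ 2) := by positivity
      have h6 : ε * (ε * (8 * κ * C)) ≤ ε * ((1 - τ) / 2) :=
        mul_le_mul_of_nonneg_left (by nlinarith) hε0.le
      have h7 : 0 < ε * (1 - τ) := mul_pos hε0 (by linarith)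
      rw [e]
      refine (norm_add₃_le).trans ?_
      nlinarith
    · have hθ0 : ev 0 θ = 0 := hθ.2
      have hF0 : ev 0 (F θ) = 0 := by
        have hfn : ev 0 (F θ) = ev 0 f := by
          simp only [hF, ev]
          have hb : (2 * ε) ≤ 1 := by linarith
          rw [subst_subst (by simp) (by simp) ((hDn θ hθ).trans hb) ((hDs θ hθ).trans hb)]
          have e1 : subst (0 : ℝ × ℝ).1 (0 : ℝ × ℝ).2 θ = 0 := hθ0
          have e2 : subst (0 : ℝ × ℝ).1 (0 : ℝ × ℝ).2 (swapL θ) = 0 := by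
            change ev 0 (swapL θ) = 0
            rw [ev_swapL hn0]; exact hθ0
          rw [e1, e2]; rfl
        rw [hfn, ← coeff_zero_eq_ev]; exact hf 0 (by simp)
      change ev 0 (G θ) = 0
      rw [← hev, hpart θ hθ 0]
      simp only [map_add, map_smul, hev, ev_mul hn0, hθ0, hF0]
      rw [hX, map_smul, ev_mono hn0]; simp
  have hlip : ∀ θ ∈ D, ∀ ψ ∈ D, ‖G θ - G ψ‖ ≤ ((1 + τ) / 2) * ‖θ - ψ‖ := fun θ hθ ψ hψ => by
    have e : G θ - G ψ = prop (U θ) α (θ - ψ) + (prop (U θ) α ψ - prop (U ψ) α ψ) +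
        (prop (U θ) γ (F θ - F ψ) + (prop (U θ) γ (F ψ) - prop (U ψ) γ (F ψ))) +
        prop 1 β (F θ - F ψ) := by
      simp only [map_sub, hG]; abel
    have hKU : K * ‖U θ - U ψ‖ ≤ K * (4 * C * ‖θ - ψ‖) :=
      mul_le_mul_of_nonneg_left (hUl θ hθ ψ hψ) hK0.le
    have hKU' := mul_le_mul_of_nonneg_left hKU hκ0.le
    have h1 := norm_prop_le (hUq θ hθ) hατ (θ - ψ)
    -- The Lipschitz constant 4C of `U` carries no factor ε, because of the division by ε in `U`;
    -- the missing smallness comes from ‖ψ‖ ≤ 2ε.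
    have h2 : _ ≤ κ * (K * (4 * C * ‖θ - ψ‖)) * (2 * ε) :=
      (norm_prop_sub_le hq1 (hUq θ hθ) (hUq ψ hψ) hακ ψ).trans
        (mul_le_mul hKU' (hDn ψ hψ) (norm_nonneg _) (by positivity))
    have h3 := (norm_prop_le (hUq θ hθ) hγq (F θ - F ψ)).trans
      (mul_le_mul_of_nonneg_left (hFl θ hθ ψ hψ) hκ0.le)
    have h4 : _ ≤ κ * (K * (4 * C * ‖θ - ψ‖)) * (4 * ε ^ 2 * C) :=
      (norm_prop_sub_le hq1 (hUq θ hθ) (hUq ψ hψ) hγκ (F ψ)).trans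
        (mul_le_mul hKU' (hFn ψ hψ) (norm_nonneg _) (by positivity))
    have h5 := (norm_prop_le (q := 1) norm_one.le hβq (F θ - F ψ)).trans
      (mul_le_mul_of_nonneg_left (hFl θ hθ ψ hψ) hκ0.le)
    have h6 : κ * (K * (4 * C * ‖θ - ψ‖)) * (4 * ε ^ 2 * C) ≤
        κ * (K * (4 * C * ‖θ - ψ‖)) * (4 * ε * C) := by
      refine mul_le_mul_of_nonneg_left ?_ (by positivity)
      refine mul_le_mul_of_nonneg_right ?_ hC0
      nlinarith
    rw [e]
    refine (norm_add₃_le).trans ?_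
    have h7 := norm_add_le (prop (U θ) α (θ - ψ)) (prop (U θ) α ψ - prop (U ψ) α ψ)
    have h8 := norm_add_le (prop (U θ) γ (F θ - F ψ)) (prop (U θ) γ (F ψ) - prop (U ψ) γ (F ψ))
    have h9 := mul_le_mul_of_nonneg_right hετ (norm_nonneg (θ - ψ))
    have h10 : τ * ‖θ - ψ‖ + κ * (K * (4 * C * ‖θ - ψ‖)) * (2 * ε) +
        (κ * (4 * ε * C * ‖θ - ψ‖) + κ * (K * (4 * C * ‖θ - ψ‖)) * (4 * ε * C)) +
        κ * (4 * ε * C * ‖θ - ψ‖) =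
        τ * ‖θ - ψ‖ + ε * (8 * κ * K * C + 8 * κ * C + 16 * κ * K * C ^ 2) * ‖θ - ψ‖ := by ring
    have h11 : (1 + τ) / 2 * ‖θ - ψ‖ = τ * ‖θ - ψ‖ + (1 - τ) / 2 * ‖θ - ψ‖ := by ring
    linarith
  have hcomplete : IsComplete D :=
    (Metric.isClosed_closedBall.inter (isClosed_singleton.preimage (ev 0).continuous)).isComplete
  have hXD : X ∈ D := by
    refine ⟨Metric.mem_closedBall_self hε0.le, ?_⟩
    change ev 0 X = 0
    rw [hX, map_smul, ev_mono hn0]; simp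
  have hctr : ContractingWith (Real.toNNReal ((1 + τ) / 2)) (hmaps.restrict G D D) := by
    refine ⟨?_, LipschitzWith.of_dist_le_mul fun θ ψ => ?_⟩
    · rw [Real.toNNReal_lt_one]; linarith
    · rw [Real.coe_toNNReal _ (by linarith), Subtype.dist_eq, Subtype.dist_eq, dist_eq_norm,
        dist_eq_norm]
      exact hlip θ θ.2 ψ ψ.2
  obtain ⟨θ, hθD, hθG, -⟩ := hctr.exists_fixedPoint' hcomplete hmaps hXD (edist_ne_top _ _)
  have hθG : G θ = θ := hθG
  have key : ∀ k, part k θ = part k X + α k • (U θ ^ k.natAbs * part k θ) +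
      γ k • (U θ ^ k.natAbs * part k (F θ)) + β k • part k (F θ) := fun k => by
    conv_lhs => rw [← hθG]
    exact hpart θ hθD k
  have hp1 : part 1 θ = X := by
    rw [key 1, hXh.part_eq]; simp [hα, hβ, hγ]
  refine ⟨ε, θ, U θ, hε0, (hDn θ hθD).trans (by linarith), (hUq θ hθD).trans_lt hq1, hU0 θ, ?_, hp1,
    fun k hk => ?_, fun k hk => ?_⟩
  · rw [coeff_zero_eq_ev]; exact hθD.2
  · rcases lt_trichotomy k 1 with h | h | h
    · obtain rfl : k = 0 := by omega
      have := key 0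
      rw [hXh.part_eq_zero one_ne_zero] at this
      simp only [hα, hβ, hγ] at this
      simp only [Int.natAbs_zero, pow_zero, one_mul] at this ⊢
      refine eq_of_zero_weight h1l.ne' ?_
      simpa using this
    · subst h
      rw [hp1]
      -- The equation of weight 1 holds by the very definition of `U`: multiplying `divX (F θ)` by x
      -- restores the part of weight 1 of `F θ`.
      have e : X * U θ = l • X + part 1 (F θ) := by
        rw [← mono_mul_divX (F θ)]
        simp only [hU, hX, mul_add, mul_smul_comm, smul_mul_assoc, mul_one, smul_smul]
        rw [inv_mul_cancel₀ hε0.ne', one_smul, mul_comm l ε]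
      simpa [mul_comm] using e
    · have := key k
      rw [hXh.part_eq_zero (by omega)] at this
      simp only [hα, hβ, hγ] at this
      rw [if_pos (by omega), if_neg (by omega), if_pos (by omega)] at this
      refine eq_of_pos_weight hl0.ne' ?_
      simpa using this
  · have := key k
    rw [hXh.part_eq_zero (by omega)] at this
    simp only [hα, hβ, hγ] at this
    rw [if_neg (by omega), if_pos hk, if_pos hk, if_neg (by omega), if_neg (by omega)] at this
    conv_lhs => rw [this]
    simp [mul_add]
    rfl

end AbsSeries

/-! ### Series as analytic functions, and back -/

namespace AbsSeries

/-- The equations in the separate weights are summed over k. At a point where u does not vanish, the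
two forms for k ≥ 0 and k < 0 both say uᵏθₖ = lθₖ + Fₖ. -/
theorem ev_scale_eq_of_parts {θ u F : AbsSeries} {l : ℝ}
    (h1 : ∀ k : ℤ, 0 ≤ k → u ^ k.natAbs * part k θ = l • part k θ + part k F)
    (h2 : ∀ k : ℤ, k < 0 → part k θ = u ^ k.natAbs * (l • part k θ + part k F))
    {p : ℝ × ℝ} (hp : ‖p‖ ≤ 1) (h0 : ev p u ≠ 0)
    (hq : ‖(ev p u * p.1, (ev p u)⁻¹ * p.2)‖ ≤ 1) :
    ev (ev p u * p.1, (ev p u)⁻¹ * p.2) θ = l * ev p θ + ev p F := by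
  set q : ℝ × ℝ := (ev p u * p.1, (ev p u)⁻¹ * p.2) with hqd
  have e1 := θ.hasSum_part.mapL (ev q)
  have e2 := ((θ.hasSum_part.mapL (ev p)).mul_left l).add (F.hasSum_part.mapL (ev p))
  refine e1.unique ?_
  convert! e2 using 2 with k
  rw [(isHomog_part k θ).ev_scale hp h0 hq]
  rcases le_or_gt 0 k with hk | hk
  · have := congrArg (ev p) (h1 k hk)
    rw [ev_mul hp, ev_pow hp, map_add, map_smul, smul_eq_mul] at this
    rw [← this, ← zpow_natCast, Int.natAbs_of_nonneg hk]
  · have := congrArg (ev p) (h2 k hk)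
    rw [ev_mul hp, ev_pow hp, map_add, map_smul, smul_eq_mul] at this
    conv_lhs => rw [this]
    rw [← mul_assoc, ← zpow_natCast, ← zpow_add₀ h0]
    have : k + (k.natAbs : ℤ) = 0 := by omega
    rw [this, zpow_zero, one_mul]

/-- The homogeneous polynomials of which a series is the sum, as multilinear maps. -/
noncomputable def fps (a : AbsSeries) : FormalMultilinearSeries ℝ (ℝ × ℝ) ℝ := fun n =>
  ∑ d ∈ Finset.HasAntidiagonal.antidiagonal n, a.coeff d •
    (ContinuousMultilinearMap.mkPiAlgebraFin ℝ n ℝ).compContinuousLinearMap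
      fun i : Fin n => if (i : ℕ) < d.1 then ContinuousLinearMap.fst ℝ ℝ ℝ
        else ContinuousLinearMap.snd ℝ ℝ ℝ

theorem fps_apply (a : AbsSeries) (n : ℕ) (p : ℝ × ℝ) : (fps a n fun _ => p) =
    ∑ d ∈ Finset.HasAntidiagonal.antidiagonal n, a.coeff d * (p.1 ^ d.1 * p.2 ^ d.2) := by
  simp only [fps, sum_apply, smul_apply,
    ContinuousMultilinearMap.compContinuousLinearMap_apply, smul_eq_mul,
    ContinuousMultilinearMap.mkPiAlgebraFin_apply, List.prod_ofFn]
  refine Finset.sum_congr rfl fun d hd => ?_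
  rw [Finset.HasAntidiagonal.mem_antidiagonal] at hd
  obtain ⟨i, j⟩ := d
  simp only at hd
  subst hd
  congr 1
  rw [Fin.prod_univ_add]
  simp

theorem norm_fps_le (a : AbsSeries) (n : ℕ) : ‖fps a n‖ ≤ ‖a‖ := by
  have h1 : ‖fps a n‖ ≤ ∑ d ∈ Finset.HasAntidiagonal.antidiagonal n, |a.coeff d| := by
    refine (norm_sum_le _ _).trans (Finset.sum_le_sum fun d _ => ?_)
    rw [norm_smul, Real.norm_eq_abs]
    refine mul_le_of_le_one_right (abs_nonneg _) ?_
    refine (ContinuousMultilinearMap.norm_compContinuousLinearMap_le _ _).trans ?_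
    refine mul_le_one₀ (by simp) (Finset.prod_nonneg fun _ _ => norm_nonneg _)
      (Finset.prod_le_one (fun _ _ => norm_nonneg _) fun i _ => ?_)
    split_ifs
    · exact ContinuousLinearMap.norm_fst_le ℝ ℝ ℝ
    · exact ContinuousLinearMap.norm_snd_le ℝ ℝ ℝ
  exact h1.trans (sum_le_hasSum _ (fun d _ => abs_nonneg _) a.hasSum_norm_coeff)

theorem mem_eball_zero_one {p : ℝ × ℝ} : p ∈ Metric.eball (0 : ℝ × ℝ) 1 ↔ ‖p‖ < 1 := by
  rw [Metric.mem_eball, edist_zero_right, enorm_eq_nnnorm, ← coe_nnnorm]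
  exact_mod_cast Iff.rfl

theorem hasFPowerSeriesOnBall_ev (a : AbsSeries) :
    HasFPowerSeriesOnBall (fun p => ev p a) (fps a) 0 1 where
  r_le := by
    have := (fps a).le_radius_of_bound (r := 1) ‖a‖ fun n => by simpa using norm_fps_le a n
    simpa using this
  r_pos := one_pos
  hasSum := fun {p} hp => by
    have hp' : ‖p‖ ≤ 1 := by
      exact (mem_eball_zero_one.1 hp).le
    rw [zero_add]
    have h := hasSum_ev hp' a
    rw [← Finset.HasAntidiagonal.sigmaAntidiagonalEquivProd.hasSum_iff] at h
    have h2 := h.sigma fun n => hasSum_fintype _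
    convert! h2 using 2 with n
    rw [fps_apply, ← Finset.sum_finset_coe]
    rfl

theorem analyticAt_ev (a : AbsSeries) {p : ℝ × ℝ} (hp : ‖p‖ < 1) :
    AnalyticAt ℝ (fun p => ev p a) p :=
  a.hasFPowerSeriesOnBall_ev.analyticAt_of_mem
    (mem_eball_zero_one.2 hp)

theorem hasFDerivAt_ev_zero (a : AbsSeries) : HasFDerivAt (fun p => ev p a)
    (a.coeff (1, 0) • ContinuousLinearMap.fst ℝ ℝ ℝ + a.coeff (0, 1) • ContinuousLinearMap.snd ℝ ℝ ℝ)
    0 := by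
  convert! a.hasFPowerSeriesOnBall_ev.hasFPowerSeriesAt.hasFDerivAt using 1
  refine ContinuousLinearMap.ext fun v => ?_
  have h : (continuousMultilinearCurryFin1 ℝ (ℝ × ℝ) ℝ (fps a 1)) v = fps a 1 fun _ => v := by
    rw [continuousMultilinearCurryFin1_apply]
    congr 1
  refine Eq.trans ?_ h.symm
  rw [fps_apply]
  simp [Finset.Nat.antidiagonal_succ, add_comm]

theorem eq_zero_of_ev_eq_zero {a : AbsSeries} (h : ∀ᶠ p in 𝓝 (0 : ℝ × ℝ), ev p a = 0) : a = 0 := by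
  have h1 : HasFPowerSeriesAt (0 : ℝ × ℝ → ℝ) (fps a) 0 :=
    a.hasFPowerSeriesOnBall_ev.hasFPowerSeriesAt.congr h
  refine ext_coeff fun d => ?_
  set n := d.1 + d.2 with hn
  -- The homogeneous polynomial of degree n is dehomogenized at (t, 1), so that its coefficients are
  -- those of a polynomial in one variable that vanishes identically.
  have h2 : (∑ i ∈ Finset.range (n + 1), Polynomial.C (a.coeff (i, n - i)) * Polynomial.X ^ i :
      Polynomial ℝ) = 0 := by
    refine Polynomial.funext fun t => ?_
    have := h1.apply_eq_zero n (t, 1)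
    rw [fps_apply, Finset.Nat.sum_antidiagonal_eq_sum_range_succ_mk
      (f := fun d => a.coeff d * (((t, 1) : ℝ × ℝ).1 ^ d.1 * ((t, 1) : ℝ × ℝ).2 ^ d.2))] at this
    simpa [Polynomial.eval_finsetSum] using this
  have h3 := congrArg (fun P => Polynomial.coeff P d.1) h2
  simp only [Polynomial.finsetSum_coeff, Polynomial.coeff_C_mul, Polynomial.coeff_X_pow,
    Polynomial.coeff_zero] at h3
  rw [Finset.sum_eq_single d.1] at h3
  · have e : n - d.1 = d.2 := by omega
    simpa [e] using h3
  · intro i _ hi; simp [hi.symm]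
  · intro hi; exact absurd (Finset.mem_range.2 (by omega)) hi

theorem norm_smul_le_one {t : ℝ} (ht0 : 0 ≤ t) (ht1 : t ≤ 1) {p : ℝ × ℝ} (hp : ‖p‖ ≤ 1) :
    ‖t • p‖ ≤ 1 := by
  rw [norm_smul, Real.norm_eq_abs, abs_of_nonneg ht0]
  exact mul_le_one₀ ht1 (norm_nonneg _) hp

/-- Rescaling of the variables. -/
noncomputable def rescale (t : ℝ) : AbsSeries →L[ℝ] AbsSeries :=
  lift fun d => t ^ (d.1 + d.2) • mono d

theorem norm_rescale_aux {t : ℝ} (ht0 : 0 ≤ t) (ht1 : t ≤ 1) (d : ℕ × ℕ) :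
    ‖t ^ (d.1 + d.2) • mono d‖ ≤ 1 := by
  rw [norm_smul, norm_mono, mul_one, norm_pow, Real.norm_eq_abs, abs_of_nonneg ht0]
  exact pow_le_one₀ ht0 ht1

theorem ev_rescale {t : ℝ} (ht0 : 0 ≤ t) (ht1 : t ≤ 1) {p : ℝ × ℝ} (hp : ‖p‖ ≤ 1) (a : AbsSeries) :
    ev p (rescale t a) = ev (t • p) a := by
  refine congrArg (fun S => S a) (clm_ext (S := ev p ∘L rescale t) (T := ev (t • p)) fun d => ?_)
  rw [ContinuousLinearMap.comp_apply, rescale, lift_mono (norm_rescale_aux ht0 ht1), map_smul,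
    ev_mono hp, ev_mono (norm_smul_le_one ht0 ht1 hp)]
  simp only [Prod.smul_fst, Prod.smul_snd, smul_eq_mul, mul_pow, pow_add]
  ring

theorem multilinear_apply_pair {n : ℕ} (P : ContinuousMultilinearMap ℝ (fun _ : Fin n => ℝ × ℝ) ℝ)
    (x y : ℝ) : (P fun _ => (x, y)) = ∑ S : Finset (Fin n), P (S.piecewise (fun _ => (1, 0))
      (fun _ => (0, 1))) * (x ^ S.card * y ^ (n - S.card)) := by
  have e : (fun _ : Fin n => ((x, y) : ℝ × ℝ)) =
      (fun _ => x • ((1, 0) : ℝ × ℝ)) + fun _ => y • ((0, 1) : ℝ × ℝ) := by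
    funext i; ext <;> simp
  rw [e, P.map_add_univ]
  refine Finset.sum_congr rfl fun S _ => ?_
  have e2 : (S.piecewise (fun _ => x • ((1, 0) : ℝ × ℝ)) fun _ => y • ((0, 1) : ℝ × ℝ)) =
      fun i => (S.piecewise (fun _ => x) (fun _ => y) i) •
        (S.piecewise (fun _ => ((1, 0) : ℝ × ℝ)) (fun _ => ((0, 1) : ℝ × ℝ)) i) := by
    funext i
    by_cases h : i ∈ S <;> simp [h]
  rw [e2, P.map_smul_univ, Finset.prod_piecewise, smul_eq_mul, mul_comm]
  simp [Finset.card_univ_sdiff]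

/-- A power series of multilinear maps is turned into a double series by expanding each term on the
standard basis. A rescaling by σ makes it absolutely convergent on the closed unit bidisc. -/
theorem exists_eq_ev {f : ℝ × ℝ → ℝ} (hf : AnalyticAt ℝ f 0) :
    ∃ σ : ℝ, 0 < σ ∧ ∃ a : AbsSeries, ∀ p : ℝ × ℝ, ‖p‖ ≤ 1 → f (σ • p) = ev p a := by
  obtain ⟨P, r, hr⟩ := hf
  obtain ⟨s, hs0, hsr⟩ := ENNReal.lt_iff_exists_nnreal_btwn.1 hr.r_pos
  obtain ⟨C, hC0, hC⟩ := P.norm_mul_pow_le_of_lt_radius (hsr.trans_le hr.r_le)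
  have hs0' : (0 : ℝ) < s := by exact_mod_cast hs0
  -- One factor 1/2 absorbs the 2ⁿ terms of the multilinear expansion of degree n, the other one
  -- makes the sum over n geometric.
  set σ : ℝ := s / 4 with hσ
  have hσ0 : 0 < σ := by positivity
  set h : ℕ → AbsSeries := fun n => ∑ S : Finset (Fin n),
    (P n (S.piecewise (fun _ => (1, 0)) (fun _ => (0, 1))) * σ ^ n) • mono (S.card, n - S.card)
    with hh
  have hb : ∀ n, ‖h n‖ ≤ C * (1 / 2) ^ n := fun n => by
    have h1 : ∀ S : Finset (Fin n), ‖(P n (S.piecewise (fun _ => (1, 0)) (fun _ => (0, 1))) *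
        σ ^ n) • mono (S.card, n - S.card)‖ ≤ ‖P n‖ * σ ^ n := fun S => by
      rw [norm_smul, norm_mono, mul_one, norm_mul, norm_pow, Real.norm_eq_abs σ, abs_of_pos hσ0]
      refine mul_le_mul_of_nonneg_right ?_ (by positivity)
      refine ((P n).le_opNorm _).trans (mul_le_of_le_one_right (norm_nonneg _) ?_)
      refine Finset.prod_le_one (fun _ _ => norm_nonneg _) fun i _ => ?_
      by_cases hi : i ∈ S <;> simp [hi]
    refine (norm_sum_le _ _).trans ((Finset.sum_le_sum fun S _ => h1 S).trans ?_)
    simp only [Finset.sum_const, Finset.card_univ, Fintype.card_finset, Fintype.card_fin,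
      nsmul_eq_mul]
    have h2 : ((2 ^ n : ℕ) : ℝ) * (‖P n‖ * σ ^ n) = ‖P n‖ * s ^ n * (1 / 2) ^ n := by
      have : σ = (s : ℝ) * (1 / 2) * (1 / 2) := by rw [hσ]; ring
      rw [this, mul_pow, mul_pow]
      push_cast
      have : (2 : ℝ) ^ n * (1 / 2) ^ n = 1 := by rw [← mul_pow]; norm_num
      linear_combination (‖P n‖ * s ^ n * (1 / 2) ^ n) * this
    rw [h2]
    exact mul_le_mul_of_nonneg_right (hC n) (by positivity)
  have hsum : Summable h :=
    Summable.of_norm_bounded ((summable_geometric_of_lt_one (by norm_num) (by norm_num)).mul_left C)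
      hb
  refine ⟨σ, hσ0, ∑' n, h n, fun p hp => ?_⟩
  have h1 := hsum.hasSum.mapL (ev p)
  have hmem : σ • p ∈ Metric.eball (0 : ℝ × ℝ) r := by
    refine Metric.eball_subset_eball hsr.le ?_
    rw [Metric.mem_eball, edist_zero_right, enorm_eq_nnnorm]
    have h3 : ‖σ • p‖ < s := by
      rw [norm_smul, Real.norm_eq_abs, abs_of_pos hσ0]
      nlinarith [norm_nonneg p]
    exact_mod_cast h3
  have h2 := hr.hasSum hmem
  rw [zero_add] at h2
  refine h2.unique ?_
  convert! h1 using 2 with n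
  have e := multilinear_apply_pair (P n) (σ * p.1) (σ * p.2)
  refine Eq.trans e ?_
  rw [hh, map_sum]
  refine Finset.sum_congr rfl fun S _ => ?_
  rw [map_smul, ev_mono hp, smul_eq_mul, mul_pow, mul_pow]
  have : σ ^ n = σ ^ S.card * σ ^ (n - S.card) := by
    rw [← pow_add]; congr 1
    have := S.card_le_univ
    rw [Fintype.card_fin] at this
    omega
  rw [this]
  ring

end AbsSeries

/-! ### Functions of xy and equivariant functions -/

namespace AbsSeries

theorem ev_part_axis_fst (a : AbsSeries) {t : ℝ} (ht : |t| ≤ 1) :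
    ev (t, 0) (part 1 a) = a.coeff (1, 0) * t := by
  have hp : ‖((t, 0) : ℝ × ℝ)‖ ≤ 1 := by simpa [Prod.norm_def] using ht
  refine (hasSum_ev hp _).unique ?_
  convert! hasSum_ite_eq ((1, 0) : ℕ × ℕ) (a.coeff (1, 0) * t) using 2 with d
  split_ifs with h
  · subst h; rw [coeff_part]; simp [wt]
  · obtain ⟨i, j⟩ := d
    rw [coeff_part]
    split_ifs with h2
    · rcases j with _ | j
      · exact absurd (by simp [wt] at h2; simp [h2]) h
      · simp
    · simp

theorem ev_part_axis_snd (a : AbsSeries) {t : ℝ} (ht : |t| ≤ 1) :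
    ev (0, t) (part (-1) a) = a.coeff (0, 1) * t := by
  have hp : ‖((0, t) : ℝ × ℝ)‖ ≤ 1 := by simpa [Prod.norm_def] using ht
  refine (hasSum_ev hp _).unique ?_
  convert! hasSum_ite_eq ((0, 1) : ℕ × ℕ) (a.coeff (0, 1) * t) using 2 with d
  split_ifs with h
  · subst h; rw [coeff_part]; simp [wt]
  · obtain ⟨i, j⟩ := d
    rw [coeff_part]
    split_ifs with h2
    · rcases i with _ | i
      · exact absurd (by simp [wt] at h2; simp [h2]) h
      · simp
    · simp

theorem norm_mul_zero_le_one {p : ℝ × ℝ} (hp : ‖p‖ ≤ 1) : ‖((p.1 * p.2, 0) : ℝ × ℝ)‖ ≤ 1 := by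
  rw [Prod.norm_def, norm_zero, max_eq_left (norm_nonneg _), norm_mul]
  exact mul_le_one₀ (norm_fst_le_one hp) (norm_nonneg _) (norm_snd_le_one hp)

/-- The operator that maps a series in `x * y` to the same series in `x`. -/
noncomputable def collapse : AbsSeries →L[ℝ] AbsSeries := lift fun d => mono (d.2, 0)

theorem IsHomog.ev_collapse {a : AbsSeries} (ha : IsHomog 0 a) {p : ℝ × ℝ} (hp : ‖p‖ ≤ 1) :
    ev (p.1 * p.2, 0) (collapse a) = ev p a := by
  rw [collapse, ev_lift (fun d => (norm_mono _).le)]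
  simp only [ev_mono (norm_mul_zero_le_one hp)]
  have hb : ∀ d : ℕ × ℕ, ‖(p.1 * p.2) ^ d.2 * (0 : ℝ) ^ 0‖ ≤ 1 := fun d => by
    rw [pow_zero, mul_one, norm_pow, norm_mul]
    exact pow_le_one₀ (by positivity)
      (mul_le_one₀ (norm_fst_le_one hp) (norm_nonneg _) (norm_snd_le_one hp))
  refine (hasSum_lift hb a).unique ?_
  convert! hasSum_ev hp a using 2 with d
  by_cases h : wt d = 0
  · have : d.1 = d.2 := by simp only [wt] at h; omega
    rw [this, mul_pow]; simp
  · rw [ha d h]; simp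

theorem analyticAt_ev_fst (a : AbsSeries) : AnalyticAt ℝ (fun w : ℝ => ev (w, 0) a) 0 := by
  have h : AnalyticAt ℝ (fun p => ev p a) ((fun w : ℝ => ((w, 0) : ℝ × ℝ)) 0) :=
    analyticAt_ev a (by simp)
  exact AnalyticAt.comp (f := fun w : ℝ => ((w, 0) : ℝ × ℝ)) h (analyticAt_id.prod analyticAt_const)

/-- The operator that maps a series in `x` to the same series in `x * y`, and that ignores the
terms that contain `y`. -/
noncomputable def expand : AbsSeries →L[ℝ] AbsSeries :=
  lift fun d => if d.2 = 0 then mono (d.1, d.1) else 0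

theorem norm_expand_aux (d : ℕ × ℕ) : ‖if d.2 = 0 then mono (d.1, d.1) else 0‖ ≤ 1 := by
  split_ifs
  · exact (norm_mono _).le
  · simp

theorem norm_expand_le (a : AbsSeries) : ‖expand a‖ ≤ ‖a‖ := by
  simpa [expand] using norm_lift_le norm_expand_aux a

theorem isHomog_expand (a : AbsSeries) : IsHomog 0 (expand a) :=
  IsHomog.lift norm_expand_aux (fun d => by
    split_ifs
    · simpa [wt] using isHomog_mono (d.1, d.1)
    · exact isHomog_zero 0) a

theorem ev_expand (a : AbsSeries) {p : ℝ × ℝ} (hp : ‖p‖ ≤ 1) :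
    ev p (expand a) = ev (p.1 * p.2, 0) a := by
  refine congrArg (fun S => S a) (clm_ext (S := ev p ∘L expand) (T := ev (p.1 * p.2, 0))
    fun d => ?_)
  rw [ContinuousLinearMap.comp_apply, expand, lift_mono norm_expand_aux,
    ev_mono (norm_mul_zero_le_one hp)]
  split_ifs with h
  · rw [ev_mono hp, h, mul_pow]; simp
  · rw [map_zero]; simp [h]

theorem norm_rescale_le {t : ℝ} (ht0 : 0 ≤ t) (ht1 : t ≤ 1) (a : AbsSeries) :
    ‖rescale t a‖ ≤ ‖a‖ := by
  simpa [rescale] using norm_lift_le (norm_rescale_aux ht0 ht1) a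

/-- The bound M is uniform in the scale t, because shrinking the variables decreases the norm. This
allows t to be chosen afterwards in terms of M. -/
theorem exists_eq_ev_mul {g : ℝ → ℝ} (hg : AnalyticAt ℝ g 0) :
    ∃ τ : ℝ, 0 < τ ∧ ∃ M : ℝ, ∀ t : ℝ, 0 ≤ t → t ≤ τ → ∃ a : AbsSeries, IsHomog 0 a ∧ ‖a‖ ≤ M ∧
      ∀ p : ℝ × ℝ, ‖p‖ ≤ 1 → g (t * p.1 * (t * p.2)) = ev p a := by
  have h : AnalyticAt ℝ (fun p : ℝ × ℝ => g p.1) 0 :=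
    AnalyticAt.comp (g := g) (f := fun p : ℝ × ℝ => p.1) hg analyticAt_fst
  obtain ⟨σ, hσ, c, hc⟩ := exists_eq_ev h
  refine ⟨min 1 σ, by positivity, ‖c‖, fun t ht0 ht => ?_⟩
  have h1 : t ≤ 1 := ht.trans (min_le_left _ _)
  have h2 : t ≤ σ := ht.trans (min_le_right _ _)
  have h3 : 0 ≤ t ^ 2 / σ := by positivity
  have h4 : t ^ 2 / σ ≤ 1 := by rw [div_le_one hσ]; nlinarith
  refine ⟨expand (rescale (t ^ 2 / σ) c), isHomog_expand _,
    (norm_expand_le _).trans (norm_rescale_le h3 h4 c), fun p hp => ?_⟩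
  have hp' := norm_mul_zero_le_one hp
  rw [ev_expand _ hp, ev_rescale h3 h4 hp', ← hc _ (norm_smul_le_one h3 h4 hp')]
  congr 1
  simp only [Prod.smul_fst, smul_eq_mul]
  field_simp

theorem continuous_at_mul_zero {g : ℝ → ℝ} (hg : ContinuousAt g 0) :
    ContinuousAt (fun p : ℝ × ℝ => g (p.1 * p.2)) 0 := by
  refine ContinuousAt.comp (g := g) (f := fun p : ℝ × ℝ => p.1 * p.2) ?_ (by fun_prop)
  simpa using hg

theorem eventually_norm_le_one : ∀ᶠ p in 𝓝 (0 : ℝ × ℝ), ‖p‖ ≤ 1 := by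
  filter_upwards [Metric.closedBall_mem_nhds (0 : ℝ × ℝ) one_pos] with p hp
  simpa using hp

/-- Composition with the normal form multiplies the part of weight j by Δ(xy)ʲ, so (Δʲ - ρ)fⱼ = 0.
At the origin Δʲ - ρ equals Δ(0)ʲ - Δ(0)ᵏ, which is nonzero for j ≠ k because 0 < Δ(0) < 1. Hence fⱼ
= 0 for all j ≠ k. -/
theorem exists_isHomog_of_equivariant {f : ℝ × ℝ → ℝ} (hf : AnalyticAt ℝ f 0) {Δ ρ : ℝ → ℝ}
    (hΔ : AnalyticAt ℝ Δ 0) (hρ : AnalyticAt ℝ ρ 0) (hΔ0 : 0 < Δ 0) (hΔ1 : Δ 0 < 1) {k : ℤ}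
    (hk : ρ 0 = Δ 0 ^ k) (h : ∀ᶠ p in 𝓝 (0 : ℝ × ℝ), f (normalForm Δ p) = ρ (p.1 * p.2) * f p) :
    ∃ t : ℝ, 0 < t ∧ ∃ a : AbsSeries, IsHomog k a ∧ ∀ p : ℝ × ℝ, ‖p‖ ≤ 1 → f (t • p) = ev p a := by
  obtain ⟨σ, hσ, a, ha⟩ := exists_eq_ev hf
  obtain ⟨τ₁, hτ₁, M₁, h₁⟩ := exists_eq_ev_mul hΔ
  obtain ⟨τ₂, hτ₂, M₂, h₂⟩ := exists_eq_ev_mul (hΔ.inv hΔ0.ne')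
  obtain ⟨τ₃, hτ₃, M₃, h₃⟩ := exists_eq_ev_mul hρ
  set M : ℝ := max 1 (max M₁ M₂) with hM
  have hM1 : 1 ≤ M := le_max_left _ _
  have hM0 : 0 < M := by linarith
  obtain ⟨t, ht0, ht⟩ : ∃ t : ℝ, 0 < t ∧ t ≤ τ₁ ∧ t ≤ τ₂ ∧ t ≤ τ₃ ∧ t ≤ σ / M :=
    ⟨min τ₁ (min τ₂ (min τ₃ (σ / M))), by positivity, by simp⟩
  obtain ⟨ht1, ht2, ht3, ht4⟩ := ht
  obtain ⟨δ, hδ0, hδM, hδ⟩ := h₁ t ht0.le ht1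
  obtain ⟨δ', hδ'0, hδ'M, hδ'⟩ := h₂ t ht0.le ht2
  obtain ⟨r', hr'0, -, hr'⟩ := h₃ t ht0.le ht3
  have hδM : ‖δ‖ ≤ M := hδM.trans ((le_max_left _ _).trans (le_max_right _ _))
  have hδ'M : ‖δ'‖ ≤ M := hδ'M.trans ((le_max_right _ _).trans (le_max_right _ _))
  set r : ℝ := t / σ with hr
  have hr0 : 0 < r := by positivity
  have hrM : r * M ≤ 1 := by
    rw [le_div_iff₀ hM0] at ht4
    rw [hr, div_mul_eq_mul_div, div_le_one hσ]; exact ht4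
  have hr1 : r ≤ 1 := by nlinarith
  have hrσ : σ * r = t := by rw [hr]; field_simp
  -- With this family, `lift w a` is the series a(rδx, rδ'y), that is, f composed with the normal
  -- form at scale t = σr. The choice of t gives rM ≤ 1, so the substitution stays in the unit
  -- bidisc.
  set w : ℕ × ℕ → AbsSeries := fun d => r ^ (d.1 + d.2) • (δ ^ d.1 * δ' ^ d.2 * mono d) with hw
  have hwb : ∀ d, ‖w d‖ ≤ 1 := fun d => by
    simp only [hw]
    rw [norm_smul, norm_pow, Real.norm_eq_abs, abs_of_pos hr0]
    have := norm_mul_le (δ ^ d.1 * δ' ^ d.2) (mono d)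
    rw [norm_mono, mul_one] at this
    have h2 := norm_pow_mul_pow_le hδM hδ'M d
    calc r ^ (d.1 + d.2) * ‖δ ^ d.1 * δ' ^ d.2 * mono d‖
        ≤ r ^ (d.1 + d.2) * M ^ (d.1 + d.2) :=
          mul_le_mul_of_nonneg_left (this.trans h2) (by positivity)
      _ = (r * M) ^ (d.1 + d.2) := (mul_pow _ _ _).symm
      _ ≤ 1 := pow_le_one₀ (by positivity) hrM
  set A := lift w a with hA
  set B := rescale r a with hB
  have hBf : ∀ p : ℝ × ℝ, ‖p‖ ≤ 1 → f (t • p) = ev p B := fun p hp => by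
    rw [hB, ev_rescale hr0.le hr1 hp, ← ha _ (norm_smul_le_one hr0.le hr1 hp), smul_smul, hrσ]
  have hAf : ∀ p : ℝ × ℝ, ‖p‖ ≤ 1 → f (normalForm Δ (t • p)) = ev p A := fun p hp => by
    set q : ℝ × ℝ := (r * (ev p δ * p.1), r * (ev p δ' * p.2)) with hq
    have hb : ∀ (b : AbsSeries) (x : ℝ), ‖b‖ ≤ M → |x| ≤ 1 → |r * (ev p b * x)| ≤ 1 := by
      intro b x hbM hx
      rw [abs_mul, abs_mul, abs_of_pos hr0]
      refine le_trans (mul_le_mul_of_nonneg_left ?_ hr0.le) hrM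
      calc |ev p b| * |x| ≤ M * 1 := mul_le_mul ((abs_ev_le hp b).trans hbM) hx (abs_nonneg _) hM0.le
        _ = M := mul_one M
    have hqn : ‖q‖ ≤ 1 := by
      rw [Prod.norm_def]
      exact max_le (hb _ _ hδM (norm_fst_le_one hp)) (hb _ _ hδ'M (norm_snd_le_one hp))
    have e1 : normalForm Δ (t • p) = σ • q := by
      simp only [normalForm, Prod.smul_fst, Prod.smul_snd, smul_eq_mul]
      have h2 := hδ' p hp
      rw [Pi.inv_apply] at h2
      rw [h2, hδ p hp, hq, ← hrσ]
      ext
      · simp only [Prod.smul_fst, smul_eq_mul]; ring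
      · simp only [Prod.smul_snd, smul_eq_mul]; ring
    rw [e1, ha q hqn, hA, ev_lift hwb]
    have hwb' : ∀ d, ‖ev p (w d)‖ ≤ 1 := fun d => (abs_ev_le hp _).trans (hwb d)
    refine (hasSum_ev hqn a).unique ?_
    convert! hasSum_lift hwb' a using 2 with d
    simp only [hw, map_smul, ev_mul hp, ev_pow hp, ev_mono hp, smul_eq_mul, hq, mul_pow, pow_add]
    ring
  have htt : Tendsto (fun p : ℝ × ℝ => t • p) (𝓝 0) (𝓝 0) := by
    have : ContinuousAt (fun p : ℝ × ℝ => t • p) 0 := by fun_prop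
    simpa [ContinuousAt] using this
  have hAB : A = r' * B := by
    have : A - r' * B = 0 := by
      refine eq_zero_of_ev_eq_zero ?_
      filter_upwards [htt.eventually h, eventually_norm_le_one] with p hp hp1
      rw [map_sub, ev_mul hp1, ← hAf p hp1, ← hBf p hp1, hp, ← hr' p hp1]
      simp
    exact sub_eq_zero.1 this
  have hpartA : ∀ j : ℤ, ∀ p : ℝ × ℝ, ‖p‖ ≤ 1 → ev p δ ≠ 0 →
      ev p (part j A) = ev p δ ^ j * ev p (part j B) := fun j p hp h0 => by
    have hδδ' : ev p δ' = (ev p δ)⁻¹ := by rw [← hδ' p hp, Pi.inv_apply, hδ p hp]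
    rw [hA, hB, clm_lift hwb, rescale, clm_lift (norm_rescale_aux hr0.le hr1),
      ev_lift (fun d => (norm_part_le j _).trans (hwb d)),
      ev_lift (fun d => (norm_part_le j _).trans (norm_rescale_aux hr0.le hr1 d))]
    have b1 : ∀ d, ‖ev p (part j (w d))‖ ≤ 1 := fun d =>
      (abs_ev_le hp _).trans ((norm_part_le j _).trans (hwb d))
    have b2 : ∀ d : ℕ × ℕ, ‖ev p (part j (r ^ (d.1 + d.2) • mono d))‖ ≤ 1 := fun d =>
      (abs_ev_le hp _).trans ((norm_part_le j _).trans (norm_rescale_aux hr0.le hr1 d))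
    refine (hasSum_lift b1 a).unique ?_
    convert! (hasSum_lift b2 a).mul_left (ev p δ ^ j) using 2 with d
    have hh : IsHomog 0 (δ ^ d.1 * δ' ^ d.2) := by simpa using (hδ0.pow d.1).mul (hδ'0.pow d.2)
    simp only [hw, map_smul, part_mul hh]
    by_cases hd : wt d = j
    · have : ev p δ ^ j = ev p δ ^ d.1 * (ev p δ)⁻¹ ^ d.2 := by
        rw [← hd, wt, zpow_sub₀ h0, zpow_natCast, zpow_natCast, inv_pow, div_eq_mul_inv]
      rw [this]
      simp only [ev_mul hp, ev_pow hp, hδδ', smul_eq_mul]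
      ring
    · rw [part_mono_of_ne hd]; simp
  refine ⟨t, ht0, B, fun d hd => ?_, hBf⟩
  have hzero : part (wt d) B = 0 := by
    refine eq_zero_of_ev_eq_zero ?_
    -- Absence of resonance: the powers of Δ 0 ∈ (0, 1) are pairwise distinct.
    have hne : Δ 0 ^ wt d ≠ ρ 0 := by
      rw [hk]; exact fun h => hd (zpow_right_injective₀ hΔ0 hΔ1.ne h)
    have c1 : ContinuousAt (fun p : ℝ × ℝ => Δ ((t • p).1 * (t • p).2)) 0 :=
      ContinuousAt.comp (g := fun p : ℝ × ℝ => Δ (p.1 * p.2)) (f := fun p : ℝ × ℝ => t • p)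
        (by simpa using continuous_at_mul_zero hΔ.continuousAt) (by fun_prop)
    have c2 : ContinuousAt (fun p : ℝ × ℝ => ρ ((t • p).1 * (t • p).2)) 0 :=
      ContinuousAt.comp (g := fun p : ℝ × ℝ => ρ (p.1 * p.2)) (f := fun p : ℝ × ℝ => t • p)
        (by simpa using continuous_at_mul_zero hρ.continuousAt) (by fun_prop)
    have c3 : ContinuousAt (fun p : ℝ × ℝ => Δ ((t • p).1 * (t • p).2) ^ wt d -
        ρ ((t • p).1 * (t • p).2)) 0 :=
      (c1.zpow₀ _ (Or.inl (by simpa using hΔ0.ne'))).sub c2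
    have n1 := c1.eventually_ne (by simpa using hΔ0.ne' : _ ≠ (0 : ℝ))
    have n3 := c3.eventually_ne (by simpa using sub_ne_zero.2 hne : _ ≠ (0 : ℝ))
    filter_upwards [n1, n3, eventually_norm_le_one] with p hp1 hp3 hp
    simp only [Prod.smul_fst, Prod.smul_snd, smul_eq_mul] at hp1 hp3
    rw [hδ p hp] at hp1 hp3
    rw [hr' p hp] at hp3
    have := hpartA (wt d) p hp hp1
    rw [hAB, part_mul hr'0, ev_mul hp] at this
    have h5 : (ev p δ ^ wt d - ev p r') * ev p (part (wt d) B) = 0 := by rw [sub_mul, this, sub_self]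
    exact (mul_eq_zero.1 h5).resolve_left hp3
  have := coeff_part (wt d) B d
  rw [if_pos rfl, hzero] at this
  exact this.symm

end AbsSeries

/-! ### Germs of a single weight; the semiconjugacy -/

namespace AbsSeries

theorem tendsto_smul_zero (t : ℝ) : Tendsto (fun p : ℝ × ℝ => t • p) (𝓝 0) (𝓝 0) := by
  have : ContinuousAt (fun p : ℝ × ℝ => t • p) 0 := by fun_prop
  simpa [ContinuousAt] using this

theorem analyticAt_ev_div (a : AbsSeries) (t : ℝ) :
    AnalyticAt ℝ (fun w : ℝ => ev (w / t ^ 2, 0) a) 0 := by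
  refine AnalyticAt.comp (g := fun w : ℝ => ev (w, 0) a) (f := fun w : ℝ => w / t ^ 2) ?_ ?_
  · simpa using analyticAt_ev_fst a
  · exact analyticAt_id.div_const

theorem exists_germ_of_isHomog_zero {f : ℝ × ℝ → ℝ} {t : ℝ} (ht : 0 < t) {a : AbsSeries}
    (ha : IsHomog 0 a) (h : ∀ p : ℝ × ℝ, ‖p‖ ≤ 1 → f (t • p) = ev p a) :
    ∃ g : ℝ → ℝ, AnalyticAt ℝ g 0 ∧ ∀ᶠ p in 𝓝 (0 : ℝ × ℝ), f p = g (p.1 * p.2) := by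
  refine ⟨_, analyticAt_ev_div (collapse a) t, ?_⟩
  filter_upwards [(tendsto_smul_zero t⁻¹).eventually eventually_norm_le_one] with p hp
  have := h _ hp
  rw [smul_inv_smul₀ ht.ne', ← ha.ev_collapse hp] at this
  rw [this]
  congr 3
  simp only [Prod.smul_fst, Prod.smul_snd, smul_eq_mul]
  field_simp

theorem exists_germ_of_isHomog_one {f : ℝ × ℝ → ℝ} {t : ℝ} (ht : 0 < t) {a : AbsSeries}
    (ha : IsHomog 1 a) (h : ∀ p : ℝ × ℝ, ‖p‖ ≤ 1 → f (t • p) = ev p a) :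
    ∃ g : ℝ → ℝ, AnalyticAt ℝ g 0 ∧ ∀ᶠ p in 𝓝 (0 : ℝ × ℝ), f p = p.1 * g (p.1 * p.2) := by
  refine ⟨fun w => t⁻¹ * ev (w / t ^ 2, 0) (collapse (divX a)),
    analyticAt_const.mul (analyticAt_ev_div (collapse (divX a)) t), ?_⟩
  filter_upwards [(tendsto_smul_zero t⁻¹).eventually eventually_norm_le_one] with p hp
  have h1 := h _ hp
  rw [smul_inv_smul₀ ht.ne', ← ha.part_eq, ← mono_mul_divX, ev_mul hp, ev_mono hp,
    ← (isHomog_divX a).ev_collapse hp] at h1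
  have e : (t⁻¹ • p).1 * (t⁻¹ • p).2 = p.1 * p.2 / t ^ 2 := by
    simp only [Prod.smul_fst, Prod.smul_snd, smul_eq_mul]; field_simp
  rw [h1, e]
  simp only [Prod.smul_fst, smul_eq_mul]
  ring

theorem IsHomog.swapL {k : ℤ} {a : AbsSeries} (ha : IsHomog k a) : IsHomog (-k) (swapL a) :=
  fun e he => by
  refine (coeff_lift (fun d => (norm_mono d.swap).le) a e).unique ?_
  convert! (hasSum_zero : HasSum (fun _ : ℕ × ℕ => (0 : ℝ)) 0) using 2 with d
  by_cases hd : wt d = k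
  · rw [coeff_mono, if_neg, mul_zero]
    rintro rfl
    apply he
    rw [← hd]
    simp only [wt, Prod.fst_swap, Prod.snd_swap]
    ring
  · rw [ha d hd, zero_mul]

theorem norm_swap (p : ℝ × ℝ) : ‖p.swap‖ = ‖p‖ := by
  rw [Prod.norm_def, Prod.norm_def, Prod.fst_swap, Prod.snd_swap, max_comm]

theorem tendsto_swap_zero : Tendsto (fun p : ℝ × ℝ => p.swap) (𝓝 0) (𝓝 0) :=
  (continuous_swap (X := ℝ) (Y := ℝ)).tendsto' 0 0 rfl

theorem exists_germ_of_isHomog_neg_one {f : ℝ × ℝ → ℝ} {t : ℝ} (ht : 0 < t) {a : AbsSeries}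
    (ha : IsHomog (-1) a) (h : ∀ p : ℝ × ℝ, ‖p‖ ≤ 1 → f (t • p) = ev p a) :
    ∃ g : ℝ → ℝ, AnalyticAt ℝ g 0 ∧ ∀ᶠ p in 𝓝 (0 : ℝ × ℝ), f p = p.2 * g (p.1 * p.2) := by
  have ha' : IsHomog 1 (AbsSeries.swapL a) := by simpa using ha.swapL
  obtain ⟨g, hg, hfg⟩ := exists_germ_of_isHomog_one (f := fun p => f p.swap) ht ha' fun p hp => by
    rw [ev_swapL hp, ← h _ ((norm_swap p).trans_le hp)]; rfl
  refine ⟨g, hg, ?_⟩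
  filter_upwards [tendsto_swap_zero.eventually hfg] with p hp
  simpa [mul_comm] using hp

theorem tendsto_normalForm {Δ : ℝ → ℝ} (hΔ : ContinuousAt Δ 0) (h0 : Δ 0 ≠ 0) :
    Tendsto (normalForm Δ) (𝓝 0) (𝓝 0) := by
  have h1 := continuous_at_mul_zero hΔ
  have h2 : ContinuousAt (normalForm Δ) 0 :=
    (h1.mul continuousAt_fst).prodMk ((h1.inv₀ (by simpa using h0)).mul continuousAt_snd)
  have : normalForm Δ 0 = 0 := by simp [normalForm]
  have h3 : Tendsto (normalForm Δ) (𝓝 0) (𝓝 (normalForm Δ 0)) := h2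
  rwa [this] at h3

/-- This is the first component of the conjugacy equation, in coordinates where the involution is
the swap. It follows from `exists_fixedPoint`, applied to the nonlinear part of the rescaled
function σ⁻¹f(σp). -/
theorem exists_semiconjugacy {f : ℝ × ℝ → ℝ} (hf : AnalyticAt ℝ f 0) (hf0 : f 0 = 0) {l : ℝ}
    (hl0 : 0 < l) (hl1 : l < 1) (hf' : HasFDerivAt f (l • ContinuousLinearMap.fst ℝ ℝ ℝ) 0) :
    ∃ (θ : ℝ × ℝ → ℝ) (Δ : ℝ → ℝ) (ε : ℝ), 0 < ε ∧ AnalyticAt ℝ θ 0 ∧ θ 0 = 0 ∧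
      HasFDerivAt θ (ε • ContinuousLinearMap.fst ℝ ℝ ℝ) 0 ∧ AnalyticAt ℝ Δ 0 ∧ Δ 0 = l ∧
      ∀ᶠ p in 𝓝 (0 : ℝ × ℝ), θ (normalForm Δ p) = f (θ p, θ p.swap) := by
  obtain ⟨σ, hσ, a, ha⟩ := exists_eq_ev hf
  have hz : ‖(0 : ℝ × ℝ)‖ ≤ 1 := by simp
  have ha0 : a.coeff 0 = 0 := by rw [coeff_zero_eq_ev, ← ha 0 hz, smul_zero, hf0]
  have had : a.coeff (1, 0) • ContinuousLinearMap.fst ℝ ℝ ℝ +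
      a.coeff (0, 1) • ContinuousLinearMap.snd ℝ ℝ ℝ =
      (l • ContinuousLinearMap.fst ℝ ℝ ℝ) ∘L (σ • ContinuousLinearMap.id ℝ (ℝ × ℝ)) := by
    refine HasFDerivAt.unique (a.hasFDerivAt_ev_zero) ?_
    have h1 : HasFDerivAt (fun p : ℝ × ℝ => σ • p) (σ • ContinuousLinearMap.id ℝ (ℝ × ℝ)) 0 :=
      (hasFDerivAt_id _).const_smul σ
    have h2 : HasFDerivAt (fun p : ℝ × ℝ => f (σ • p)) _ 0 :=
      HasFDerivAt.comp (g := f) (f := fun p : ℝ × ℝ => σ • p) 0 (by simpa using hf') h1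
    refine h2.congr_of_eventuallyEq ?_
    filter_upwards [eventually_norm_le_one] with p hp
    exact (ha p hp).symm
  have ha1 : a.coeff (1, 0) = σ * l := by
    have := congrArg (fun S => S ((1, 0) : ℝ × ℝ)) had
    simpa [mul_comm] using this
  have ha2 : a.coeff (0, 1) = 0 := by
    have := congrArg (fun S => S ((0, 1) : ℝ × ℝ)) had
    simpa using this
  set g : AbsSeries := σ⁻¹ • a + (-l) • mono (1, 0) with hg
  have hgo : OrderTwo g := by
    rintro ⟨i, j⟩ hd
    simp only at hd
    have : (i = 0 ∧ j = 0) ∨ (i = 1 ∧ j = 0) ∨ (i = 0 ∧ j = 1) := by omega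
    rcases this with ⟨rfl, rfl⟩ | ⟨rfl, rfl⟩ | ⟨rfl, rfl⟩
    · have : a.coeff (0, 0) = 0 := ha0
      simp [hg, -neg_smul, coeff_mono, this]
    · simp [hg, -neg_smul, coeff_mono, ha1, hσ.ne']
    · simp [hg, -neg_smul, coeff_mono, ha2]
  have hfg : ∀ p : ℝ × ℝ, ‖p‖ ≤ 1 → f (σ • p) = σ * (l * p.1 + ev p g) := fun p hp => by
    rw [ha p hp, hg, map_add, map_smul, map_smul, ev_mono hp]
    simp only [smul_eq_mul]
    field_simp
    ring
  obtain ⟨ε, θ, u, hε, hθ1, hu1, hu0, hθ0, hp1, hk1, hk2⟩ := exists_fixedPoint hgo hl0 hl1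
  set F := subst θ (swapL θ) g with hF
  have hsθ : ‖swapL θ‖ ≤ 1 := (norm_swapL_le θ).trans hθ1
  have hev : ∀ p : ℝ × ℝ, ‖p‖ ≤ 1 → ‖((ev p θ, ev p.swap θ) : ℝ × ℝ)‖ ≤ 1 := fun p hp => by
    rw [Prod.norm_def]
    exact max_le ((abs_ev_le hp θ).trans hθ1)
      ((abs_ev_le ((norm_swap p).trans_le hp) θ).trans hθ1)
  have hFev : ∀ p : ℝ × ℝ, ‖p‖ ≤ 1 → ev p F = ev (ev p θ, ev p.swap θ) g := fun p hp => by
    rw [hF, ev, subst_subst (norm_fst_le_one hp) (norm_snd_le_one hp) hθ1 hsθ]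
    change subst (ev p θ) (ev p (swapL θ)) g = _
    rw [ev_swapL hp]
    rfl
  -- the series `F` has no linear terms
  have hgd : HasFDerivAt (fun p => ev p g) (0 : ℝ × ℝ →L[ℝ] ℝ) 0 := by
    have := g.hasFDerivAt_ev_zero
    rw [hgo (1, 0) (by simp), hgo (0, 1) (by simp), zero_smul, zero_smul, add_zero] at this
    exact this
  have hθz : ev 0 θ = 0 := by rw [← coeff_zero_eq_ev, hθ0]
  have hθd := θ.hasFDerivAt_ev_zero
  have hFd : F.coeff (1, 0) • ContinuousLinearMap.fst ℝ ℝ ℝ +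
      F.coeff (0, 1) • ContinuousLinearMap.snd ℝ ℝ ℝ = 0 := by
    refine HasFDerivAt.unique (F.hasFDerivAt_ev_zero) ?_
    have h2 : HasFDerivAt (fun p : ℝ × ℝ => ev p.swap θ) _ 0 :=
      HasFDerivAt.comp (g := fun p => ev p θ) (f := Prod.swap) 0 (by simpa using hθd)
        (ContinuousLinearEquiv.prodComm ℝ ℝ ℝ).hasFDerivAt
    have h3 : HasFDerivAt (fun p : ℝ × ℝ => ev (ev p θ, ev p.swap θ) g) _ 0 :=
      HasFDerivAt.comp (g := fun p => ev p g) (f := fun p : ℝ × ℝ => (ev p θ, ev p.swap θ)) 0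
        (by
          have : ((ev 0 θ, ev (0 : ℝ × ℝ).swap θ) : ℝ × ℝ) = 0 := by simp [hθz]
          rw [this]; exact hgd) (hθd.prodMk h2)
    rw [ContinuousLinearMap.zero_comp] at h3
    refine h3.congr_of_eventuallyEq ?_
    filter_upwards [eventually_norm_le_one] with p hp
    exact hFev p hp
  have hF1 : F.coeff (1, 0) = 0 := by
    have := congrArg (fun S => S ((1, 0) : ℝ × ℝ)) hFd
    simpa using this
  have hF2 : F.coeff (0, 1) = 0 := by
    have := congrArg (fun S => S ((0, 1) : ℝ × ℝ)) hFd
    simpa using this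
  have hθ1' : θ.coeff (1, 0) = ε := by
    have := coeff_part 1 θ (1, 0)
    rw [hp1] at this
    simpa [wt, coeff_mono] using this.symm
  have n1 : ‖((1, 0) : ℝ × ℝ)‖ ≤ 1 := by simp
  have n2 : ‖((0, 1) : ℝ × ℝ)‖ ≤ 1 := by simp
  -- On the x-axis the equation of weight 1 compares the coefficients of x: F has no linear term,
  -- hence εu(0) = lε.
  have hul : ev 0 u = l := by
    have h1 := congrArg (ev (1, 0)) (hk1 1 zero_le_one)
    rw [ev_mul n1, map_add, map_smul, ev_part_axis_fst θ (by simp),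
      ev_part_axis_fst F (by simp), hθ1', hF1] at h1
    have h2 : ev (1, 0) u = ev 0 u := hu0.ev_eq_of_mul_eq n1 hz (by simp)
    simp only [Int.natAbs_one, pow_one, h2, smul_eq_mul, mul_one, add_zero] at h1
    exact mul_right_cancel₀ hε.ne' h1
  -- On the y-axis the equation of weight -1 becomes θ₀₁ = l · lθ₀₁, and l² < 1.
  have hθ2 : θ.coeff (0, 1) = 0 := by
    have h1 := congrArg (ev (0, 1)) (hk2 (-1) (by norm_num))
    rw [ev_mul n2, map_add, map_smul, ev_part_axis_snd θ (by simp),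
      ev_part_axis_snd F (by simp), hF2] at h1
    have h2 : ev (0, 1) u = ev 0 u := hu0.ev_eq_of_mul_eq n2 hz (by simp)
    simp only [Int.natAbs_neg, Int.natAbs_one, pow_one, h2, hul, smul_eq_mul, mul_one,
      add_zero] at h1
    have h3 : (1 - l * l) * θ.coeff (0, 1) = 0 := by linear_combination h1
    exact (mul_eq_zero.1 h3).resolve_left (by nlinarith)
  have hΔ : ∀ p : ℝ × ℝ, ‖p‖ ≤ 1 → ev (p.1 * p.2, 0) (collapse u) = ev p u :=
    fun p hp => hu0.ev_collapse hp
  have hΔ0 : ev (0, 0) (collapse u) = l := by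
    have := hΔ 0 hz
    simpa [hul] using this
  refine ⟨fun p => σ * ev p θ, fun w => ev (w, 0) (collapse u), σ * ε, by positivity,
    analyticAt_const.mul (analyticAt_ev θ (by simp)), by simp [hθz], ?_,
    analyticAt_ev_fst _, hΔ0, ?_⟩
  · have := hθd.const_mul σ
    rw [hθ1', hθ2, zero_smul, add_zero, smul_smul] at this
    exact this
  · have hN := tendsto_normalForm (analyticAt_ev_fst (collapse u)).continuousAt
      (by rw [hΔ0]; exact hl0.ne')
    have hc : ContinuousAt (fun p => ev p u) 0 := (analyticAt_ev u (by simp)).continuousAt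
    filter_upwards [eventually_norm_le_one, hN.eventually eventually_norm_le_one,
      hc.eventually_ne (by rw [hul]; exact hl0.ne')] with p hp hNp hup
    have e : normalForm (fun w => ev (w, 0) (collapse u)) p =
        (ev p u * p.1, (ev p u)⁻¹ * p.2) := by simp only [normalForm, hΔ p hp]
    rw [e] at hNp ⊢
    rw [ev_scale_eq_of_parts hk1 hk2 hp hup hNp, hFev p hp]
    have := hfg _ (hev p hp)
    simp only [Prod.smul_mk, smul_eq_mul] at this
    exact this.symm

end AbsSeries

/-! ### Local inverses, Jacobians and primitives -/

theorem exists_analytic_localInverse {F : ℝ × ℝ → ℝ × ℝ} {a : ℝ × ℝ} (hF : AnalyticAt ℝ F a)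
    (hdet : (fderiv ℝ F a).det ≠ 0) :
    ∃ G : ℝ × ℝ → ℝ × ℝ, AnalyticAt ℝ G (F a) ∧ G (F a) = a ∧ (∀ᶠ x in 𝓝 a, G (F x) = x) ∧
      ∀ᶠ y in 𝓝 (F a), F (G y) = y := by
  set i := (fderiv ℝ F a).toContinuousLinearEquivOfDetNeZero hdet with hi
  have hi' : (i : ℝ × ℝ →L[ℝ] ℝ × ℝ) = fderiv ℝ F a :=
    ContinuousLinearMap.coe_toContinuousLinearEquivOfDetNeZero _ _
  have hs : HasStrictFDerivAt F (i : ℝ × ℝ →L[ℝ] ℝ × ℝ) a := by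
    rw [hi']; exact hF.hasStrictFDerivAt
  have hsymm := (hs.toOpenPartialHomeomorph F).analyticAt_symm' (i := i)
    (hs.mem_toOpenPartialHomeomorph_source) hF hi'.symm
  exact ⟨hs.localInverse F i a, hsymm, hs.localInverse_apply_image, hs.eventually_left_inverse,
    hs.eventually_right_inverse⟩

theorem exists_analytic_localInverse_real {h : ℝ → ℝ} {a : ℝ} (hh : AnalyticAt ℝ h a)
    (h' : deriv h a ≠ 0) :
    ∃ g : ℝ → ℝ, AnalyticAt ℝ g (h a) ∧ g (h a) = a ∧ (∀ᶠ x in 𝓝 a, g (h x) = x) ∧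
      ∀ᶠ y in 𝓝 (h a), h (g y) = y :=
  ⟨_, hh.analyticAt_localInverse h', HasStrictFDerivAt.localInverse_apply_image _,
    HasStrictDerivAt.eventually_left_inverse _ h', HasStrictDerivAt.eventually_right_inverse _ h'⟩

theorem det_eq_of_prod (A : ℝ × ℝ →L[ℝ] ℝ × ℝ) :
    A.det = (A (1, 0)).1 * (A (0, 1)).2 - (A (0, 1)).1 * (A (1, 0)).2 := by
  rw [ContinuousLinearMap.det, ← LinearMap.det_toMatrix (Module.Basis.finTwoProd ℝ),
    Matrix.det_fin_two]
  simp [LinearMap.toMatrix_apply]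

theorem det_comp_prod (A B : ℝ × ℝ →L[ℝ] ℝ × ℝ) : (A ∘L B).det = A.det * B.det := by
  simp [ContinuousLinearMap.det, LinearMap.det_comp]

theorem analyticAt_det_fderiv {F : ℝ × ℝ → ℝ × ℝ} {a : ℝ × ℝ} (hF : AnalyticAt ℝ F a) :
    AnalyticAt ℝ (fun p => (fderiv ℝ F p).det) a := by
  have h1 : ∀ v, AnalyticAt ℝ (fun p => fderiv ℝ F p v) a := fun v =>
    ((ContinuousLinearMap.apply ℝ (ℝ × ℝ) v).analyticAt _).comp hF.fderiv
  have h2 : ∀ v, AnalyticAt ℝ (fun p => (fderiv ℝ F p v).1) a := fun v =>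
    analyticAt_fst.comp (h1 v)
  have h3 : ∀ v, AnalyticAt ℝ (fun p => (fderiv ℝ F p v).2) a := fun v =>
    analyticAt_snd.comp (h1 v)
  simp only [det_eq_of_prod]
  exact ((h2 _).mul (h3 _)).sub ((h2 _).mul (h3 _))

/-- The derivative of a map `(x, y) ↦ (a (x * y) * x, b (x * y) * y)`. -/
theorem hasFDerivAt_weightMap {a b : ℝ → ℝ} {a' b' : ℝ} {p : ℝ × ℝ}
    (ha : HasDerivAt a a' (p.1 * p.2)) (hb : HasDerivAt b b' (p.1 * p.2)) :
    ∃ A : ℝ × ℝ →L[ℝ] ℝ × ℝ,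
      HasFDerivAt (fun q : ℝ × ℝ => (a (q.1 * q.2) * q.1, b (q.1 * q.2) * q.2)) A p ∧
      A.det = a (p.1 * p.2) * b (p.1 * p.2) +
        p.1 * p.2 * (a' * b (p.1 * p.2) + a (p.1 * p.2) * b') ∧
      (p = 0 → ∀ v, A v = (a 0 * v.1, b 0 * v.2)) := by
  have hm : HasFDerivAt (fun q : ℝ × ℝ => q.1 * q.2) _ p :=
    (hasFDerivAt_fst (𝕜 := ℝ) (E := ℝ) (F := ℝ)).mul hasFDerivAt_snd
  have h1 := (ha.comp_hasFDerivAt p hm).mul (hasFDerivAt_fst (𝕜 := ℝ) (E := ℝ) (F := ℝ))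
  have h2 := (hb.comp_hasFDerivAt p hm).mul (hasFDerivAt_snd (𝕜 := ℝ) (E := ℝ) (F := ℝ))
  refine ⟨_, h1.prodMk h2, ?_, ?_⟩
  · rw [det_eq_of_prod]
    simp
    ring
  · rintro rfl v
    simp

/-- The coefficient of xⁿ is divided by n + 1. The primitive is kept in the form w k(w), since k is
what is needed afterwards: its square root is the factor α of the symplectic correction. -/
theorem exists_analytic_primitive {j : ℝ → ℝ} (hj : AnalyticAt ℝ j 0) :
    ∃ k : ℝ → ℝ, AnalyticAt ℝ k 0 ∧ ∀ᶠ w in 𝓝 (0 : ℝ), HasDerivAt (fun w => w * k w) (j w) w := by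
  obtain ⟨σ, hσ, c, hc⟩ := AbsSeries.exists_eq_ev (f := fun p : ℝ × ℝ => j p.1)
    (AnalyticAt.comp (g := j) (f := fun p : ℝ × ℝ => p.1) hj analyticAt_fst)
  set w : ℕ × ℕ → AbsSeries := fun d => ((d.1 : ℝ) + 1)⁻¹ • AbsSeries.mono d with hw
  have hinv : ∀ n : ℕ, |((n : ℝ) + 1)⁻¹| ≤ 1 := fun n => by
    rw [abs_of_pos (by positivity)]
    exact inv_le_one_of_one_le₀ (by linarith [n.cast_nonneg (α := ℝ)])
  have hwb : ∀ d, ‖w d‖ ≤ 1 := fun d => by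
    rw [hw, norm_smul, AbsSeries.norm_mono, mul_one]; exact hinv _
  set b := AbsSeries.lift w c with hb
  have hpt : ∀ x : ℝ, |x| ≤ 1 → ‖((x, 0) : ℝ × ℝ)‖ ≤ 1 := fun x hx => by
    simpa [Prod.norm_def] using hx
  have hevb : ∀ x : ℝ, |x| ≤ 1 → HasSum (fun d : ℕ × ℕ =>
      c.coeff d * (((d.1 : ℝ) + 1)⁻¹ * x ^ (d.1 + 1) * 0 ^ d.2)) (x * AbsSeries.ev (x, 0) b) := by
    intro x hx
    have hwb' : ∀ d, ‖AbsSeries.ev (x, 0) (w d)‖ ≤ 1 := fun d =>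
      (AbsSeries.abs_ev_le (hpt x hx) _).trans (hwb d)
    have := (AbsSeries.hasSum_lift hwb' c).mul_left x
    rw [← AbsSeries.ev_lift hwb] at this
    convert! this using 2 with d
    simp only [hw, map_smul, AbsSeries.ev_mono (hpt x hx), smul_eq_mul]
    ring
  have hder : ∀ y : ℝ, y ∈ Metric.ball (0 : ℝ) 1 →
      HasDerivAt (fun x => x * AbsSeries.ev (x, 0) b) (AbsSeries.ev (y, 0) c) y := by
    intro y hy
    have h1 := hasDerivAt_tsum_of_isPreconnected (y₀ := 0) (y := y) (t := Metric.ball (0 : ℝ) 1)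
      (g := fun (d : ℕ × ℕ) x => c.coeff d * (((d.1 : ℝ) + 1)⁻¹ * x ^ (d.1 + 1) * 0 ^ d.2))
      (g' := fun (d : ℕ × ℕ) x => c.coeff d * (x ^ d.1 * 0 ^ d.2))
      (c.hasSum_norm_coeff.summable) Metric.isOpen_ball
      (convex_ball (0 : ℝ) 1).isPreconnected ?_ ?_ (Metric.mem_ball_self one_pos) ?_ hy
    · have hy' : |y| ≤ 1 := by
        have : |y| < 1 := by simpa using hy
        exact this.le
      rw [(AbsSeries.hasSum_ev (hpt y hy') c).tsum_eq] at h1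
      refine h1.congr_of_eventuallyEq ?_
      filter_upwards [Metric.isOpen_ball.mem_nhds hy] with x hx
      have hx' : |x| < 1 := by simpa using hx
      exact (hevb x hx'.le).tsum_eq.symm
    · intro d x _
      have := ((((hasDerivAt_id x).pow (d.1 + 1)).const_mul ((d.1 : ℝ) + 1)⁻¹).mul_const
        ((0 : ℝ) ^ d.2)).const_mul (c.coeff d)
      convert! this using 1
      have : ((d.1 : ℝ) + 1) ≠ 0 := by positivity
      simp only [id, Nat.add_sub_cancel, mul_one]
      push_cast
      field_simp
    · intro d x hx
      have hx' : |x| < 1 := by simpa using hx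
      rw [norm_mul, Real.norm_eq_abs]
      refine mul_le_of_le_one_right (abs_nonneg _) ?_
      exact AbsSeries.norm_pow_mul_pow_le_one (by simpa using hx'.le) (by simp) d
    · exact (hevb 0 (by simp)).summable
  refine ⟨fun w => AbsSeries.ev (w / σ, 0) b, ?_, ?_⟩
  · refine AnalyticAt.comp (g := fun w : ℝ => AbsSeries.ev (w, 0) b) (f := fun w : ℝ => w / σ) ?_ ?_
    · simpa using AbsSeries.analyticAt_ev_fst b
    · exact analyticAt_id.div_const
  · have hball : Metric.ball (0 : ℝ) σ ∈ 𝓝 (0 : ℝ) := Metric.ball_mem_nhds _ hσ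
    filter_upwards [hball] with x hx
    have hx' : |x| < σ := by simpa using hx
    have hxσ : |x / σ| < 1 := by rwa [abs_div, abs_of_pos hσ, div_lt_one hσ]
    have h1 := (hder (x / σ) (by rw [Metric.mem_ball, dist_zero_right]; exact hxσ)).comp x ((hasDerivAt_id x).div_const σ)
    have h2 := h1.const_mul σ
    have h3 := hc (x / σ, 0) (hpt _ hxσ.le)
    simp only [Prod.smul_mk, smul_eq_mul] at h3
    rw [mul_div_cancel₀ _ hσ.ne'] at h3
    rw [← h3] at h2
    convert! h2 using 1
    · funext z; simp only [Function.comp, id]; field_simp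
    · field_simp

/-! ### Normal form of a reversible symplectic map -/

open AbsSeries (tendsto_normalForm tendsto_swap_zero continuous_at_mul_zero)

/-- Strict differentiability bounds the error of linearization by (l/2)‖q.1 - q.2‖ for both points
at once; on a common horizontal line the linear part is l|x - x'|, which dominates. -/
theorem eventually_injective_fst {f : ℝ × ℝ → ℝ} {l : ℝ} (hl : 0 < l)
    (hf : HasStrictFDerivAt f (l • ContinuousLinearMap.fst ℝ ℝ ℝ) 0) :
    ∀ᶠ q in 𝓝 ((0, 0) : (ℝ × ℝ) × (ℝ × ℝ)), q.1.2 = q.2.2 → f q.1 = f q.2 → q.1 = q.2 := by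
  have h := hf.isLittleO.def (c := l / 2) (by positivity)
  filter_upwards [h] with q hq h2 hfq
  rw [hfq, sub_self, zero_sub, norm_neg] at hq
  have e1 : ‖q.1 - q.2‖ = |q.1.1 - q.2.1| := by
    rw [Prod.norm_def, Prod.snd_sub, h2, sub_self, norm_zero, max_eq_left (norm_nonneg _)]
    rfl
  rw [e1] at hq
  simp only [smul_apply, ContinuousLinearMap.coe_fst', Prod.fst_sub, smul_eq_mul,
    norm_mul, Real.norm_eq_abs, abs_of_pos hl] at hq
  have h3 : |q.1.1 - q.2.1| ≤ 0 := by nlinarith [abs_nonneg (q.1.1 - q.2.1)]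
  have h4 : q.1.1 = q.2.1 := by
    have := abs_eq_zero.1 (le_antisymm h3 (abs_nonneg _)); linarith
  exact Prod.ext h4 h2

theorem normalForm_swap {Δ : ℝ → ℝ} {p : ℝ × ℝ} (h : Δ (p.1 * p.2) ≠ 0) :
    normalForm Δ (normalForm Δ p).swap = p.swap := by
  have e : (Δ (p.1 * p.2))⁻¹ * p.2 * (Δ (p.1 * p.2) * p.1) = p.1 * p.2 := by field_simp
  simp only [normalForm, Prod.fst_swap, Prod.snd_swap, e]
  ext <;> simp [h]

/-- Only the first component is solved for. Put z = (θ(p), θ(swap p)). The semiconjugacy at swap(N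
p), together with N(swap(N p)) = swap p, and the reversibility of T at z give the same value θ(swap
p) to f at two points with the common second coordinate θ(N p). Injectivity of f in its first
variable identifies the second component of T z with θ(swap(N p)). -/
theorem exists_conjugacy_of_reversible {T : ℝ × ℝ → ℝ × ℝ} (hT : AnalyticAt ℝ T 0) (hT0 : T 0 = 0)
    {l : ℝ} (hl0 : 0 < l) (hl1 : l < 1)
    (hT' : HasFDerivAt (fun p => (T p).1) (l • ContinuousLinearMap.fst ℝ ℝ ℝ) 0)
    (hrev : ∀ᶠ p in 𝓝 (0 : ℝ × ℝ), (T (T p).swap).swap = p) :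
    ∃ (θ : ℝ × ℝ → ℝ) (Δ : ℝ → ℝ) (ε : ℝ), 0 < ε ∧ AnalyticAt ℝ θ 0 ∧ θ 0 = 0 ∧
      HasFDerivAt θ (ε • ContinuousLinearMap.fst ℝ ℝ ℝ) 0 ∧ AnalyticAt ℝ Δ 0 ∧ Δ 0 = l ∧
      ∀ᶠ p in 𝓝 (0 : ℝ × ℝ), T (θ p, θ p.swap) =
        (θ (normalForm Δ p), θ (normalForm Δ p).swap) := by
  have hf : AnalyticAt ℝ (fun p => (T p).1) 0 := analyticAt_fst.comp hT
  obtain ⟨θ, Δ, ε, hε, hθ, hθ0, hθ', hΔ, hΔ0, hsem⟩ :=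
    AbsSeries.exists_semiconjugacy hf (by simp [hT0]) hl0 hl1 hT'
  refine ⟨θ, Δ, ε, hε, hθ, hθ0, hθ', hΔ, hΔ0, ?_⟩
  have hN := tendsto_normalForm hΔ.continuousAt (by rw [hΔ0]; exact hl0.ne')
  have hθt : Tendsto θ (𝓝 0) (𝓝 0) := by simpa [hθ0] using hθ.continuousAt.tendsto
  have hΦt : Tendsto (fun p : ℝ × ℝ => (θ p, θ p.swap)) (𝓝 0) (𝓝 0) := by
    exact hθt.prodMk_nhds (hθt.comp tendsto_swap_zero)
  have hTt : Tendsto T (𝓝 0) (𝓝 0) := by simpa [hT0] using hT.continuousAt.tendsto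
  have hTt2 : Tendsto (fun p => (T p).2) (𝓝 0) (𝓝 0) :=
    (continuous_snd.tendsto' (0 : ℝ × ℝ) 0 rfl).comp hTt
  have hinj := eventually_injective_fst hl0 (by
    have := hf.hasStrictFDerivAt; rwa [hT'.fderiv] at this)
  -- the pair of points to which injectivity is applied
  have hpair : Tendsto (fun p : ℝ × ℝ => (((θ (normalForm Δ p).swap, θ (normalForm Δ p)),
      ((T (θ p, θ p.swap)).2, θ (normalForm Δ p))) : (ℝ × ℝ) × (ℝ × ℝ)))
      (𝓝 0) (𝓝 ((0, 0) : (ℝ × ℝ) × (ℝ × ℝ))) := by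
    have h1 := (hθt.comp tendsto_swap_zero).comp hN
    have h2 := hθt.comp hN
    have h3 := hTt2.comp hΦt
    exact (h1.prodMk_nhds h2).prodMk_nhds (h3.prodMk_nhds h2)
  filter_upwards [hsem, (tendsto_swap_zero.comp hN).eventually hsem, hΦt.eventually hrev,
    hpair.eventually hinj,
    (continuous_at_mul_zero hΔ.continuousAt).eventually_ne
      (by simpa [hΔ0] using hl0.ne' : _ ≠ (0 : ℝ))] with p h1 h2 h3 h4 h5
  simp only [Function.comp] at h2
  rw [normalForm_swap h5, Prod.swap_swap] at h2
  have h6 := congrArg Prod.snd h3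
  rw [Prod.snd_swap] at h6
  have e : (T (θ p, θ p.swap)).swap = ((T (θ p, θ p.swap)).2, θ (normalForm Δ p)) := by
    ext
    · rfl
    · rw [Prod.snd_swap, ← h1]
  rw [e] at h6
  have h7 := congrArg Prod.fst (h4 rfl (h2.symm.trans h6.symm))
  ext
  · exact h1.symm
  · exact h7.symm

theorem eventually_det_fderiv_normalForm {Δ : ℝ → ℝ} (hΔ : AnalyticAt ℝ Δ 0) (h0 : Δ 0 ≠ 0) :
    ∀ᶠ p in 𝓝 (0 : ℝ × ℝ), DifferentiableAt ℝ (normalForm Δ) p ∧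
      (fderiv ℝ (normalForm Δ) p).det = 1 := by
  have hm : Tendsto (fun p : ℝ × ℝ => p.1 * p.2) (𝓝 0) (𝓝 0) :=
    (continuous_mul (M := ℝ)).tendsto' 0 0 (by simp)
  filter_upwards [hm.eventually hΔ.eventually_analyticAt,
    hm.eventually (hΔ.continuousAt.eventually_ne h0)] with p h1 h2
  have hd := h1.differentiableAt.hasDerivAt
  obtain ⟨A, hA, hdet, -⟩ := hasFDerivAt_weightMap hd (hd.fun_inv h2)
  have hA' : HasFDerivAt (normalForm Δ) A p := hA
  refine ⟨hA'.differentiableAt, ?_⟩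
  rw [hA'.fderiv, hdet]
  field_simp
  ring

/-- By the chain rule, with T and N of Jacobian 1, the Jacobian of Ψ is invariant under N. It is
therefore of weight 0, that is, a function of xy. -/
theorem exists_det_eq_mul {T Ψ : ℝ × ℝ → ℝ × ℝ} {Δ : ℝ → ℝ} (hT : AnalyticAt ℝ T 0)
    (hΨ : AnalyticAt ℝ Ψ 0) (hΨ0 : Ψ 0 = 0) (hΔ : AnalyticAt ℝ Δ 0) (hΔ0 : 0 < Δ 0) (hΔ1 : Δ 0 < 1)
    (hdet : ∀ᶠ p in 𝓝 (0 : ℝ × ℝ), (fderiv ℝ T p).det = 1)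
    (hconj : ∀ᶠ p in 𝓝 (0 : ℝ × ℝ), T (Ψ p) = Ψ (normalForm Δ p)) :
    ∃ j : ℝ → ℝ, AnalyticAt ℝ j 0 ∧
      ∀ᶠ p in 𝓝 (0 : ℝ × ℝ), (fderiv ℝ Ψ p).det = j (p.1 * p.2) := by
  have hΨt : Tendsto Ψ (𝓝 0) (𝓝 0) := by simpa [hΨ0] using hΨ.continuousAt.tendsto
  have hN := tendsto_normalForm hΔ.continuousAt hΔ0.ne'
  have hinv : ∀ᶠ p in 𝓝 (0 : ℝ × ℝ), (fderiv ℝ Ψ (normalForm Δ p)).det =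
      (fun _ : ℝ => (1 : ℝ)) (p.1 * p.2) * (fderiv ℝ Ψ p).det := by
    filter_upwards [hconj.eventually_nhds, hΨt.eventually hdet,
      hΨt.eventually hT.eventually_analyticAt, hΨ.eventually_analyticAt,
      hN.eventually hΨ.eventually_analyticAt,
      eventually_det_fderiv_normalForm hΔ hΔ0.ne'] with p h1 h2 h3 h4 h5 h6
    have e1 := (h3.differentiableAt.hasFDerivAt.comp p h4.differentiableAt.hasFDerivAt)
    have e2 := (h5.differentiableAt.hasFDerivAt.comp p h6.1.hasFDerivAt)
    have e3 := (e1.congr_of_eventuallyEq (f₁ := Ψ ∘ normalForm Δ)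
      (by filter_upwards [h1] with q hq; exact hq.symm)).unique e2
    have e4 := congrArg ContinuousLinearMap.det e3
    rw [det_comp_prod, det_comp_prod, h2, h6.2, one_mul, mul_one] at e4
    rw [one_mul]; exact e4.symm
  obtain ⟨t, ht, a, ha, hev⟩ := AbsSeries.exists_isHomog_of_equivariant (k := 0)
    (analyticAt_det_fderiv hΨ) hΔ analyticAt_const hΔ0 hΔ1 (by simp) hinv
  exact AbsSeries.exists_germ_of_isHomog_zero ht ha hev

/-- The involution `(s, r) ↦ (s, -r)`, which reverses the billiard flow. -/
def negSnd (p : ℝ × ℝ) : ℝ × ℝ := (p.1, -p.2)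

theorem tendsto_negSnd_zero : Tendsto negSnd (𝓝 0) (𝓝 0) := by
  have : Continuous negSnd := by unfold negSnd; fun_prop
  exact this.tendsto' 0 0 (by simp [negSnd])

theorem tendsto_mul_zero : Tendsto (fun p : ℝ × ℝ => p.1 * p.2) (𝓝 0) (𝓝 0) :=
  (continuous_mul (M := ℝ)).tendsto' 0 0 (by simp)

/-- The map Q(x, y) = (α(xy)x, α(xy)y) has the Jacobian (wα²)' at w = xy, so α² = k with (wk)' = j
gives it the Jacobian of Ψ. Since Q preserves the levels of xy and commutes with the swap, Q ∘ Ψ⁻¹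
remains a conjugacy to a normal form and remains compatible with the involutions. -/
theorem exists_symplectic_conjugacy {T Ψ : ℝ × ℝ → ℝ × ℝ} {Δ : ℝ → ℝ} (hT : AnalyticAt ℝ T 0)
    (hT0 : T 0 = 0) (hdet : ∀ᶠ p in 𝓝 (0 : ℝ × ℝ), (fderiv ℝ T p).det = 1)
    (hΨ : AnalyticAt ℝ Ψ 0) (hΨ0 : Ψ 0 = 0) {A : ℝ × ℝ →L[ℝ] ℝ × ℝ} (hA : HasFDerivAt Ψ A 0)
    (hAdet : 0 < A.det) {c : ℝ} (hc : 0 < c) (hAc : A (1, 1) = (c, 0))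
    (hΔ : AnalyticAt ℝ Δ 0) (hΔ0 : 0 < Δ 0) (hΔ1 : Δ 0 < 1)
    (hflip : ∀ p, Ψ p.swap = negSnd (Ψ p))
    (hconj : ∀ᶠ p in 𝓝 (0 : ℝ × ℝ), T (Ψ p) = Ψ (normalForm Δ p)) :
    ∃ (Δ' : ℝ → ℝ) (R : ℝ × ℝ → ℝ × ℝ), AnalyticAt ℝ Δ' 0 ∧ Δ' 0 = Δ 0 ∧ AnalyticAt ℝ R 0 ∧
      R 0 = 0 ∧ (∀ᶠ p in 𝓝 (0 : ℝ × ℝ), (fderiv ℝ R p).det = 1) ∧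
      (∀ᶠ p in 𝓝 (0 : ℝ × ℝ), R (T p) = normalForm Δ' (R p)) ∧
      (∀ᶠ p in 𝓝 (0 : ℝ × ℝ), R (negSnd p) = (R p).swap) ∧ 0 < (fderiv ℝ R 0 (1, 0)).1 := by
  obtain ⟨j, hj, hJ⟩ := exists_det_eq_mul hT hΨ hΨ0 hΔ hΔ0 hΔ1 hdet hconj
  have hj0 : 0 < j 0 := by
    have := hJ.self_of_nhds
    rw [hA.fderiv] at this
    simpa [this] using hAdet
  obtain ⟨k, hk, hkj⟩ := exists_analytic_primitive hj
  set h : ℝ → ℝ := fun w => w * k w with hh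
  have hk0 : k 0 = j 0 := by
    have h1 := hkj.self_of_nhds
    have h2 := (hasDerivAt_id (0 : ℝ)).mul hk.differentiableAt.hasDerivAt
    have := h1.unique h2
    simpa using this.symm
  have hkpos : 0 < k 0 := by rw [hk0]; exact hj0
  -- the square root of `k`
  set α : ℝ → ℝ := fun w => Real.exp (Real.log (k w) / 2) with hα
  have hαa : AnalyticAt ℝ α 0 := ((hk.log hkpos).div_const).rexp
  have hα2 : ∀ᶠ w in 𝓝 (0 : ℝ), α w * α w = k w := by
    filter_upwards [hk.continuousAt.eventually_const_lt hkpos] with w hw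
    rw [hα, ← Real.exp_add, add_halves, Real.exp_log hw]
  have hha : AnalyticAt ℝ h 0 := analyticAt_id.mul hk
  have hh0 : h 0 = 0 := by simp [hh]
  obtain ⟨g, hg, hg0, hgh, -⟩ := exists_analytic_localInverse_real hha
    (by rw [hkj.self_of_nhds.deriv]; exact hj0.ne')
  rw [hh0] at hg hg0
  obtain ⟨G, hG, hG0, hGΨ, hΨG⟩ := exists_analytic_localInverse hΨ
    (by rw [hA.fderiv]; exact hAdet.ne')
  rw [hΨ0] at hG hG0 hΨG
  have hGt : Tendsto G (𝓝 0) (𝓝 0) := by simpa [hG0] using hG.continuousAt.tendsto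
  have hΨt : Tendsto Ψ (𝓝 0) (𝓝 0) := by simpa [hΨ0] using hΨ.continuousAt.tendsto
  have hTt : Tendsto T (𝓝 0) (𝓝 0) := by simpa [hT0] using hT.continuousAt.tendsto
  have hN := tendsto_normalForm hΔ.continuousAt hΔ0.ne'
  set Q : ℝ × ℝ → ℝ × ℝ := fun q => (α (q.1 * q.2) * q.1, α (q.1 * q.2) * q.2) with hQ
  have hαm : AnalyticAt ℝ (fun q : ℝ × ℝ => α (q.1 * q.2)) 0 :=
    AnalyticAt.comp (g := α) (f := fun q : ℝ × ℝ => q.1 * q.2) (by simpa using hαa)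
      (analyticAt_fst.mul analyticAt_snd)
  have hQa : AnalyticAt ℝ Q 0 := (hαm.mul analyticAt_fst).prod (hαm.mul analyticAt_snd)
  have hQ0 : Q 0 = 0 := by simp [hQ]
  -- the determinant of the derivative of `Q`
  have hQdet : ∀ᶠ q in 𝓝 (0 : ℝ × ℝ), (fderiv ℝ Q q).det = j (q.1 * q.2) := by
    filter_upwards [tendsto_mul_zero.eventually hαa.eventually_analyticAt,
      tendsto_mul_zero.eventually hα2.eventually_nhds, tendsto_mul_zero.eventually hkj]
      with q h1 h2 h3
    have hd := h1.differentiableAt.hasDerivAt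
    obtain ⟨B, hB, hBdet, -⟩ := hasFDerivAt_weightMap hd hd
    have hB' : HasFDerivAt Q B q := hB
    rw [hB'.fderiv, hBdet]
    have h4 : HasDerivAt (fun w => w * (α w * α w)) _ (q.1 * q.2) :=
      (hasDerivAt_id _).mul (hd.mul hd)
    have h5 := (h4.congr_of_eventuallyEq (f₁ := fun w => w * k w)
      (by filter_upwards [h2] with w hw; rw [hw])).unique h3
    simpa using h5
  have hRa : AnalyticAt ℝ (Q ∘ G) 0 := AnalyticAt.comp (by rw [hG0]; exact hQa) hG
  refine ⟨fun w => Δ (g w), Q ∘ G, ?_, by simp [hg0], hRa,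
    by simp [hG0, hQ0], ?_, ?_, ?_, ?_⟩
  · exact AnalyticAt.comp (g := Δ) (f := g) (by rwa [hg0]) hg
  · filter_upwards [hGt.eventually hQa.eventually_analyticAt, hG.eventually_analyticAt,
      hGt.eventually hQdet, hGt.eventually hJ, hGt.eventually hΨ.eventually_analyticAt,
      hΨG.eventually_nhds] with p h1 h2 h3 h4 h5 h6
    have e1 := h1.differentiableAt.hasFDerivAt.comp p h2.differentiableAt.hasFDerivAt
    have e2 := h5.differentiableAt.hasFDerivAt.comp p h2.differentiableAt.hasFDerivAt
    have e3 := (e2.congr_of_eventuallyEq (f₁ := id)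
      (by filter_upwards [h6] with q hq; exact hq.symm)).unique (hasFDerivAt_id p)
    have e4 := congrArg ContinuousLinearMap.det e3
    rw [det_comp_prod, h4] at e4
    rw [e1.fderiv, det_comp_prod, h3, e4]
    simp [ContinuousLinearMap.det]
  · have hm : Tendsto (fun p => (G p).1 * (G p).2) (𝓝 0) (𝓝 0) := tendsto_mul_zero.comp hGt
    filter_upwards [hΨG, hGt.eventually hconj, (hN.comp hGt).eventually hGΨ,
      hm.eventually hgh, hm.eventually hα2,
      hm.eventually (hΔ.continuousAt.eventually_ne hΔ0.ne')] with p h1 h2 h3 h4 h5 h6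
    rw [h1] at h2
    simp only [Function.comp] at h3 ⊢
    rw [h2, h3]
    set q := G p with hq
    have e : Δ (q.1 * q.2) * q.1 * ((Δ (q.1 * q.2))⁻¹ * q.2) = q.1 * q.2 := by field_simp
    -- The product of the new coordinates is h(w) = w k(w), where w is the old product. Hence the
    -- old multiplier Δ(w) becomes Δ ∘ g of the new product, g being the inverse of h.
    have e2 : α (q.1 * q.2) * q.1 * (α (q.1 * q.2) * q.2) = h (q.1 * q.2) := by
      simp only [hh, ← h5]; ring
    simp only [hQ, normalForm, e, e2, h4]
    ext
    · ring
    · ring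
  · filter_upwards [hΨG, hGt.eventually hGΨ, (tendsto_swap_zero.comp hGt).eventually hGΨ]
      with p h1 _ h3
    simp only [Function.comp] at h3 ⊢
    rw [hflip, h1] at h3
    rw [h3]
    simp only [hQ, Prod.fst_swap, Prod.snd_swap, Prod.swap_prod_mk, mul_comm (G p).2]
  · have hd0 : HasDerivAt α (deriv α 0) ((0 : ℝ × ℝ).1 * (0 : ℝ × ℝ).2) := by
      simpa using hαa.differentiableAt.hasDerivAt
    obtain ⟨B, hB, -, hBv⟩ := hasFDerivAt_weightMap (p := 0) hd0 hd0
    have hB' : HasFDerivAt Q B 0 := hB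
    have e1 : HasFDerivAt ((Q ∘ G) ∘ Ψ) ((fderiv ℝ (Q ∘ G) 0) ∘L A) 0 :=
      HasFDerivAt.comp 0 (by rw [hΨ0]; exact hRa.differentiableAt.hasFDerivAt) hA
    -- As Q = R ∘ Ψ near 0, differentiating along (1, 1), which Ψ sends to (c, 0), gives α(0) = c
    -- ∂ₛR₁, where R₁ is the first component of R. This determines the sign.
    have e2 := (hB'.congr_of_eventuallyEq (f₁ := (Q ∘ G) ∘ Ψ)
      (by filter_upwards [hGΨ] with q hq; simp only [Function.comp, hq])).unique e1
    have e3 := congrArg (fun S => (S ((1, 1) : ℝ × ℝ)).1) e2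
    simp only [hBv rfl, ContinuousLinearMap.comp_apply, hAc] at e3
    have e4 : ((c, 0) : ℝ × ℝ) = c • (1, 0) := by simp
    rw [e4, map_smul, Prod.smul_fst, smul_eq_mul, mul_one] at e3
    have h5 : 0 < α 0 := Real.exp_pos _
    by_contra hneg
    push Not at hneg
    nlinarith

/-- Reversibility forces equal diagonal entries P, so the eigenvectors are (1, ±κ) with βκ² = γ.
They are exchanged by `negSnd`, which thus becomes the swap in the eigencoordinates. -/
theorem exists_reversible_normalForm {T : ℝ × ℝ → ℝ × ℝ} (hT : AnalyticAt ℝ T 0) (hT0 : T 0 = 0)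
    (hdet : ∀ᶠ p in 𝓝 (0 : ℝ × ℝ), (fderiv ℝ T p).det = 1)
    (hrev : ∀ᶠ p in 𝓝 (0 : ℝ × ℝ), negSnd (T (negSnd (T p))) = p)
    {A : ℝ × ℝ →L[ℝ] ℝ × ℝ} (hA : HasFDerivAt T A 0) {P β γ : ℝ} (hA1 : A (1, 0) = (P, γ))
    (hA2 : A (0, 1) = (β, P)) (hβ : 0 < β) (hγ : 0 < γ) (hP : 1 < P) :
    ∃ (Δ : ℝ → ℝ) (R : ℝ × ℝ → ℝ × ℝ), AnalyticAt ℝ Δ 0 ∧ 0 < Δ 0 ∧ Δ 0 < 1 ∧ AnalyticAt ℝ R 0 ∧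
      R 0 = 0 ∧ (∀ᶠ p in 𝓝 (0 : ℝ × ℝ), (fderiv ℝ R p).det = 1) ∧
      (∀ᶠ p in 𝓝 (0 : ℝ × ℝ), R (T p) = normalForm Δ (R p)) ∧
      (∀ᶠ p in 𝓝 (0 : ℝ × ℝ), R (negSnd p) = (R p).swap) ∧ 0 < (fderiv ℝ R 0 (1, 0)).1 := by
  set κ : ℝ := √(γ / β) with hκ
  have hκ0 : 0 < κ := Real.sqrt_pos.2 (by positivity)
  have hκ2 : β * κ ^ 2 = γ := by rw [hκ, Real.sq_sqrt (by positivity)]; field_simp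
  have hPdet : P ^ 2 - β * γ = 1 := by
    have := hdet.self_of_nhds
    rw [hA.fderiv, det_eq_of_prod, hA1, hA2] at this
    simp only at this
    linarith
  -- The eigenvalue of (1, -κ); the other one is P + βκ, and their product is P² - βγ = 1.
  set l : ℝ := P - β * κ with hl
  have hl2 : l * (P + β * κ) = 1 := by rw [hl]; linear_combination hPdet - β * hκ2
  have hβκ : 0 < β * κ := by positivity
  have hl0 : 0 < l := by
    by_contra h
    push Not at h
    nlinarith
  have hl1 : l < 1 := by nlinarith
  have hAv : ∀ v : ℝ × ℝ, A v = (v.1 * P + v.2 * β, v.1 * γ + v.2 * P) := fun v => by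
    have : v = v.1 • ((1, 0) : ℝ × ℝ) + v.2 • ((0, 1) : ℝ × ℝ) := by ext <;> simp
    conv_lhs => rw [this]
    rw [map_add, map_smul, map_smul, hA1, hA2]
    ext <;> simp
  set C : ℝ × ℝ →L[ℝ] ℝ × ℝ := (ContinuousLinearMap.fst ℝ ℝ ℝ + ContinuousLinearMap.snd ℝ ℝ ℝ).prod
    (κ • (ContinuousLinearMap.snd ℝ ℝ ℝ - ContinuousLinearMap.fst ℝ ℝ ℝ)) with hC
  have hCv : ∀ v : ℝ × ℝ, C v = (v.1 + v.2, κ * (v.2 - v.1)) := fun v => rfl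
  set D : ℝ × ℝ →L[ℝ] ℝ × ℝ :=
    ((2 : ℝ)⁻¹ • (ContinuousLinearMap.fst ℝ ℝ ℝ - κ⁻¹ • ContinuousLinearMap.snd ℝ ℝ ℝ)).prod
    ((2 : ℝ)⁻¹ • (ContinuousLinearMap.fst ℝ ℝ ℝ + κ⁻¹ • ContinuousLinearMap.snd ℝ ℝ ℝ)) with hD
  have hDv : ∀ v : ℝ × ℝ, D v = (2⁻¹ * (v.1 - κ⁻¹ * v.2), 2⁻¹ * (v.1 + κ⁻¹ * v.2)) := fun v => rfl
  have hCD : ∀ v, C (D v) = v := fun v => by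
    rw [hCv, hDv]; ext
    · simp; ring
    · simp; field_simp; ring
  have hDC : ∀ v, D (C v) = v := fun v => by
    rw [hCv, hDv]; ext
    · simp; field_simp; ring
    · simp; field_simp; ring
  have hCs : ∀ v : ℝ × ℝ, C v.swap = negSnd (C v) := fun v => by
    rw [hCv, hCv, negSnd]; ext
    · simp; ring
    · simp; ring
  have hDs : ∀ v : ℝ × ℝ, (D v).swap = D (negSnd v) := fun v => by
    rw [hDv, hDv, negSnd]; ext
    · simp
    · simp; ring
  have hCt : Tendsto C (𝓝 0) (𝓝 0) := C.continuous.tendsto' 0 0 (map_zero C)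
  have hC0 : C 0 = 0 := map_zero C
  have hTCa : AnalyticAt ℝ (T ∘ C) 0 := AnalyticAt.comp (by rwa [hC0]) (C.analyticAt 0)
  have hT'a : AnalyticAt ℝ (D ∘ T ∘ C) 0 := (D.analyticAt _).comp hTCa
  have hT'd : HasFDerivAt (fun p => (D (T (C p))).1) (l • ContinuousLinearMap.fst ℝ ℝ ℝ) 0 := by
    have h1 : HasFDerivAt (T ∘ C) (A ∘L C) 0 :=
      HasFDerivAt.comp 0 (by rwa [hC0]) C.hasFDerivAt
    have h2 := (((ContinuousLinearMap.fst ℝ ℝ ℝ) ∘L D).hasFDerivAt (x := (T ∘ C) 0)).comp 0 h1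
    convert! h2 using 1
    refine ContinuousLinearMap.ext fun v => ?_
    simp only [smul_apply, ContinuousLinearMap.coe_fst', smul_eq_mul,
      ContinuousLinearMap.comp_apply, hDv, hAv, hCv, hl, ← hκ2]
    field_simp
    ring
  obtain ⟨θ, Δ, ε, hε, hθ, hθ0, hθ', hΔ, hΔ0, hconj⟩ :=
    exists_conjugacy_of_reversible hT'a (by simp [hC0, hT0]) hl0 hl1 hT'd (by
      filter_upwards [hCt.eventually hrev] with p hp
      simp only [Function.comp]
      rw [hDs, hDs, hCD, hp, hDC])
  set Ψ : ℝ × ℝ → ℝ × ℝ := fun p => C (θ p, θ p.swap) with hΨ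
  have hθs : AnalyticAt ℝ (fun p : ℝ × ℝ => θ p.swap) 0 :=
    AnalyticAt.comp (g := θ) (f := fun p : ℝ × ℝ => (p.2, p.1)) (x := 0) hθ
      (analyticAt_snd.prod analyticAt_fst)
  have hθs' : HasFDerivAt (fun p : ℝ × ℝ => θ p.swap) (ε • ContinuousLinearMap.snd ℝ ℝ ℝ) 0 := by
    have h1 : HasFDerivAt (fun p : ℝ × ℝ => θ p.swap) _ 0 :=
      HasFDerivAt.comp (g := θ) (f := Prod.swap) 0 (by simpa using hθ')
        (ContinuousLinearEquiv.prodComm ℝ ℝ ℝ).hasFDerivAt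
    convert! h1 using 1
  have hΨa : AnalyticAt ℝ Ψ 0 := (C.analyticAt _).comp (hθ.prod hθs)
  have hΨd : HasFDerivAt Ψ (C ∘L ((ε • ContinuousLinearMap.fst ℝ ℝ ℝ).prod
      (ε • ContinuousLinearMap.snd ℝ ℝ ℝ))) 0 := C.hasFDerivAt.comp 0 (hθ'.prodMk hθs')
  set E : ℝ × ℝ →L[ℝ] ℝ × ℝ := C ∘L ((ε • ContinuousLinearMap.fst ℝ ℝ ℝ).prod
      (ε • ContinuousLinearMap.snd ℝ ℝ ℝ)) with hE
  have hEv : ∀ v : ℝ × ℝ, E v = (ε * v.1 + ε * v.2, κ * (ε * v.2 - ε * v.1)) := fun v => rfl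
  have hEdet : 0 < E.det := by
    rw [det_eq_of_prod, hEv, hEv]
    have : 0 < ε * (κ * ε) := by positivity
    simp only
    linarith
  have hE1 : E (1, 1) = (ε + ε, 0) := by simp [hEv]
  have hΨ0 : Ψ 0 = 0 := by
    have : ((θ 0, θ (0 : ℝ × ℝ).swap) : ℝ × ℝ) = 0 := by simp [hθ0]
    simp only [hΨ, this, hC0]
  have hflip : ∀ p, Ψ p.swap = negSnd (Ψ p) := fun p => by
    simp only [hΨ]
    rw [← hCs]
    rfl
  have hconj' : ∀ᶠ p in 𝓝 (0 : ℝ × ℝ), T (Ψ p) = Ψ (normalForm Δ p) := by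
    filter_upwards [hconj] with p hp
    have := congrArg C hp
    simp only [Function.comp] at this
    rwa [hCD] at this
  obtain ⟨Δ', R, hΔ', hΔ'0, hR⟩ := exists_symplectic_conjugacy hT hT0 hdet hΨa hΨ0 hΨd hEdet
    (by positivity) hE1 hΔ (by rw [hΔ0]; exact hl0) (by rw [hΔ0]; exact hl1) hflip hconj'
  exact ⟨Δ', R, hΔ', by rw [hΔ'0, hΔ0]; exact hl0, by rw [hΔ'0, hΔ0]; exact hl1, hR⟩

/-! ### Uniqueness of the normal form and of the conjugacy -/

/-- Every small nonzero w is the product of the coordinates of a point near the origin, namely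
(√|w|, ±√|w|). -/
theorem eventually_of_eventually_mul {P : ℝ → Prop}
    (h : ∀ᶠ p in 𝓝 (0 : ℝ × ℝ), p.1 ≠ 0 → P (p.1 * p.2)) : ∀ᶠ w in 𝓝 (0 : ℝ), w ≠ 0 → P w := by
  have h1 : Tendsto (fun w : ℝ => (√|w|, √|w|)) (𝓝 0) (𝓝 0) :=
    Continuous.tendsto' (by fun_prop) 0 0 (by simp)
  have h2 : Tendsto (fun w : ℝ => (√|w|, -√|w|)) (𝓝 0) (𝓝 0) :=
    Continuous.tendsto' (by fun_prop) 0 0 (by simp)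
  filter_upwards [h1.eventually h, h2.eventually h] with w hw1 hw2 hw
  have hs : √|w| ≠ 0 := (Real.sqrt_pos.2 (abs_pos.2 hw)).ne'
  have hss : √|w| * √|w| = |w| := Real.mul_self_sqrt (abs_nonneg w)
  rcases le_total 0 w with h0 | h0
  · have := hw1 hs
    simp only [hss] at this
    rwa [abs_of_nonneg h0] at this
  · have := hw2 hs
    simp only [mul_neg, hss] at this
    rwa [abs_of_nonpos h0, neg_neg] at this

theorem eventually_eq_id_of_hasDerivAt {h : ℝ → ℝ} (h0 : h 0 = 0)
    (hd : ∀ᶠ w in 𝓝 (0 : ℝ), HasDerivAt h 1 w) : ∀ᶠ w in 𝓝 (0 : ℝ), h w = w := by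
  obtain ⟨r, hr, hball⟩ := Metric.eventually_nhds_iff_ball.1 hd
  filter_upwards [Metric.ball_mem_nhds 0 hr] with w hw
  exact Metric.isOpen_ball.eqOn_of_deriv_eq (g := id) (convex_ball 0 r).isPreconnected
    (fun x hx => (hball x hx).differentiableAt.differentiableWithinAt)
    differentiableOn_id (fun x hx => by rw [(hball x hx).deriv, deriv_id])
    (Metric.mem_ball_self hr) h0 hw

theorem hasFDerivAt_normalForm_zero {Δ : ℝ → ℝ} (hΔ : AnalyticAt ℝ Δ 0) (h0 : Δ 0 ≠ 0) :
    ∃ A : ℝ × ℝ →L[ℝ] ℝ × ℝ, HasFDerivAt (normalForm Δ) A 0 ∧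
      ∀ v, A v = (Δ 0 * v.1, (Δ 0)⁻¹ * v.2) := by
  have hd : HasDerivAt Δ (deriv Δ 0) ((0 : ℝ × ℝ).1 * (0 : ℝ × ℝ).2) := by
    simpa using hΔ.differentiableAt.hasDerivAt
  have hd' : HasDerivAt (fun w => (Δ w)⁻¹) _ ((0 : ℝ × ℝ).1 * (0 : ℝ × ℝ).2) :=
    hd.inv (by simpa using h0)
  obtain ⟨B, hB, -, hBv⟩ := hasFDerivAt_weightMap (p := 0) hd hd'
  exact ⟨B, hB, hBv rfl⟩

/-- The product Φ₁Φ₂ is invariant under the first normal form, so it is h(xy). Then Φ₁ and Φ₂ are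
multiplied by Δ₂(h(xy)) and by its inverse, hence are of weights 1 and -1. The Jacobian of the
resulting map is (wFG)' at w = xy; that it equals 1 gives FG = 1, so Φ preserves xy and the
multipliers agree. -/
theorem normalForm_intertwiner {Φ : ℝ × ℝ → ℝ × ℝ} {Δ₁ Δ₂ : ℝ → ℝ} (hΦ : AnalyticAt ℝ Φ 0)
    (hΦ0 : Φ 0 = 0) (hdet : ∀ᶠ p in 𝓝 (0 : ℝ × ℝ), (fderiv ℝ Φ p).det = 1)
    (hΔ₁ : AnalyticAt ℝ Δ₁ 0) (h₁ : 0 < Δ₁ 0) (h₁' : Δ₁ 0 < 1)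
    (hΔ₂ : AnalyticAt ℝ Δ₂ 0) (h₂ : 0 < Δ₂ 0) (h₂' : Δ₂ 0 < 1)
    (hconj : ∀ᶠ p in 𝓝 (0 : ℝ × ℝ), Φ (normalForm Δ₁ p) = normalForm Δ₂ (Φ p)) :
    Δ₁ =ᶠ[𝓝 0] Δ₂ ∧ ∃ F G : ℝ → ℝ, AnalyticAt ℝ F 0 ∧ AnalyticAt ℝ G 0 ∧
      (∀ᶠ w in 𝓝 (0 : ℝ), F w * G w = 1) ∧
      ∀ᶠ p in 𝓝 (0 : ℝ × ℝ), Φ p = (F (p.1 * p.2) * p.1, G (p.1 * p.2) * p.2) := by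
  have hΦt : Tendsto Φ (𝓝 0) (𝓝 0) := by simpa [hΦ0] using hΦ.continuousAt.tendsto
  have hN := tendsto_normalForm hΔ₁.continuousAt h₁.ne'
  -- the linear parts
  have hl : Δ₁ 0 = Δ₂ 0 := by
    obtain ⟨A₁, hA₁, hA₁v⟩ := hasFDerivAt_normalForm_zero hΔ₁ h₁.ne'
    obtain ⟨A₂, hA₂, hA₂v⟩ := hasFDerivAt_normalForm_zero hΔ₂ h₂.ne'
    have hB := hΦ.differentiableAt.hasFDerivAt
    set B := fderiv ℝ Φ 0 with hBdef
    have hN0 : normalForm Δ₁ 0 = 0 := by simp [normalForm]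
    have e1 : HasFDerivAt (Φ ∘ normalForm Δ₁) (B ∘L A₁) 0 :=
      HasFDerivAt.comp 0 (by rwa [hN0]) hA₁
    have e2 : HasFDerivAt (normalForm Δ₂ ∘ Φ) (A₂ ∘L B) 0 :=
      HasFDerivAt.comp 0 (by rwa [hΦ0]) hB
    have e3 := (e2.congr_of_eventuallyEq (f₁ := Φ ∘ normalForm Δ₁) hconj).unique e1
    have e4 := congrArg (fun S => S ((1, 0) : ℝ × ℝ)) e3
    simp only [ContinuousLinearMap.comp_apply, hA₁v, hA₂v] at e4
    have e5 : ((Δ₁ 0 * 1, (Δ₁ 0)⁻¹ * 0) : ℝ × ℝ) = Δ₁ 0 • (1, 0) := by simp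
    rw [e5, map_smul] at e4
    have e6 := hdet.self_of_nhds
    rw [det_eq_of_prod] at e6
    have f1 := congrArg Prod.fst e4
    have f2 := congrArg Prod.snd e4
    simp only [Prod.smul_fst, Prod.smul_snd, smul_eq_mul] at f1 f2
    -- The derivative of Φ maps the contracting eigenvector to an eigenvector; a component along the
    -- expanding direction would require Δ₁(0)Δ₂(0) = 1.
    have hc : (B (1, 0)).2 = 0 := by
      have : (B (1, 0)).2 * (Δ₁ 0 * Δ₂ 0 - 1) = 0 := by
        field_simp at f2
        linear_combination -f2
      rcases mul_eq_zero.1 this with h | h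
      · exact h
      · nlinarith
    have ha : (B (1, 0)).1 ≠ 0 := fun ha => by
      rw [hc, ha] at e6; simp at e6
    exact mul_right_cancel₀ ha f1.symm
  have ha1 : AnalyticAt ℝ (fun p => (Φ p).1) 0 := analyticAt_fst.comp hΦ
  have ha2 : AnalyticAt ℝ (fun p => (Φ p).2) 0 := analyticAt_snd.comp hΦ
  have hmt : Tendsto (fun p => (Φ p).1 * (Φ p).2) (𝓝 0) (𝓝 0) := tendsto_mul_zero.comp hΦt
  have hΔne := hmt.eventually (hΔ₂.continuousAt.eventually_ne h₂.ne')
  obtain ⟨t, ht, a, ha, hta⟩ := AbsSeries.exists_isHomog_of_equivariant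
    (f := fun p => (Φ p).1 * (Φ p).2) (ha1.mul ha2) (Δ := Δ₁) (ρ := fun _ => 1) (k := 0) hΔ₁
    analyticAt_const h₁ h₁' (by simp) (by
      filter_upwards [hconj, hΔne] with p hp hp2
      rw [hp, normalForm]
      field_simp)
  obtain ⟨h, hh, hhΦ⟩ := AbsSeries.exists_germ_of_isHomog_zero (f := fun p => (Φ p).1 * (Φ p).2) ht ha hta
  have hh0 : h 0 = 0 := by simpa [hΦ0] using hhΦ.self_of_nhds.symm
  have hρ : AnalyticAt ℝ (fun w => Δ₂ (h w)) 0 :=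
    AnalyticAt.comp (g := Δ₂) (f := h) (by rwa [hh0]) hh
  obtain ⟨t, ht, a, ha, hta⟩ := AbsSeries.exists_isHomog_of_equivariant
    (f := fun p => (Φ p).1) ha1 (Δ := Δ₁) (ρ := fun w => Δ₂ (h w)) (k := 1) hΔ₁
    hρ h₁ h₁' (by simp [hh0, hl]) (by
      filter_upwards [hconj, hhΦ] with p hp hp2
      rw [hp, normalForm, hp2])
  obtain ⟨F, hF, hFΦ⟩ := AbsSeries.exists_germ_of_isHomog_one (f := fun p => (Φ p).1) ht ha hta
  obtain ⟨t, ht, a, ha, hta⟩ := AbsSeries.exists_isHomog_of_equivariant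
    (f := fun p => (Φ p).2) ha2 (Δ := Δ₁) (ρ := fun w => (Δ₂ (h w))⁻¹) (k := -1) hΔ₁
    (hρ.inv (by rw [hh0]; exact h₂.ne')) h₁ h₁' (by simp [hh0, hl]) (by
      filter_upwards [hconj, hhΦ] with p hp hp2
      rw [hp, normalForm, hp2])
  obtain ⟨G, hG, hGΦ⟩ := AbsSeries.exists_germ_of_isHomog_neg_one (f := fun p => (Φ p).2) ht ha hta
  have hΦeq : ∀ᶠ p in 𝓝 (0 : ℝ × ℝ), Φ p = (F (p.1 * p.2) * p.1, G (p.1 * p.2) * p.2) := by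
    filter_upwards [hFΦ, hGΦ] with p h1 h2
    ext
    · rw [h1, mul_comm]
    · rw [h2, mul_comm]
  have hFGa : AnalyticAt ℝ (fun w => F w * G w) 0 := hF.mul hG
  have hd : ∀ᶠ w in 𝓝 (0 : ℝ), w ≠ 0 → HasDerivAt (fun w => w * (F w * G w)) 1 w := by
    refine eventually_of_eventually_mul ?_
    filter_upwards [hΦeq.eventually_nhds, hdet, tendsto_mul_zero.eventually hF.eventually_analyticAt,
      tendsto_mul_zero.eventually hG.eventually_analyticAt] with p h1 h2 h3 h4 _
    have hdF := h3.differentiableAt.hasDerivAt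
    have hdG := h4.differentiableAt.hasDerivAt
    obtain ⟨B, hB, hBdet, -⟩ := hasFDerivAt_weightMap hdF hdG
    rw [(hB.congr_of_eventuallyEq h1).fderiv, hBdet] at h2
    have := (hasDerivAt_id (p.1 * p.2)).mul (hdF.mul hdG)
    convert! this using 1
    simp only [Pi.mul_apply, id]
    linarith
  have hd0 : HasDerivAt (fun w => w * (F w * G w)) (F 0 * G 0) 0 := by
    have := (hasDerivAt_id (0 : ℝ)).mul hFGa.differentiableAt.hasDerivAt
    convert! this using 1
    simp
  have hFG0 : F 0 * G 0 = 1 := by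
    have h1 := hdet.self_of_nhds
    have hdF : HasDerivAt F (deriv F 0) ((0 : ℝ × ℝ).1 * (0 : ℝ × ℝ).2) := by
      simpa using hF.differentiableAt.hasDerivAt
    have hdG : HasDerivAt G (deriv G 0) ((0 : ℝ × ℝ).1 * (0 : ℝ × ℝ).2) := by
      simpa using hG.differentiableAt.hasDerivAt
    obtain ⟨B, hB, hBdet, -⟩ := hasFDerivAt_weightMap (p := 0) hdF hdG
    rw [(hB.congr_of_eventuallyEq hΦeq).fderiv, hBdet] at h1
    simpa using h1
  rw [hFG0] at hd0
  have hid := eventually_eq_id_of_hasDerivAt (h := fun w => w * (F w * G w)) (by simp) (by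
    filter_upwards [hd] with w hw
    by_cases h0 : w = 0
    · rwa [h0]
    · exact hw h0)
  have hFG : ∀ᶠ w in 𝓝 (0 : ℝ), F w * G w = 1 := by
    filter_upwards [hid] with w hw
    by_cases h0 : w = 0
    · rwa [h0]
    · exact mul_left_cancel₀ h0 (by rw [hw, mul_one])
  refine ⟨?_, F, G, hF, hG, hFG, hΦeq⟩
  have key : ∀ᶠ w in 𝓝 (0 : ℝ), w ≠ 0 → Δ₁ w = Δ₂ w := by
    refine eventually_of_eventually_mul ?_
    filter_upwards [hΦeq, hN.eventually hΦeq, hconj, tendsto_mul_zero.eventually hFG,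
      tendsto_mul_zero.eventually (hΔ₁.continuousAt.eventually_ne h₁.ne')] with p h1 h2 h3 h4 h5 hp
    have e : (normalForm Δ₁ p).1 * (normalForm Δ₁ p).2 = p.1 * p.2 := by
      simp only [normalForm]; field_simp
    rw [h3, h1, e] at h2
    have e2 : F (p.1 * p.2) * p.1 * (G (p.1 * p.2) * p.2) = p.1 * p.2 := by
      linear_combination p.1 * p.2 * h4
    have h6 := congrArg Prod.fst h2
    simp only [normalForm, e2] at h6
    have hFne : F (p.1 * p.2) ≠ 0 := left_ne_zero_of_mul_eq_one h4
    refine mul_right_cancel₀ (mul_ne_zero hFne hp) ?_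
    linarith
  filter_upwards [key] with w hw
  by_cases h0 : w = 0
  · rw [h0, hl]
  · exact hw h0

/-- The transition map R₂ ∘ R₁⁻¹ intertwines the two normal forms and has Jacobian 1. -/
theorem conjugacy_unique {T R₁ R₂ : ℝ × ℝ → ℝ × ℝ} {Δ₁ Δ₂ : ℝ → ℝ}
    (hT : ContinuousAt T 0) (hT0 : T 0 = 0)
    (hR₁ : AnalyticAt ℝ R₁ 0) (hR₁0 : R₁ 0 = 0)
    (hdet₁ : ∀ᶠ p in 𝓝 (0 : ℝ × ℝ), (fderiv ℝ R₁ p).det = 1)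
    (hR₂ : AnalyticAt ℝ R₂ 0) (hR₂0 : R₂ 0 = 0)
    (hdet₂ : ∀ᶠ p in 𝓝 (0 : ℝ × ℝ), (fderiv ℝ R₂ p).det = 1)
    (hΔ₁ : AnalyticAt ℝ Δ₁ 0) (h₁ : 0 < Δ₁ 0) (h₁' : Δ₁ 0 < 1)
    (hΔ₂ : AnalyticAt ℝ Δ₂ 0) (h₂ : 0 < Δ₂ 0) (h₂' : Δ₂ 0 < 1)
    (hconj₁ : ∀ᶠ p in 𝓝 (0 : ℝ × ℝ), R₁ (T p) = normalForm Δ₁ (R₁ p))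
    (hconj₂ : ∀ᶠ p in 𝓝 (0 : ℝ × ℝ), R₂ (T p) = normalForm Δ₂ (R₂ p)) :
    Δ₁ =ᶠ[𝓝 0] Δ₂ ∧ ∃ F G : ℝ → ℝ, AnalyticAt ℝ F 0 ∧ AnalyticAt ℝ G 0 ∧
      (∀ᶠ w in 𝓝 (0 : ℝ), F w * G w = 1) ∧
      ∀ᶠ p in 𝓝 (0 : ℝ × ℝ), R₂ p = (F ((R₁ p).1 * (R₁ p).2) * (R₁ p).1,
        G ((R₁ p).1 * (R₁ p).2) * (R₁ p).2) := by
  obtain ⟨S, hS, hS0, hSR, hRS⟩ := exists_analytic_localInverse hR₁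
    (by rw [hdet₁.self_of_nhds]; exact one_ne_zero)
  rw [hR₁0] at hS hS0 hRS
  have hSt : Tendsto S (𝓝 0) (𝓝 0) := by simpa [hS0] using hS.continuousAt.tendsto
  have hR₁t : Tendsto R₁ (𝓝 0) (𝓝 0) := by simpa [hR₁0] using hR₁.continuousAt.tendsto
  have hTt : Tendsto T (𝓝 0) (𝓝 0) := by simpa [hT0] using hT.tendsto
  obtain ⟨hΔ, F, G, hF, hG, hFG, hΦ⟩ := normalForm_intertwiner (Φ := R₂ ∘ S)
    (AnalyticAt.comp (by rwa [hS0]) hS) (by simp [hS0, hR₂0]) (by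
      filter_upwards [hSt.eventually hdet₁, hSt.eventually hdet₂, hS.eventually_analyticAt,
        hSt.eventually hR₁.eventually_analyticAt, hSt.eventually hR₂.eventually_analyticAt,
        hRS.eventually_nhds] with p h1 h2 h3 h4 h5 h6
      have e1 := h5.differentiableAt.hasFDerivAt.comp p h3.differentiableAt.hasFDerivAt
      have e2 := h4.differentiableAt.hasFDerivAt.comp p h3.differentiableAt.hasFDerivAt
      have e3 := (e2.congr_of_eventuallyEq (f₁ := id)
        (by filter_upwards [h6] with q hq; exact hq.symm)).unique (hasFDerivAt_id p)
      have e4 := congrArg ContinuousLinearMap.det e3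
      rw [det_comp_prod, h1, one_mul] at e4
      rw [e1.fderiv, det_comp_prod, h2, e4]
      simp [ContinuousLinearMap.det]) hΔ₁ h₁ h₁' hΔ₂ h₂ h₂' (by
      filter_upwards [hRS, hSt.eventually hconj₁, hSt.eventually hconj₂,
        (hTt.comp hSt).eventually hSR] with p h1 h2 h3 h4
      simp only [Function.comp] at h4 ⊢
      rw [h1] at h2
      rw [← h2, h4, h3])
  refine ⟨hΔ, F, G, hF, hG, hFG, ?_⟩
  filter_upwards [hSR, hR₁t.eventually hΦ] with p h1 h2
  simpa only [Function.comp, h1] using h2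

/-- A conjugacy that maps a half-axis into the diagonal is unique. -/
theorem conjugacy_unique_of_diagonal {R₁ R₂ : ℝ × ℝ → ℝ × ℝ} {F G : ℝ → ℝ}
    (hR₁ : AnalyticAt ℝ R₁ 0) (hR₁0 : R₁ 0 = 0) (hdet : (fderiv ℝ R₁ 0).det = 1)
    (hF : AnalyticAt ℝ F 0)
    (hFG : ∀ᶠ w in 𝓝 (0 : ℝ), F w * G w = 1)
    (h : ∀ᶠ p in 𝓝 (0 : ℝ × ℝ), R₂ p = (F ((R₁ p).1 * (R₁ p).2) * (R₁ p).1,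
        G ((R₁ p).1 * (R₁ p).2) * (R₁ p).2))
    (h₁ : ∀ᶠ s in 𝓝 (0 : ℝ), 0 ≤ s → 0 ≤ (R₁ (s, 0)).1 ∧ (R₁ (s, 0)).1 = (R₁ (s, 0)).2)
    (h₂ : ∀ᶠ s in 𝓝 (0 : ℝ), 0 ≤ s → 0 ≤ (R₂ (s, 0)).1 ∧ (R₂ (s, 0)).1 = (R₂ (s, 0)).2) :
    R₁ =ᶠ[𝓝 0] R₂ := by
  have hin : Tendsto (fun s : ℝ => (s, (0 : ℝ))) (𝓝 0) (𝓝 0) :=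
    Continuous.tendsto' (by fun_prop) 0 0 rfl
  have hR₁t : Tendsto R₁ (𝓝 0) (𝓝 0) := by simpa [hR₁0] using hR₁.continuousAt.tendsto
  have hmt : Tendsto (fun p => (R₁ p).1 * (R₁ p).2) (𝓝 0) (𝓝 0) := tendsto_mul_zero.comp hR₁t
  have hinj : ∀ᶠ p in 𝓝 (0 : ℝ × ℝ), R₁ p = 0 → p = 0 := by
    obtain ⟨S, -, -, hSR, -⟩ := exists_analytic_localInverse hR₁
      (by rw [hdet]; exact one_ne_zero)
    filter_upwards [hSR] with p hp h0
    have := hSR.self_of_nhds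
    rw [hR₁0] at this
    rw [← hp, h0, this]
  -- `F = 1` along the image of the half-axis
  have h3 : ∀ᶠ s in 𝓝[>] (0 : ℝ), F ((R₁ (s, 0)).1 * (R₁ (s, 0)).2) = 1 ∧
      (R₁ (s, 0)).1 * (R₁ (s, 0)).2 ≠ 0 := by
    filter_upwards [nhdsWithin_le_nhds (hin.eventually h), nhdsWithin_le_nhds h₁,
      nhdsWithin_le_nhds h₂, nhdsWithin_le_nhds (hin.eventually hinj),
      nhdsWithin_le_nhds ((hmt.comp hin).eventually hFG), self_mem_nhdsWithin]
      with s e1 e2 e3 e4 e5 hs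
    obtain ⟨e2, e2'⟩ := e2 hs.le
    obtain ⟨e3, e3'⟩ := e3 hs.le
    simp only [Function.comp, ← e2'] at e5 ⊢
    rw [e1, ← e2'] at e3 e3'
    simp only at e3 e3'
    have hx : (R₁ (s, 0)).1 ≠ 0 := fun h0 => by
      have := e4 (Prod.ext h0 (by rw [← e2', h0]; rfl))
      exact (ne_of_gt hs) (congrArg Prod.fst this)
    have hpos : 0 < (R₁ (s, 0)).1 := lt_of_le_of_ne e2 hx.symm
    set x := (R₁ (s, 0)).1
    -- At the image (x, x) of a point of the half-axis, both components of R₂ agree, so F = G there;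
    -- with FG = 1 and F ≥ 0 this leaves F = 1.
    have h6 := mul_right_cancel₀ hx e3'
    rw [← h6] at e5
    have h7 : 0 ≤ F (x * x) := by
      by_contra hneg
      push Not at hneg
      nlinarith
    refine ⟨by nlinarith, by positivity⟩
  have hF1 : ∀ᶠ w in 𝓝 (0 : ℝ), F w = 1 := by
    -- Identity theorem: the values x² at which F = 1 is known are nonzero and accumulate at 0.
    refine (hF.frequently_eq_iff_eventually_eq analyticAt_const).1 ?_
    have ht : Tendsto (fun s : ℝ => (R₁ (s, 0)).1 * (R₁ (s, 0)).2) (𝓝[>] 0) (𝓝[≠] 0) :=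
      tendsto_nhdsWithin_iff.2 ⟨((hmt.comp hin).mono_left nhdsWithin_le_nhds),
        h3.mono fun s hs => hs.2⟩
    exact ht.frequently (h3.mono fun s hs => hs.1).frequently
  filter_upwards [h, hmt.eventually hF1, hmt.eventually hFG] with p e1 e2 e3
  rw [e2, one_mul] at e3
  rw [e1, e2, e3, one_mul, one_mul]

/-! ### The map generated by the length of chords -/

theorem fderiv_leftInverse_comp {F G : ℝ × ℝ → ℝ × ℝ} {p : ℝ × ℝ} (hF : DifferentiableAt ℝ F p)
    (hG : DifferentiableAt ℝ G (F p)) (h : ∀ᶠ x in 𝓝 p, G (F x) = x) :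
    (fderiv ℝ G (F p)) ∘L (fderiv ℝ F p) = ContinuousLinearMap.id ℝ (ℝ × ℝ) :=
  ((hG.hasFDerivAt.comp p hF.hasFDerivAt).congr_of_eventuallyEq (f₁ := id)
    (by filter_upwards [h] with q hq; exact hq.symm)).unique (hasFDerivAt_id p)

/-- The linear version of `negSnd`. -/
def negSndL : ℝ × ℝ →L[ℝ] ℝ × ℝ :=
  (ContinuousLinearMap.fst ℝ ℝ ℝ).prod (-ContinuousLinearMap.snd ℝ ℝ ℝ)

theorem negSndL_apply (p : ℝ × ℝ) : negSndL p = negSnd p := rfl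

theorem negSnd_negSnd (p : ℝ × ℝ) : negSnd (negSnd p) = p := by simp [negSnd]

theorem negSnd_zero : negSnd 0 = 0 := by simp [negSnd]

theorem det_negSndL : negSndL.det = -1 := by
  simp [det_eq_of_prod, negSndL_apply, negSnd]

/-- Functions `r₁ = -∂₁L` and `r₂ = ∂₂L`, for a generating function `L`, determine a reversible
symplectic map, which is hyperbolic under the given conditions on the second derivatives. -/
theorem exists_reversible_map {r₁ r₂ : ℝ × ℝ → ℝ} (h₁ : AnalyticAt ℝ r₁ 0)
    (h₂ : AnalyticAt ℝ r₂ 0) (h₁0 : r₁ 0 = 0) (h₂0 : r₂ 0 = 0)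
    (hmix : ∀ᶠ q in 𝓝 (0 : ℝ × ℝ), fderiv ℝ r₁ q (0, 1) = -fderiv ℝ r₂ q (1, 0)) {a c d : ℝ}
    (hc : 0 < c) (hac : c < a) (hdc : c < d) (h₁a : fderiv ℝ r₁ 0 (1, 0) = -a)
    (h₂c : fderiv ℝ r₂ 0 (1, 0) = c) (h₂d : fderiv ℝ r₂ 0 (0, 1) = d) :
    ∃ T : ℝ × ℝ → ℝ × ℝ, AnalyticAt ℝ T 0 ∧ T 0 = 0 ∧
      (∀ᶠ p in 𝓝 (0 : ℝ × ℝ), (fderiv ℝ T p).det = 1) ∧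
      (∀ᶠ p in 𝓝 (0 : ℝ × ℝ), negSnd (T (negSnd (T p))) = p) ∧
      (∃ (A : ℝ × ℝ →L[ℝ] ℝ × ℝ) (P β γ : ℝ), HasFDerivAt T A 0 ∧ A (1, 0) = (P, γ) ∧
        A (0, 1) = (β, P) ∧ 0 < β ∧ 0 < γ ∧ 1 < P) ∧
      ∀ Q : ℝ × ℝ → Prop, (∀ᶠ q in 𝓝 0, Q q) → ∀ᶠ p in 𝓝 (0 : ℝ × ℝ), ∃ q q', Q q ∧ Q q' ∧
        p = (q.1, r₁ q) ∧ (q'.2, r₂ q') = negSnd (q.2, r₂ q) ∧ T p = negSnd (q'.1, r₁ q') := by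
  have hc' := hc.ne'
  set Ψ : ℝ × ℝ → ℝ × ℝ := fun q => (q.1, r₁ q) with hΨ
  set Ω : ℝ × ℝ → ℝ × ℝ := fun q => (q.2, r₂ q) with hΩ
  have hΨa : AnalyticAt ℝ Ψ 0 := analyticAt_fst.prod h₁
  have hΩa : AnalyticAt ℝ Ω 0 := analyticAt_snd.prod h₂
  have hΨ0 : Ψ 0 = 0 := by simp [hΨ, h₁0]
  have hΩ0 : Ω 0 = 0 := by simp [hΩ, h₂0]
  have hΨd : ∀ᶠ q in 𝓝 (0 : ℝ × ℝ), ∀ v, fderiv ℝ Ψ q v = (v.1, fderiv ℝ r₁ q v) := by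
    filter_upwards [h₁.eventually_analyticAt] with q hq v
    rw [((hasFDerivAt_fst (𝕜 := ℝ)).prodMk hq.differentiableAt.hasFDerivAt).fderiv]
    rfl
  have hΩd : ∀ᶠ q in 𝓝 (0 : ℝ × ℝ), ∀ v, fderiv ℝ Ω q v = (v.2, fderiv ℝ r₂ q v) := by
    filter_upwards [h₂.eventually_analyticAt] with q hq v
    rw [((hasFDerivAt_snd (𝕜 := ℝ)).prodMk hq.differentiableAt.hasFDerivAt).fderiv]
    rfl
  have hdet : ∀ᶠ q in 𝓝 (0 : ℝ × ℝ), (fderiv ℝ Ψ q).det = (fderiv ℝ Ω q).det := by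
    filter_upwards [hΨd, hΩd, hmix] with q e1 e2 e3
    rw [det_eq_of_prod, det_eq_of_prod, e1, e1, e2, e2, e3]
    simp
  have h₁c : fderiv ℝ r₁ 0 (0, 1) = -c := by rw [hmix.self_of_nhds, h₂c]
  have hsplit : ∀ (B : ℝ × ℝ →L[ℝ] ℝ) (v : ℝ × ℝ), B v = v.1 * B (1, 0) + v.2 * B (0, 1) :=
    fun B v => by
    have : v = v.1 • ((1, 0) : ℝ × ℝ) + v.2 • ((0, 1) : ℝ × ℝ) := by ext <;> simp
    conv_lhs => rw [this]
    rw [map_add, map_smul, map_smul]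
    rfl
  have hΨv : ∀ v : ℝ × ℝ, fderiv ℝ Ψ 0 v = (v.1, -a * v.1 - c * v.2) := fun v => by
    rw [hΨd.self_of_nhds, hsplit, h₁a, h₁c]
    ext
    · rfl
    · simp only; ring
  have hΩv : ∀ v : ℝ × ℝ, fderiv ℝ Ω 0 v = (v.2, c * v.1 + d * v.2) := fun v => by
    rw [hΩd.self_of_nhds, hsplit, h₂c, h₂d]
    ext
    · rfl
    · simp only; ring
  have hΨdet : (fderiv ℝ Ψ 0).det ≠ 0 := by
    rw [det_eq_of_prod, hΨv, hΨv]; simp [hc']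
  have hΩdet : (fderiv ℝ Ω 0).det ≠ 0 := by
    rw [← hdet.self_of_nhds]; exact hΨdet
  obtain ⟨X, hX, hX0, hXΨ, hΨX⟩ := exists_analytic_localInverse hΨa hΨdet
  obtain ⟨Y, hY, hY0, hYΩ, hΩY⟩ := exists_analytic_localInverse hΩa hΩdet
  have hXv : ∀ v, fderiv ℝ X 0 (fderiv ℝ Ψ 0 v) = v := fun v => by
    have := fderiv_leftInverse_comp hΨa.differentiableAt hX.differentiableAt hXΨ
    rw [hΨ0] at this
    exact congrArg (fun S => S v) this
  have hYv : ∀ v, fderiv ℝ Y 0 (fderiv ℝ Ω 0 v) = v := fun v => by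
    have := fderiv_leftInverse_comp hΩa.differentiableAt hY.differentiableAt hYΩ
    rw [hΩ0] at this
    exact congrArg (fun S => S v) this
  rw [hΨ0] at hX hX0 hΨX
  rw [hΩ0] at hY hY0 hΩY
  have hΨt : Tendsto Ψ (𝓝 0) (𝓝 0) := by simpa [hΨ0] using hΨa.continuousAt.tendsto
  have hΩt : Tendsto Ω (𝓝 0) (𝓝 0) := by simpa [hΩ0] using hΩa.continuousAt.tendsto
  have hXt : Tendsto X (𝓝 0) (𝓝 0) := by simpa [hX0] using hX.continuousAt.tendsto
  have hYt : Tendsto Y (𝓝 0) (𝓝 0) := by simpa [hY0] using hY.continuousAt.tendsto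
  have hIt := tendsto_negSnd_zero
  have hIa : ∀ p, AnalyticAt ℝ negSnd p := fun p => negSndL.analyticAt p
  have hId : ∀ p, HasFDerivAt negSnd negSndL p := fun p => negSndL.hasFDerivAt
  -- the point at which the second collision is computed
  set Z : ℝ × ℝ → ℝ × ℝ := fun p => Y (negSnd (Ω (X p))) with hZ
  have hZt : Tendsto Z (𝓝 0) (𝓝 0) := hYt.comp (hIt.comp (hΩt.comp hXt))
  have hΩX : AnalyticAt ℝ (Ω ∘ X) 0 := AnalyticAt.comp (by rwa [hX0]) hX
  have hIΩX : AnalyticAt ℝ (negSnd ∘ Ω ∘ X) 0 := (hIa _).comp hΩX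
  have hZa : AnalyticAt ℝ Z 0 :=
    AnalyticAt.comp (g := Y) (f := negSnd ∘ Ω ∘ X) (by simpa [hX0, hΩ0, negSnd_zero] using hY) hIΩX
  have hZ0 : Z 0 = 0 := by simp [hZ, hX0, hΩ0, negSnd_zero, hY0]
  have hΩZ : ∀ᶠ p in 𝓝 (0 : ℝ × ℝ), Ω (Z p) = negSnd (Ω (X p)) :=
    (hIt.comp (hΩt.comp hXt)).eventually hΩY
  have hIdet : ∀ (S : ℝ × ℝ → ℝ × ℝ) p, DifferentiableAt ℝ S p →
      (fderiv ℝ (fun q => negSnd (S q)) p).det = -(fderiv ℝ S p).det := fun S p hS => by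
    have := (hId (S p)).comp p hS.hasFDerivAt
    have h : HasFDerivAt (fun q => negSnd (S q)) _ p := this
    rw [h.fderiv, det_comp_prod, det_negSndL]
    ring
  have hΨZ : AnalyticAt ℝ (Ψ ∘ Z) 0 := AnalyticAt.comp (by rwa [hZ0]) hZa
  refine ⟨fun p => negSnd (Ψ (Z p)), (hIa _).comp hΨZ, by simp [hZ0, hΨ0, negSnd_zero],
    ?_, ?_, ?_, ?_⟩
  · filter_upwards [hX.eventually_analyticAt, hXt.eventually hΨa.eventually_analyticAt,
      hXt.eventually hΩa.eventually_analyticAt, hXt.eventually hdet,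
      hZa.eventually_analyticAt, hZt.eventually hΨa.eventually_analyticAt,
      hZt.eventually hΩa.eventually_analyticAt, hZt.eventually hdet,
      hΩZ.eventually_nhds, hΨX.eventually_nhds]
      with p a1 a2 a3 a4 a5 a6 a7 a8 a9 a10
    have e1 := a2.differentiableAt.hasFDerivAt.comp p a1.differentiableAt.hasFDerivAt
    have e1' := congrArg ContinuousLinearMap.det ((e1.congr_of_eventuallyEq (f₁ := id)
      (by filter_upwards [a10] with q hq; exact hq.symm)).unique (hasFDerivAt_id p))
    have e2 := a3.differentiableAt.hasFDerivAt.comp p a1.differentiableAt.hasFDerivAt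
    have e3 := a7.differentiableAt.hasFDerivAt.comp p a5.differentiableAt.hasFDerivAt
    have e4 := a6.differentiableAt.hasFDerivAt.comp p a5.differentiableAt.hasFDerivAt
    have e5 := (e3.congr_of_eventuallyEq (f₁ := fun q => negSnd ((Ω ∘ X) q))
      (by filter_upwards [a9] with q hq; exact hq.symm)).fderiv
    have e6 := hIdet _ _ e2.differentiableAt
    have e7 := hIdet _ _ e4.differentiableAt
    rw [e5, e2.fderiv, det_comp_prod, det_comp_prod] at e6
    rw [det_comp_prod] at e1'
    have e8 : (ContinuousLinearMap.id ℝ (ℝ × ℝ)).det = 1 := by simp [ContinuousLinearMap.det]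
    rw [e8] at e1'
    have e7' : (fderiv ℝ (fun p => negSnd (Ψ (Z p))) p).det = -(fderiv ℝ (Ψ ∘ Z) p).det := e7
    rw [e7', e4.fderiv, det_comp_prod, a8]
    rw [← a4, e1'] at e6
    linarith
  · filter_upwards [hΩZ, hZt.eventually hXΨ, hΨX, hXt.eventually hYΩ] with p e1 e2 e3 e4
    -- This is (I T)² = id, which holds because I T = S⁻¹ I S is conjugate to an involution.
    have : Z (Ψ (Z p)) = X p := by
      simp only [hZ] at e1 e2 ⊢
      rw [e2, e1, negSnd_negSnd, e4]
    rw [negSnd_negSnd, negSnd_negSnd, this, e3]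
  · have d1 := hX.differentiableAt.hasFDerivAt
    have d2 : HasFDerivAt (Ω ∘ X) ((fderiv ℝ Ω 0) ∘L (fderiv ℝ X 0)) 0 :=
      HasFDerivAt.comp 0 (by rw [hX0]; exact hΩa.differentiableAt.hasFDerivAt) d1
    have d3 : HasFDerivAt (negSnd ∘ Ω ∘ X) (negSndL ∘L (fderiv ℝ Ω 0) ∘L (fderiv ℝ X 0)) 0 :=
      HasFDerivAt.comp 0 (hId _) d2
    have d4 : HasFDerivAt (Y ∘ negSnd ∘ Ω ∘ X)
        ((fderiv ℝ Y 0) ∘L negSndL ∘L (fderiv ℝ Ω 0) ∘L (fderiv ℝ X 0)) 0 :=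
      HasFDerivAt.comp 0 (by
        simp only [Function.comp, hX0, hΩ0, negSnd_zero]
        exact hY.differentiableAt.hasFDerivAt) d3
    have d5 : HasFDerivAt (Ψ ∘ Z)
        ((fderiv ℝ Ψ 0) ∘L (fderiv ℝ Y 0) ∘L negSndL ∘L (fderiv ℝ Ω 0) ∘L (fderiv ℝ X 0)) 0 :=
      HasFDerivAt.comp 0 (by rw [hZ0]; exact hΨa.differentiableAt.hasFDerivAt) d4
    have d6 : HasFDerivAt (fun p => negSnd (Ψ (Z p))) (negSndL ∘L (fderiv ℝ Ψ 0) ∘L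
        (fderiv ℝ Y 0) ∘L negSndL ∘L (fderiv ℝ Ω 0) ∘L (fderiv ℝ X 0)) 0 :=
      HasFDerivAt.comp (g := negSnd) (f := Ψ ∘ Z) 0 (hId _) d5
    -- The derivatives of X and Y invert the matrices of Ψ and Ω, with rows (1, 0), (-a, -c) and (0,
    -- 1), (c, d).
    have x1 : fderiv ℝ X 0 (1, 0) = (1, -a / c) := by
      rw [← hXv (1, -a / c), hΨv]; congr 1; ext <;> simp; field_simp; ring
    have x2 : fderiv ℝ X 0 (0, 1) = (0, -1 / c) := by
      rw [← hXv (0, -1 / c), hΨv]; congr 1; ext <;> simp; field_simp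
    have y : ∀ v : ℝ × ℝ, fderiv ℝ Y 0 v = ((v.2 - d * v.1) / c, v.1) := fun v => by
      rw [← hYv ((v.2 - d * v.1) / c, v.1), hΩv]; congr 1; ext <;> simp; field_simp; ring
    have hP : 1 < a * d / c ^ 2 := by
      rw [lt_div_iff₀ (by positivity)]
      nlinarith
    refine ⟨_, 2 * (a * d / c ^ 2) - 1, 2 * d / c ^ 2, 2 * a * (a * d / c ^ 2 - 1), d6, ?_, ?_, ?_,
      ?_, by linarith⟩
    · simp only [ContinuousLinearMap.comp_apply, x1, hΩv, negSndL_apply, negSnd, y, hΨv]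
      ext <;> simp only <;> field_simp <;> ring
    · simp only [ContinuousLinearMap.comp_apply, x2, hΩv, negSndL_apply, negSnd, y, hΨv]
      ext <;> simp only <;> field_simp <;> ring
    · have : 0 < d := by linarith
      positivity
    · have : 0 < a := by linarith
      have : 0 < a * d / c ^ 2 - 1 := by linarith
      positivity
  · intro Q hQ
    filter_upwards [hXt.eventually hQ, hZt.eventually hQ, hΨX, hΩZ] with p e1 e2 e3 e4
    exact ⟨X p, Z p, e1, e2, e3.symm, e4, rfl⟩

theorem hasDerivAt_inner_div_norm {V : Type*} [NormedAddCommGroup V] [InnerProductSpace ℝ V]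
    {g w : ℝ → V} {g' w' : V} {t : ℝ} (hg : HasDerivAt g g' t) (hw : HasDerivAt w w' t)
    (h0 : g t ≠ 0) :
    HasDerivAt (fun t => inner ℝ (g t) (w t) / ‖g t‖)
      ((inner ℝ (g t) w' + inner ℝ g' (w t)) / ‖g t‖ -
        inner ℝ (g t) (w t) * inner ℝ (g t) g' / ‖g t‖ ^ 3) t := by
  have hn : 0 < ‖g t‖ := norm_pos_iff.2 h0
  have h1 := hg.inner ℝ hw
  have h2 : HasDerivAt (fun t => √(inner ℝ (g t) (g t))) _ t :=
    (hg.inner ℝ hg).sqrt (by simpa using h0)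
  simp only [← norm_eq_sqrt_real_inner] at h2
  convert! h1.div h2 hn.ne' using 1
  rw [real_inner_comm g' (g t)]
  field_simp
  ring

section Generating

variable {V : Type*} [NormedAddCommGroup V] [InnerProductSpace ℝ V] {A B : ℝ → V} {q : ℝ × ℝ}

theorem fderiv_apply_one_zero {f : ℝ × ℝ → ℝ} {f' : ℝ} (hf : DifferentiableAt ℝ f q)
    (h : HasDerivAt (fun t => f (t, q.2)) f' q.1) : fderiv ℝ f q (1, 0) = f' := by
  have h1 : HasDerivAt (fun t : ℝ => (t, q.2)) ((1 : ℝ), (0 : ℝ)) q.1 :=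
    (hasDerivAt_id q.1).prodMk (hasDerivAt_const _ _)
  exact (HasFDerivAt.comp_hasDerivAt q.1 (l := f) hf.hasFDerivAt h1).unique h

theorem fderiv_apply_zero_one {f : ℝ × ℝ → ℝ} {f' : ℝ} (hf : DifferentiableAt ℝ f q)
    (h : HasDerivAt (fun t => f (q.1, t)) f' q.2) : fderiv ℝ f q (0, 1) = f' := by
  have h1 : HasDerivAt (fun t : ℝ => (q.1, t)) ((0 : ℝ), (1 : ℝ)) q.2 :=
    (hasDerivAt_const _ _).prodMk (hasDerivAt_id q.2)
  exact (HasFDerivAt.comp_hasDerivAt q.2 (l := f) hf.hasFDerivAt h1).unique h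

/-- The tangential component along `A` of the unit vector from `A q.1` to `B q.2`. -/
noncomputable def tangentialFst (A B : ℝ → V) (q : ℝ × ℝ) : ℝ :=
  inner ℝ (B q.2 - A q.1) (deriv A q.1) / ‖B q.2 - A q.1‖

/-- The tangential component along `B` of the unit vector from `A q.1` to `B q.2`. -/
noncomputable def tangentialSnd (A B : ℝ → V) (q : ℝ × ℝ) : ℝ :=
  inner ℝ (B q.2 - A q.1) (deriv B q.2) / ‖B q.2 - A q.1‖

theorem AnalyticAt.norm_of_ne_zero {E : Type*} [NormedAddCommGroup E] [NormedSpace ℝ E] {f : E → V}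
    {x : E} (hf : AnalyticAt ℝ f x) (h0 : f x ≠ 0) : AnalyticAt ℝ (fun y => ‖f y‖) x := by
  have h1 : AnalyticAt ℝ (fun y => (inner ℝ (f y) (f y) : ℝ)) x :=
    AnalyticAt.comp (g := fun p : V × V => innerSL ℝ p.1 p.2) (f := fun y => (f y, f y))
      ((innerSL ℝ).analyticAt_bilinear _) (hf.prod hf)
  have h2 : AnalyticAt ℝ (fun y => Real.exp (Real.log (inner ℝ (f y) (f y)) / 2)) x :=
    AnalyticAt.comp (g := fun w => Real.exp (Real.log w / 2))
      ((analyticAt_id.log (real_inner_self_pos.2 h0)).div_const).rexp h1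
  refine h2.congr ?_
  filter_upwards [hf.continuousAt.eventually_ne h0] with y hy
  have : 0 < ‖f y‖ := norm_pos_iff.2 hy
  rw [real_inner_self_eq_norm_sq, Real.log_pow]
  push_cast
  rw [mul_div_cancel_left₀ _ two_ne_zero, Real.exp_log this]

variable [CompleteSpace V]

theorem analyticAt_tangentialFst (hA : AnalyticOnNhd ℝ A univ) (hB : AnalyticOnNhd ℝ B univ)
    (h0 : B q.2 - A q.1 ≠ 0) : AnalyticAt ℝ (tangentialFst A B) q := by
  have hE : AnalyticAt ℝ (fun q : ℝ × ℝ => B q.2 - A q.1) q :=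
    (AnalyticAt.comp (g := B) (hB _ trivial) analyticAt_snd).sub
      (AnalyticAt.comp (g := A) (hA _ trivial) analyticAt_fst)
  have hu : AnalyticAt ℝ (fun q : ℝ × ℝ => deriv A q.1) q :=
    AnalyticAt.comp (g := deriv A) (hA _ trivial).deriv analyticAt_fst
  exact (AnalyticAt.comp (g := fun p : V × V => innerSL ℝ p.1 p.2)
    ((innerSL ℝ).analyticAt_bilinear _) (hE.prod hu)).div (hE.norm_of_ne_zero h0)
    (norm_ne_zero_iff.2 h0)

theorem analyticAt_tangentialSnd (hA : AnalyticOnNhd ℝ A univ) (hB : AnalyticOnNhd ℝ B univ)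
    (h0 : B q.2 - A q.1 ≠ 0) : AnalyticAt ℝ (tangentialSnd A B) q := by
  have hE : AnalyticAt ℝ (fun q : ℝ × ℝ => B q.2 - A q.1) q :=
    (AnalyticAt.comp (g := B) (hB _ trivial) analyticAt_snd).sub
      (AnalyticAt.comp (g := A) (hA _ trivial) analyticAt_fst)
  have hu : AnalyticAt ℝ (fun q : ℝ × ℝ => deriv B q.2) q :=
    AnalyticAt.comp (g := deriv B) (hB _ trivial).deriv analyticAt_snd
  exact (AnalyticAt.comp (g := fun p : V × V => innerSL ℝ p.1 p.2)
    ((innerSL ℝ).analyticAt_bilinear _) (hE.prod hu)).div (hE.norm_of_ne_zero h0)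
    (norm_ne_zero_iff.2 h0)

theorem fderiv_tangentialFst (hA : AnalyticOnNhd ℝ A univ) (hB : AnalyticOnNhd ℝ B univ)
    (h0 : B q.2 - A q.1 ≠ 0) :
    fderiv ℝ (tangentialFst A B) q (1, 0) =
        (inner ℝ (B q.2 - A q.1) (deriv (deriv A) q.1) - inner ℝ (deriv A q.1) (deriv A q.1)) /
          ‖B q.2 - A q.1‖ + inner ℝ (B q.2 - A q.1) (deriv A q.1) *
          inner ℝ (B q.2 - A q.1) (deriv A q.1) / ‖B q.2 - A q.1‖ ^ 3 ∧
      fderiv ℝ (tangentialFst A B) q (0, 1) =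
        inner ℝ (deriv B q.2) (deriv A q.1) / ‖B q.2 - A q.1‖ -
          inner ℝ (B q.2 - A q.1) (deriv A q.1) *
          inner ℝ (B q.2 - A q.1) (deriv B q.2) / ‖B q.2 - A q.1‖ ^ 3 := by
  have hA' := (hA q.1 trivial).differentiableAt.hasDerivAt
  have hB' := (hB q.2 trivial).differentiableAt.hasDerivAt
  have hA'' := (hA q.1 trivial).deriv.differentiableAt.hasDerivAt
  have hd := (analyticAt_tangentialFst hA hB h0).differentiableAt
  refine ⟨fderiv_apply_one_zero hd ?_, fderiv_apply_zero_one hd ?_⟩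
  · convert! hasDerivAt_inner_div_norm (hA'.const_sub (B q.2)) hA'' h0 using 1
    simp only [inner_neg_left, inner_neg_right]
    ring
  · convert! hasDerivAt_inner_div_norm (hB'.sub_const (A q.1)) (hasDerivAt_const q.2 (deriv A q.1))
      h0 using 1
    simp

theorem fderiv_tangentialSnd (hA : AnalyticOnNhd ℝ A univ) (hB : AnalyticOnNhd ℝ B univ)
    (h0 : B q.2 - A q.1 ≠ 0) :
    fderiv ℝ (tangentialSnd A B) q (1, 0) =
        -inner ℝ (deriv A q.1) (deriv B q.2) / ‖B q.2 - A q.1‖ +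
          inner ℝ (B q.2 - A q.1) (deriv B q.2) *
          inner ℝ (B q.2 - A q.1) (deriv A q.1) / ‖B q.2 - A q.1‖ ^ 3 ∧
      fderiv ℝ (tangentialSnd A B) q (0, 1) =
        (inner ℝ (B q.2 - A q.1) (deriv (deriv B) q.2) + inner ℝ (deriv B q.2) (deriv B q.2)) /
          ‖B q.2 - A q.1‖ - inner ℝ (B q.2 - A q.1) (deriv B q.2) *
          inner ℝ (B q.2 - A q.1) (deriv B q.2) / ‖B q.2 - A q.1‖ ^ 3 := by
  have hA' := (hA q.1 trivial).differentiableAt.hasDerivAt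
  have hB' := (hB q.2 trivial).differentiableAt.hasDerivAt
  have hB'' := (hB q.2 trivial).deriv.differentiableAt.hasDerivAt
  have hd := (analyticAt_tangentialSnd hA hB h0).differentiableAt
  refine ⟨fderiv_apply_one_zero hd ?_, fderiv_apply_zero_one hd ?_⟩
  · convert! hasDerivAt_inner_div_norm (hA'.const_sub (B q.2)) (hasDerivAt_const q.1 (deriv B q.2))
      h0 using 1
    simp only [inner_neg_left, inner_neg_right, inner_zero_right]
    ring
  · exact hasDerivAt_inner_div_norm (hB'.sub_const (A q.1)) hB'' h0

/-- Two curves of unit speed, facing each other with positive curvature, determine a reversible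
hyperbolic symplectic map: the square of the billiard map between them. -/
theorem exists_reversible_map_of_curves (hA : AnalyticOnNhd ℝ A univ) (hB : AnalyticOnNhd ℝ B univ)
    (h0 : B 0 - A 0 ≠ 0) (hAE : inner ℝ (B 0 - A 0) (deriv A 0) = 0)
    (hBE : inner ℝ (B 0 - A 0) (deriv B 0) = 0) (hA1 : ‖deriv A 0‖ = 1)
    (hBA : deriv B 0 = -deriv A 0) (hAK : inner ℝ (B 0 - A 0) (deriv (deriv A) 0) < 0)
    (hBK : 0 < inner ℝ (B 0 - A 0) (deriv (deriv B) 0)) :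
    ∃ T : ℝ × ℝ → ℝ × ℝ, AnalyticAt ℝ T 0 ∧ T 0 = 0 ∧
      (∀ᶠ p in 𝓝 (0 : ℝ × ℝ), (fderiv ℝ T p).det = 1) ∧
      (∀ᶠ p in 𝓝 (0 : ℝ × ℝ), negSnd (T (negSnd (T p))) = p) ∧
      (∃ (A : ℝ × ℝ →L[ℝ] ℝ × ℝ) (P β γ : ℝ), HasFDerivAt T A 0 ∧ A (1, 0) = (P, γ) ∧
        A (0, 1) = (β, P) ∧ 0 < β ∧ 0 < γ ∧ 1 < P) ∧
      ∀ Q : ℝ × ℝ → Prop, (∀ᶠ q in 𝓝 0, Q q) → ∀ᶠ p in 𝓝 (0 : ℝ × ℝ), ∃ q q', Q q ∧ Q q' ∧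
        p = (q.1, tangentialFst A B q) ∧
        (q'.2, tangentialSnd A B q') = negSnd (q.2, tangentialSnd A B q) ∧
        T p = negSnd (q'.1, tangentialFst A B q') := by
  have h0' : B (0 : ℝ × ℝ).2 - A (0 : ℝ × ℝ).1 ≠ 0 := h0
  have hn : 0 < ‖B 0 - A 0‖ := norm_pos_iff.2 h0
  have hAA : (inner ℝ (deriv A 0) (deriv A 0) : ℝ) = 1 := by
    rw [real_inner_self_eq_norm_sq, hA1, one_pow]
  have hc : ContinuousAt (fun q : ℝ × ℝ => B q.2 - A q.1) 0 :=
    (ContinuousAt.comp (g := B) (hB _ trivial).continuousAt continuousAt_snd).sub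
      (ContinuousAt.comp (g := A) (hA _ trivial).continuousAt continuousAt_fst)
  obtain ⟨e1, -⟩ := fderiv_tangentialFst hA hB h0'
  obtain ⟨e3, e4⟩ := fderiv_tangentialSnd hA hB h0'
  simp only [Prod.fst_zero, Prod.snd_zero, hAE, hBA, hAA, inner_neg_right, inner_neg_left]
    at e1 e3 e4
  -- On the periodic orbit the chord is orthogonal to both curves, so the second derivatives of its
  -- length reduce to these values. The curvature terms make a and d strictly larger than c.
  refine exists_reversible_map (analyticAt_tangentialFst hA hB h0')
    (analyticAt_tangentialSnd hA hB h0') (by simp [tangentialFst, hAE])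
    (by simp [tangentialSnd, hBE]) ?_ (a := (1 - inner ℝ (B 0 - A 0) (deriv (deriv A) 0)) /
      ‖B 0 - A 0‖) (c := 1 / ‖B 0 - A 0‖) (d := (1 + inner ℝ (B 0 - A 0) (deriv (deriv B) 0)) /
      ‖B 0 - A 0‖) (by positivity) ?_ ?_ ?_ ?_ ?_
  · filter_upwards [hc.eventually_ne h0'] with q hq
    rw [(fderiv_tangentialFst hA hB hq).2, (fderiv_tangentialSnd hA hB hq).1,
      real_inner_comm (deriv A q.1) (deriv B q.2)]
    ring
  · gcongr; linarith
  · gcongr; linarith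
  · rw [e1]; ring
  · rw [e3]; ring
  · rw [e4]; ring

end Generating

/-! ### Geometry of the billiard table -/

theorem inner_plane (x y : Plane) : inner ℝ x y = x 0 * y 0 + x 1 * y 1 := by
  simp [PiLp.inner_apply, Fin.sum_univ_two, mul_comm]

theorem plane_ext {x y : Plane} (h0 : x 0 = y 0) (h1 : x 1 = y 1) : x = y := by
  ext k; fin_cases k <;> assumption

theorem plane_norm_sq (x : Plane) : ‖x‖ ^ 2 = x 0 ^ 2 + x 1 ^ 2 := by
  rw [← real_inner_self_eq_norm_sq, inner_plane]; ring

namespace BilliardTable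

variable {m : ℕ} (D : BilliardTable m)

theorem tangent_sq (x : Collision m) : D.tangent x 0 ^ 2 + D.tangent x 1 ^ 2 = 1 := by
  rw [← plane_norm_sq, tangent, D.unit_speed, one_pow]

theorem normal_zero (x : Collision m) : D.normal x 0 = D.tangent x 1 := rfl

theorem normal_one (x : Collision m) : D.normal x 1 = -D.tangent x 0 := rfl

theorem inner_normal_tangent (x : Collision m) : inner ℝ (D.normal x) (D.tangent x) = (0 : ℝ) := by
  rw [inner_plane, normal_zero, normal_one]; ring

theorem inner_normal_self (x : Collision m) : inner ℝ (D.normal x) (D.normal x) = (1 : ℝ) := by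
  rw [inner_plane, normal_zero, normal_one]; linear_combination D.tangent_sq x

theorem inner_tangent_self (x : Collision m) : inner ℝ (D.tangent x) (D.tangent x) = (1 : ℝ) := by
  rw [inner_plane]; linear_combination D.tangent_sq x

theorem eq_inner_smul_add (x : Collision m) (w : Plane) :
    w = (inner ℝ w (D.normal x) : ℝ) • D.normal x + (inner ℝ w (D.tangent x) : ℝ) • D.tangent x := by
  have h := D.tangent_sq x
  refine plane_ext ?_ ?_ <;>
    simp only [PiLp.add_apply, PiLp.smul_apply, smul_eq_mul, inner_plane, normal_zero, normal_one]
  · linear_combination -w 0 * h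
  · linear_combination -w 1 * h

theorem norm_sq_eq (x : Collision m) (w : Plane) :
    ‖w‖ ^ 2 = (inner ℝ w (D.normal x) : ℝ) ^ 2 + (inner ℝ w (D.tangent x) : ℝ) ^ 2 := by
  have h := D.tangent_sq x
  rw [plane_norm_sq, inner_plane, inner_plane, normal_zero, normal_one]
  linear_combination -(w 0 ^ 2 + w 1 ^ 2) * h

theorem inner_velocity_tangent (x : Collision m) : inner ℝ (D.velocity x) (D.tangent x) = x.r := by
  rw [velocity, inner_add_left, inner_smul_left, inner_smul_left, inner_normal_tangent,
    inner_tangent_self]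
  simp

theorem velocity_eq (x : Collision m) {w : Plane} (hw : w ≠ 0)
    (hr : x.r = inner ℝ w (D.tangent x) / ‖w‖) :
    D.velocity x = ‖w‖⁻¹ • (|(inner ℝ w (D.normal x) : ℝ)| • D.normal x +
      (inner ℝ w (D.tangent x) : ℝ) • D.tangent x) := by
  have hn : 0 < ‖w‖ := norm_pos_iff.2 hw
  have h : 1 - x.r ^ 2 = (|(inner ℝ w (D.normal x) : ℝ)| / ‖w‖) ^ 2 := by
    rw [hr, div_pow, div_pow, sq_abs]
    field_simp
    linarith [D.norm_sq_eq x w]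
  rw [velocity, h, Real.sqrt_sq (by positivity), hr, smul_add, smul_smul, smul_smul]
  congr 2 <;> ring

theorem point_mem (x : Collision m) : D.point x ∈ D.O x.idx := by
  have : D.point x ∈ frontier (D.O x.idx) := by
    rw [← D.range_eq]; exact mem_range_self _
  exact (D.isCompact _).isClosed.frontier_subset this

/-- An obstacle lies on one side of each of its tangent lines. -/
theorem inner_normal_nonpos (x : Collision m) {z : Plane} (hz : z ∈ D.O x.idx) :
    inner ℝ (z - D.point x) (D.normal x) ≤ (0 : ℝ) := by
  have hx : D.point x ∉ interior (D.O x.idx) := by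
    have : D.point x ∈ frontier (D.O x.idx) := by
      rw [← D.range_eq]; exact mem_range_self _
    exact this.2
  -- The supporting functional attains its maximum over the obstacle at the point of impact, so it
  -- vanishes on the tangent and is a multiple of the inner product with the normal. Only the sign
  -- of this multiple remains to be found.
  obtain ⟨f, hf, hmax⟩ := geometric_hahn_banach_of_nonempty_interior_point (D.convex x.idx) hx
    (D.nonempty_interior _)
  have hfc : ∀ s, HasDerivAt (fun t => f (D.Υ x.idx t)) (f (deriv (D.Υ x.idx) s)) s := fun s =>
    f.hasFDerivAt.comp_hasDerivAt s (D.analytic x.idx s trivial).differentiableAt.hasDerivAt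
  have hd1 : deriv (fun t => f (D.Υ x.idx t)) = fun s => f (deriv (D.Υ x.idx) s) :=
    funext fun s => (hfc s).deriv
  have hfc2 : HasDerivAt (fun t => f (deriv (D.Υ x.idx) t)) (f (deriv (deriv (D.Υ x.idx)) x.s)) x.s :=
    f.hasFDerivAt.comp_hasDerivAt x.s
      (D.analytic x.idx x.s trivial).deriv.differentiableAt.hasDerivAt
  have hlm : ∀ s, f (D.Υ x.idx s) ≤ f (D.Υ x.idx x.s) := fun s =>
    hmax _ (D.point_mem ⟨x.idx, s, 0⟩)
  have hmaxl : IsLocalMax (fun t => f (D.Υ x.idx t)) x.s := Eventually.of_forall hlm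
  have hft : f (D.tangent x) = 0 := by
    have := hmaxl.deriv_eq_zero
    rwa [hd1] at this
  -- `f` is a multiple of the inner product with the normal
  have hfw : ∀ w, f w = inner ℝ w (D.normal x) * f (D.normal x) := fun w => by
    conv_lhs => rw [D.eq_inner_smul_add x w]
    rw [map_add, map_smul, map_smul, hft, smul_zero, add_zero, smul_eq_mul]
  have hne : f (D.normal x) ≠ 0 := fun h => hf (by
    ext w; rw [hfw, h]; simp)
  have hK : inner ℝ (deriv (deriv (D.Υ x.idx)) x.s) (D.normal x) < (0 : ℝ) := by
    have := D.curvature_pos x.idx x.s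
    rw [inner_plane, normal_zero, normal_one]
    simp only [tangent]
    linarith
  have hpos : 0 < f (D.normal x) := by
    -- With the wrong sign, positive curvature would make the point a local minimum of f along the
    -- boundary, besides a maximum; f would then be locally constant there, against its nonzero
    -- second derivative.
    by_contra hneg
    have hlt : f (D.normal x) < 0 := lt_of_le_of_ne (not_lt.1 hneg) hne
    have h2 : 0 < f (deriv (deriv (D.Υ x.idx)) x.s) := by
      rw [hfw]; exact mul_pos_of_neg_of_neg hK hlt
    have hmin : IsLocalMin (fun t => f (D.Υ x.idx t)) x.s :=
      isLocalMin_of_deriv_deriv_pos (by rw [hd1, hfc2.deriv]; exact h2)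
        (by rw [hd1]; exact hft) (hfc x.s).continuousAt
    have hconst : (fun t => f (D.Υ x.idx t)) =ᶠ[𝓝 x.s] fun _ => f (D.Υ x.idx x.s) := by
      filter_upwards [hmin] with t ht
      exact le_antisymm (hlm t) ht
    have h3 := hconst.deriv.deriv_eq
    rw [hd1, hfc2.deriv] at h3
    simp at h3
    linarith
  have := hmax z hz
  have h4 : f (z - D.point x) ≤ 0 := by rw [map_sub]; linarith
  rw [hfw] at h4
  by_contra hcon
  push Not at hcon
  nlinarith

theorem inner_deriv_deriv_normal (x : Collision m) :
    inner ℝ (D.normal x) (deriv (deriv (D.Υ x.idx)) x.s) < (0 : ℝ) := by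
  have := D.curvature_pos x.idx x.s
  rw [inner_plane, normal_zero, normal_one]
  simp only [tangent]
  linarith

/-- The non-eclipse condition makes two obstacles disjoint, as there is a third one. -/
theorem disjoint_obstacles (hm : 3 ≤ m) {i j : Fin m} (hij : i ≠ j) : Disjoint (D.O i) (D.O j) := by
  obtain ⟨k, hk⟩ : ∃ k : Fin m, k ∉ ({i, j} : Finset (Fin m)) := by
    by_contra h
    push Not at h
    have h1 := Finset.card_le_card (fun k _ => h k : (Finset.univ : Finset (Fin m)) ⊆ {i, j})
    rw [Finset.card_univ, Fintype.card_fin] at h1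
    have := h1.trans Finset.card_le_two
    omega
  simp only [Finset.mem_insert, Finset.mem_singleton, not_or] at hk
  exact (D.non_eclipse i k j (Ne.symm hk.1) hij.symm (Ne.symm hk.2)).mono_left
    (subset_union_left.trans (subset_convexHull ℝ _))

/-- The open chord lies strictly outside the supporting half-planes of the two end obstacles, and
inside their convex hull, which the other obstacles avoid. The sign conditions also select the
outgoing branch of the velocity at each end. -/
theorem bounce_of_inner_pos {x y : Collision m} (hxy : x.idx ≠ y.idx)
    (hx : 0 < (inner ℝ (D.point y - D.point x) (D.normal x) : ℝ))
    (hy : inner ℝ (D.point y - D.point x) (D.normal y) < (0 : ℝ))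
    (hxr : x.r = inner ℝ (D.point y - D.point x) (D.tangent x) / ‖D.point y - D.point x‖)
    (hyr : y.r = inner ℝ (D.point y - D.point x) (D.tangent y) / ‖D.point y - D.point x‖) :
    D.Bounce x y := by
  set w := D.point y - D.point x with hw
  have hw0 : w ≠ 0 := fun h => by rw [h, inner_zero_left] at hx; exact lt_irrefl _ hx
  have hn : 0 < ‖w‖ := norm_pos_iff.2 hw0
  have hle : ∀ z : Collision m, |inner ℝ w (D.tangent z) / ‖w‖| ≤ (1 : ℝ) := fun z => by
    rw [abs_div, abs_of_pos hn, div_le_one hn]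
    refine abs_le_of_sq_le_sq ?_ hn.le
    rw [D.norm_sq_eq z w]
    nlinarith [sq_nonneg (inner ℝ w (D.normal z) : ℝ)]
  have hvx : D.velocity x = ‖w‖⁻¹ • w := by
    rw [D.velocity_eq x hw0 hxr, abs_of_pos hx, ← D.eq_inner_smul_add]
  have hpy : D.point y = D.point x + w := by rw [hw]; abel
  refine ⟨hxr ▸ hle x, hyr ▸ hle y, ⟨‖w‖, hn, ?_, ?_⟩, ?_⟩
  · rw [hvx, smul_smul, mul_inv_cancel₀ hn.ne', one_smul, hpy]
  · intro u hu k hk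
    rw [hvx, smul_smul] at hk
    set v := u * ‖w‖⁻¹ with hv
    have hv0 : 0 < v := mul_pos hu.1 (by positivity)
    have hv1 : v < 1 := by
      rw [hv, ← div_eq_mul_inv, div_lt_one hn]; exact hu.2
    by_cases h1 : k = x.idx
    · subst h1
      have := D.inner_normal_nonpos x hk
      rw [add_sub_cancel_left, inner_smul_left] at this
      have h2 := mul_pos hv0 hx
      simp at this
      linarith
    by_cases h2 : k = y.idx
    · subst h2
      have := D.inner_normal_nonpos y hk
      have e : D.point x + v • w - D.point y = -((1 - v) • w) := by
        rw [hpy, sub_smul, one_smul]; abel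
      rw [e, inner_neg_left, inner_smul_left] at this
      have h3 := mul_neg_of_pos_of_neg (sub_pos.2 hv1) hy
      simp at this
      linarith
    · refine (D.non_eclipse x.idx y.idx k hxy h1 h2).le_bot ⟨?_, hk⟩
      have hc := convex_convexHull ℝ (D.O x.idx ∪ D.O y.idx)
      have := hc (subset_convexHull ℝ _ (Or.inl (D.point_mem x)))
        (subset_convexHull ℝ _ (Or.inr (D.point_mem y))) (sub_pos.2 hv1).le hv0.le
        (sub_add_cancel 1 v)
      convert! this using 1
      rw [hpy, smul_add, sub_smul, one_smul]
      abel
  · rw [hvx, D.velocity_eq y hw0 hyr, abs_of_neg hy, inner_smul_left]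
    have hd := D.eq_inner_smul_add y w
    simp only [conj_trivial]
    linear_combination (norm := module) (-‖w‖⁻¹) • hd

theorem inner_velocity_eq_of_bounce {x y : Collision m} (h : D.Bounce x y) :
    y.r = inner ℝ (D.velocity x - (2 * inner ℝ (D.velocity x) (D.normal y) : ℝ) • D.normal y)
      (D.tangent y) := by
  rw [← h.2.2.2, inner_velocity_tangent]

/-- Two sets of coordinates of the same collision. -/
def SameCollision (x y : Collision m) : Prop :=
  x.idx = y.idx ∧ (∃ n : ℤ, y.s = x.s + n • D.ℓ x.idx) ∧ x.r = y.r

variable {D}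

theorem eq_add_zsmul_of_eq {i : Fin m} {s s' : ℝ} (h : D.Υ i s = D.Υ i s') :
    ∃ n : ℤ, s' = s + n • D.ℓ i := by
  have hl := D.length_pos i
  have e : ∀ t, D.Υ i (toIcoMod hl 0 t) = D.Υ i t := fun t => by
    rw [← self_sub_toIcoDiv_zsmul]; exact (D.periodic i).sub_zsmul_eq _
  have h1 := D.simple i (toIcoMod_mem_Ico' hl s) (toIcoMod_mem_Ico' hl s') (by rw [e, e, h])
  refine ⟨toIcoDiv hl 0 s' - toIcoDiv hl 0 s, ?_⟩
  rw [sub_zsmul]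
  have h2 := toIcoMod_add_toIcoDiv_zsmul hl 0 s
  have h3 := toIcoMod_add_toIcoDiv_zsmul hl 0 s'
  linarith

namespace SameCollision

variable {x y : Collision m}

theorem point_eq (h : D.SameCollision x y) : D.point x = D.point y := by
  obtain ⟨h1, ⟨n, h2⟩, -⟩ := h
  rw [point, point, ← h1, h2, ((D.periodic x.idx).zsmul n) x.s]

theorem tangent_eq (h : D.SameCollision x y) : D.tangent x = D.tangent y := by
  obtain ⟨h1, ⟨n, h2⟩, -⟩ := h
  have : (fun t => D.Υ x.idx (t + n • D.ℓ x.idx)) = D.Υ x.idx :=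
    funext ((D.periodic x.idx).zsmul n)
  rw [tangent, tangent, ← h1, h2, ← deriv_comp_add_const, this]

theorem normal_eq (h : D.SameCollision x y) : D.normal x = D.normal y := by
  rw [normal, normal, h.tangent_eq]

theorem velocity_eq (h : D.SameCollision x y) : D.velocity x = D.velocity y := by
  rw [velocity, velocity, h.tangent_eq, h.normal_eq, h.2.2]

theorem bounce (h : D.SameCollision x y) {z : Collision m} (hb : D.Bounce x z) : D.Bounce y z := by
  unfold Bounce at *
  rwa [← h.point_eq, ← h.velocity_eq, ← h.2.2]

end SameCollision

/-- The flight time is the first hitting time. Distinct obstacles are disjoint, so the point of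
impact determines the label, and it determines s up to a multiple of the length of the boundary. -/
theorem Bounce.unique (hm : 3 ≤ m) {x y y' : Collision m} (h : D.Bounce x y) (h' : D.Bounce x y') :
    D.SameCollision y y' := by
  obtain ⟨-, -, ⟨t, ht, hy, hav⟩, -⟩ := id h
  obtain ⟨-, -, ⟨t', ht', hy', hav'⟩, -⟩ := id h'
  have htt : t = t' := by
    rcases lt_trichotomy t t' with hlt | heq | hgt
    · exact absurd (hy ▸ D.point_mem y) (hav' t ⟨ht, hlt⟩ _)
    · exact heq
    · exact absurd (hy' ▸ D.point_mem y') (hav t' ⟨ht', hgt⟩ _)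
  have hp : D.point y = D.point y' := by rw [hy, hy', htt]
  have hidx : y.idx = y'.idx := by
    by_contra hne
    exact (D.disjoint_obstacles hm hne).le_bot ⟨D.point_mem y, hp ▸ D.point_mem y'⟩
  have hs : ∃ n : ℤ, y'.s = y.s + n • D.ℓ y.idx :=
    eq_add_zsmul_of_eq (by
      have := hp
      rwa [point, point, ← hidx] at this)
  refine ⟨hidx, hs, ?_⟩
  have hsame : D.SameCollision ⟨y.idx, y.s, y.r⟩ ⟨y'.idx, y'.s, y.r⟩ := ⟨hidx, hs, rfl⟩
  have ht : D.tangent y = D.tangent y' := hsame.tangent_eq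
  have hn : D.normal y = D.normal y' := hsame.normal_eq
  rw [D.inner_velocity_eq_of_bounce h, D.inner_velocity_eq_of_bounce h', ht, hn]

theorem SquareMap.unique (hm : 3 ≤ m) {i : Fin m} {p p' p'' : ℝ × ℝ} (h' : D.SquareMap i p p')
    (h'' : D.SquareMap i p p'') (hp' : |p'.1| < D.ℓ i / 2) (hp'' : |p''.1| < D.ℓ i / 2) :
    p' = p'' := by
  obtain ⟨y, h1, h2⟩ := h'
  obtain ⟨z, h3, h4⟩ := h''
  obtain ⟨-, ⟨n, hn⟩, hr⟩ := ((h1.unique hm h3).bounce h2).unique hm h4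
  simp only [zsmul_eq_mul] at hn hr
  -- Both values of s lie in an open interval of length ℓ, so they cannot differ by a nonzero
  -- multiple of ℓ.
  have hn0 : n = 0 := by
    have hl := D.length_pos i
    rw [abs_lt] at hp' hp''
    have h5 : (n : ℝ) < 1 := by
      by_contra h; push Not at h
      nlinarith
    have h6 : (-1 : ℝ) < n := by
      by_contra h; push Not at h
      nlinarith
    have h7 : n < 1 := by exact_mod_cast h5
    have h8 : -1 < n := by exact_mod_cast h6
    omega
  rw [hn0] at hn
  exact Prod.ext (by simpa using hn.symm) hr

end BilliardTable

/-! ### The square of the billiard map near the periodic orbit -/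

namespace BilliardTable

variable {m : ℕ} {D : BilliardTable m} {i j : Fin m}

theorem velocity_of_r_eq_zero (i : Fin m) (s : ℝ) : D.velocity ⟨i, s, 0⟩ = D.normal ⟨i, s, 0⟩ := by
  simp [velocity]

/-- The orbit leaves and arrives along the normals. Pairing the law of reflection with the second
normal v gives ⟨u, v⟩ = -1 for the first normal u, and the same law then reads u + v = 0. -/
theorem normal_eq_neg_of_bounce {b : ℝ} (h : D.Bounce ⟨i, 0, 0⟩ ⟨j, b, 0⟩) :
    ∃ t : ℝ, 0 < t ∧ D.Υ j b - D.Υ i 0 = t • D.normal ⟨i, 0, 0⟩ ∧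
      D.normal ⟨j, b, 0⟩ = -D.normal ⟨i, 0, 0⟩ := by
  obtain ⟨-, -, ⟨t, ht, hp, -⟩, hv⟩ := h
  rw [velocity_of_r_eq_zero] at hp hv
  rw [velocity_of_r_eq_zero] at hv
  refine ⟨t, ht, ?_, ?_⟩
  · rw [sub_eq_iff_eq_add']; exact hp
  · set u := D.normal ⟨i, 0, 0⟩
    set v := D.normal ⟨j, b, 0⟩
    have huu : inner ℝ u u = (1 : ℝ) := D.inner_normal_self _
    have hvv : inner ℝ v v = (1 : ℝ) := D.inner_normal_self _
    have h1 := congrArg (fun w => (inner ℝ w v : ℝ)) hv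
    simp only [inner_sub_left, inner_smul_left, hvv, conj_trivial] at h1
    have h2 : (inner ℝ u v : ℝ) = -1 := by linarith
    rw [h2] at hv
    have h3 : u + v = 0 := by linear_combination (norm := module) -hv
    exact eq_neg_of_add_eq_zero_right h3

theorem exists_squareMap (hij : i ≠ j) {b : ℝ} (h : D.Bounce ⟨i, 0, 0⟩ ⟨j, b, 0⟩) :
    ∃ T : ℝ × ℝ → ℝ × ℝ, AnalyticAt ℝ T 0 ∧ T 0 = 0 ∧
      (∀ᶠ p in 𝓝 (0 : ℝ × ℝ), (fderiv ℝ T p).det = 1) ∧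
      (∀ᶠ p in 𝓝 (0 : ℝ × ℝ), negSnd (T (negSnd (T p))) = p) ∧
      (∃ (A : ℝ × ℝ →L[ℝ] ℝ × ℝ) (P β γ : ℝ), HasFDerivAt T A 0 ∧ A (1, 0) = (P, γ) ∧
        A (0, 1) = (β, P) ∧ 0 < β ∧ 0 < γ ∧ 1 < P) ∧
      ∀ᶠ p in 𝓝 (0 : ℝ × ℝ), D.SquareMap i p (T p) := by
  obtain ⟨t, ht, hE, hn⟩ := normal_eq_neg_of_bounce h
  set A : ℝ → Plane := D.Υ i with hA
  set B : ℝ → Plane := fun s => D.Υ j (b + s) with hB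
  have hAa : AnalyticOnNhd ℝ A univ := D.analytic i
  have hBa : AnalyticOnNhd ℝ B univ := fun s _ =>
    AnalyticAt.comp (g := D.Υ j) (f := fun s => b + s) (D.analytic j _ trivial)
      (analyticAt_const.add analyticAt_id)
  have hB' : deriv B = fun s => deriv (D.Υ j) (b + s) := funext fun s => deriv_comp_const_add _ _ _
  have hB'' : deriv (deriv B) = fun s => deriv (deriv (D.Υ j)) (b + s) := by
    rw [hB']; exact funext fun s => deriv_comp_const_add (deriv (D.Υ j)) b s
  have hB0 : deriv B 0 = deriv (D.Υ j) b := by simp [hB']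
  have hB0' : deriv (deriv B) 0 = deriv (deriv (D.Υ j)) b := by simp [hB'']
  have hE' : B 0 - A 0 = t • D.normal ⟨i, 0, 0⟩ := by simpa [hB] using hE
  have hE'' : B 0 - A 0 = -(t • D.normal ⟨j, b, 0⟩) := by rw [hE', hn, smul_neg, neg_neg]
  have hpos : (0 : ℝ) < inner ℝ (B 0 - A 0) (D.normal ⟨i, 0, 0⟩) := by
    rw [hE', inner_smul_left, inner_normal_self]; simpa
  have hneg : inner ℝ (B 0 - A 0) (D.normal ⟨j, b, 0⟩) < (0 : ℝ) := by
    rw [hE'', inner_neg_left, inner_smul_left, inner_normal_self]; simpa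
  have h0 : B 0 - A 0 ≠ 0 := fun h => by rw [h, inner_zero_left] at hpos; exact lt_irrefl _ hpos
  have hBA : deriv B 0 = -deriv A 0 := by
    rw [hB']
    have e0 := congrArg (fun w : Plane => w 0) hn
    have e1 := congrArg (fun w : Plane => w 1) hn
    simp only [PiLp.neg_apply, normal_zero, normal_one, tangent] at e0 e1
    refine plane_ext ?_ ?_ <;> simp only [PiLp.neg_apply, add_zero, hA] <;> linarith
  obtain ⟨T, hT, hT0, hdet, hrev, hlin, hQ⟩ := exists_reversible_map_of_curves hAa hBa h0
    (by rw [hE', inner_smul_left]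
        exact mul_eq_zero_of_right _ (D.inner_normal_tangent ⟨i, 0, 0⟩))
    (by rw [hE'', inner_neg_left, inner_smul_left, hB0, neg_eq_zero]
        exact mul_eq_zero_of_right _ (D.inner_normal_tangent ⟨j, b, 0⟩))
    (D.unit_speed i 0) hBA
    (by rw [hE', inner_smul_left]
        exact mul_neg_of_pos_of_neg ht (D.inner_deriv_deriv_normal ⟨i, 0, 0⟩))
    (by rw [hE'', inner_neg_left, inner_smul_left, hB0', neg_pos]
        exact mul_neg_of_pos_of_neg ht (D.inner_deriv_deriv_normal ⟨j, b, 0⟩))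
  refine ⟨T, hT, hT0, hdet, hrev, hlin, ?_⟩
  have cA : Continuous A := continuous_iff_continuousAt.2 fun s => (hAa s trivial).continuousAt
  have cB : Continuous B := continuous_iff_continuousAt.2 fun s => (hBa s trivial).continuousAt
  have cA' : Continuous (deriv A) :=
    continuous_iff_continuousAt.2 fun s => (hAa s trivial).deriv.continuousAt
  have cB' : Continuous (deriv B) :=
    continuous_iff_continuousAt.2 fun s => (hBa s trivial).deriv.continuousAt
  have hnB : ∀ s r, D.normal ⟨j, b + s, r⟩ = !₂[deriv B s 1, -deriv B s 0] := fun s r => by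
    rw [hB']; rfl
  have c1 : Continuous fun q : ℝ × ℝ =>
      (inner ℝ (B q.2 - A q.1) (D.normal ⟨i, q.1, 0⟩) : ℝ) := by
    simp only [inner_plane, normal_zero, normal_one, tangent]
    simp only [← hA, PiLp.sub_apply]
    fun_prop
  have c2 : Continuous fun q : ℝ × ℝ =>
      (inner ℝ (B q.2 - A q.1) (D.normal ⟨j, b + q.2, 0⟩) : ℝ) := by
    simp only [hnB, inner_plane, PiLp.sub_apply]
    simp only [Matrix.cons_val_zero, Matrix.cons_val_one]
    fun_prop
  -- The chord conditions of `bounce_of_inner_pos` are open and hold on the periodic orbit, hence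
  -- for both flights of every nearby trajectory.
  have hev := hQ (fun q => 0 < (inner ℝ (B q.2 - A q.1) (D.normal ⟨i, q.1, 0⟩) : ℝ) ∧
      (inner ℝ (B q.2 - A q.1) (D.normal ⟨j, b + q.2, 0⟩) : ℝ) < 0)
    ((c1.continuousAt.eventually_const_lt (by simpa using hpos)).and
      (c2.continuousAt.eventually_lt_const (by simpa using hneg)))
  filter_upwards [hev] with p hp
  obtain ⟨q, q', ⟨hq1, hq2⟩, ⟨hq1', hq2'⟩, hpq, hqq, hTp⟩ := hp
  have hq'2 : q'.2 = q.2 := congrArg Prod.fst hqq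
  have hr : tangentialSnd A B q = -tangentialSnd A B q' := by
    have : tangentialSnd A B q' = -tangentialSnd A B q := congrArg Prod.snd hqq
    rw [this, neg_neg]
  have hB1 : ∀ s, deriv B s = D.tangent ⟨j, b + s, 0⟩ := fun s => by rw [hB']; rfl
  refine ⟨⟨j, b + q.2, tangentialSnd A B q⟩, ?_, ?_⟩
  · rw [hpq]
    exact D.bounce_of_inner_pos hij hq1 hq2 rfl (by
      simp only [tangentialSnd, hB1]; rfl)
  · rw [hTp, hr, ← hq'2]
    have e : D.Υ i q'.1 - D.Υ j (b + q'.2) = -(B q'.2 - A q'.1) := by rw [neg_sub]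
    refine D.bounce_of_inner_pos (Ne.symm hij) ?_ ?_ ?_ ?_
    · change (0 : ℝ) < inner ℝ (D.Υ i q'.1 - D.Υ j (b + q'.2)) (D.normal ⟨j, b + q'.2, 0⟩)
      rw [e, inner_neg_left]
      linarith
    · change inner ℝ (D.Υ i q'.1 - D.Υ j (b + q'.2)) (D.normal ⟨i, q'.1, 0⟩) < (0 : ℝ)
      rw [e, inner_neg_left]
      linarith
    · change -tangentialSnd A B q' = inner ℝ (D.Υ i q'.1 - D.Υ j (b + q'.2))
        (D.tangent ⟨j, b + q'.2, 0⟩) / ‖D.Υ i q'.1 - D.Υ j (b + q'.2)‖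
      rw [e, inner_neg_left, norm_neg, tangentialSnd, hB1, neg_div]
    · change -tangentialFst A B q' = inner ℝ (D.Υ i q'.1 - D.Υ j (b + q'.2))
        (D.tangent ⟨i, q'.1, 0⟩) / ‖D.Υ i q'.1 - D.Υ j (b + q'.2)‖
      rw [e, inner_neg_left, norm_neg, tangentialFst, neg_div]
      rfl

/-- R intertwines `negSnd` with the swap, so it matches their fixed sets, the axis r = 0 and the
diagonal. The positive derivative along the axis selects the half-lines. -/
theorem exists_isCanonicalConjugacy (hm : 3 ≤ m) {T R : ℝ × ℝ → ℝ × ℝ} {Δ Δ' : ℝ → ℝ}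
    (hT : ContinuousAt T 0) (hT0 : T 0 = 0)
    (hsq : ∀ᶠ p in 𝓝 (0 : ℝ × ℝ), D.SquareMap i p (T p))
    (hR : AnalyticAt ℝ R 0) (hR0 : R 0 = 0)
    (hdet : ∀ᶠ p in 𝓝 (0 : ℝ × ℝ), (fderiv ℝ R p).det = 1)
    (hconj : ∀ᶠ p in 𝓝 (0 : ℝ × ℝ), R (T p) = normalForm Δ (R p))
    (hswap : ∀ᶠ p in 𝓝 (0 : ℝ × ℝ), R (negSnd p) = (R p).swap)
    (hpos : 0 < (fderiv ℝ R 0 (1, 0)).1)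
    (hΔ' : AnalyticAt ℝ Δ' 0) (hΔ'0 : Δ' 0 ≠ 0) (hΔ : Δ =ᶠ[𝓝 0] Δ') :
    ∃ U, D.IsCanonicalConjugacy i Δ' U R := by
  have hRt : Tendsto R (𝓝 0) (𝓝 0) := by simpa [hR0] using hR.continuousAt.tendsto
  have hmt : Tendsto (fun p => (R p).1 * (R p).2) (𝓝 0) (𝓝 0) := tendsto_mul_zero.comp hRt
  have hTt : Tendsto T (𝓝 0) (𝓝 0) := by simpa [hT0] using hT.tendsto
  have hl := D.length_pos i
  have hchart : ∀ᶠ p in 𝓝 (0 : ℝ × ℝ), |p.1| < D.ℓ i / 2 ∧ |p.2| < 1 :=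
    ((continuous_fst.abs.tendsto' (0 : ℝ × ℝ) 0 (by simp)).eventually_lt_const (by positivity)).and
      ((continuous_snd.abs.tendsto' (0 : ℝ × ℝ) 0 (by simp)).eventually_lt_const one_pos)
  obtain ⟨G, -, -, hGR, -⟩ := exists_analytic_localInverse hR
    (by rw [hdet.self_of_nhds]; exact one_ne_zero)
  have hpos' : ∀ᶠ p in 𝓝 (0 : ℝ × ℝ), 0 < (fderiv ℝ R p (1, 0)).1 := by
    have : ContinuousAt (fun p => (fderiv ℝ R p (1, 0)).1) 0 :=
      (hR.fderiv.continuousAt.clm_apply continuousAt_const).fst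
    exact this.eventually_const_lt hpos
  have hall := hchart.and (hsq.and (hR.eventually_analyticAt.and (hdet.and (hconj.and (hswap.and
    (hpos'.and (hGR.and ((hTt.eventually hchart).and ((hmt.eventually hΔ'.eventually_analyticAt).and
    ((hmt.eventually (hΔ'.continuousAt.eventually_ne hΔ'0)).and (hmt.eventually hΔ)))))))))))
  -- Balls of the maximum norm are squares, hence invariant under `negSnd`; this is needed to
  -- recognize the preimages of points of the diagonal.
  obtain ⟨r, hr, hball⟩ := Metric.eventually_nhds_iff_ball.1 hall
  have hmem : ∀ p : ℝ × ℝ, p ∈ Metric.ball (0 : ℝ × ℝ) r ↔ |p.1| < r ∧ |p.2| < r := fun p => by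
    rw [mem_ball_zero_iff, Prod.norm_def, max_lt_iff, Real.norm_eq_abs, Real.norm_eq_abs]
  have hinj : InjOn R (Metric.ball 0 r) := fun p hp q hq hpq => by
    rw [← (hball p hp).2.2.2.2.2.2.2.1, ← (hball q hq).2.2.2.2.2.2.2.1, hpq]
  -- monotonicity along the axis
  have hmono : StrictMonoOn (fun s : ℝ => (R (s, 0)).1) (Ioo (-r) r) := by
    have hd : ∀ s ∈ Ioo (-r) r, HasDerivAt (fun s : ℝ => (R (s, 0)).1)
        (fderiv ℝ R (s, 0) (1, 0)).1 s := fun s hs => by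
      have h1 : HasDerivAt (fun s : ℝ => (s, (0 : ℝ))) ((1 : ℝ), (0 : ℝ)) s :=
        (hasDerivAt_id s).prodMk (hasDerivAt_const _ _)
      have h2 := (hball (s, 0) ((hmem _).2 ⟨abs_lt.2 hs, by simpa using hr⟩)).2.2.1
      exact (hasFDerivAt_fst (𝕜 := ℝ) (E := ℝ) (F := ℝ)).comp_hasDerivAt s
        (HasFDerivAt.comp_hasDerivAt s (l := R) h2.differentiableAt.hasFDerivAt h1)
    refine strictMonoOn_of_deriv_pos (convex_Ioo _ _)
      (fun s hs => (hd s hs).continuousAt.continuousWithinAt) fun s hs => ?_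
    rw [interior_Ioo] at hs
    rw [(hd s hs).deriv]
    exact (hball (s, 0) ((hmem _).2 ⟨abs_lt.2 hs, by simpa using hr⟩)).2.2.2.2.2.2.1
  have h0r : (0 : ℝ) ∈ Ioo (-r) r := ⟨by linarith, hr⟩
  have hR00 : R (0, 0) = 0 := hR0
  refine ⟨Metric.ball 0 r, ⟨Metric.isOpen_ball, Metric.mem_ball_self hr, fun p hp => (hball p hp).1,
    fun p hp => ⟨_, (hball p hp).2.1⟩, fun p hp => (hball p hp).2.2.1, hinj, hR0,
    fun p hp => (hball p hp).2.2.2.1, fun p hp => ?_, fun p hp p' hp' hpp' => ?_⟩, ?_⟩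
  · obtain ⟨-, -, -, -, -, -, -, -, -, h1, h2, -⟩ := hball p hp
    exact ⟨h1, h2⟩
  · obtain ⟨-, h1, -, -, h2, -, -, -, h3, -, -, h4⟩ := hball p hp
    rw [hpp'.unique hm h1 (hball p' hp').1.1 h3.1, h2, normalForm, normalForm, h4]
  · apply Subset.antisymm
    · rintro _ ⟨p, ⟨hp, s, hs, rfl⟩, rfl⟩
      refine ⟨⟨_, hp, rfl⟩, (R (s, 0)).1, ?_, ?_⟩
      · have h1 := hmono.monotoneOn h0r (abs_lt.1 ((hmem _).1 hp).1) hs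
        simpa only [hR00, Prod.fst_zero] using h1
      · have h1 := (hball _ hp).2.2.2.2.2.1
        have h2 : negSnd (s, 0) = (s, 0) := by simp [negSnd]
        rw [h2] at h1
        have h3 : (R (s, 0)).2 = (R (s, 0)).1 := congrArg Prod.snd h1
        exact Prod.ext rfl h3
    · rintro _ ⟨⟨p, hp, rfl⟩, ξ, hξ, hRp⟩
      have hp' := (hmem p).1 hp
      have h1 := (hball _ hp).2.2.2.2.2.1
      have h2 : (R p).swap = R p := by rw [hRp]; rfl
      rw [h2] at h1
      -- A point whose image lies on the diagonal has the same image as its reflection, so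
      -- injectivity puts it on the axis.
      have h3 := hinj ((hmem (negSnd p)).2 ⟨hp'.1, by simpa [negSnd] using hp'.2⟩) hp h1
      have h4 : p.2 = 0 := by
        have := congrArg Prod.snd h3
        simp only [negSnd] at this
        linarith
      have hpe : p = (p.1, 0) := Prod.ext rfl h4
      refine ⟨p, ⟨hp, p.1, ?_, hpe⟩, rfl⟩
      by_contra hneg
      have h5 := hmono (abs_lt.1 hp'.1) h0r (not_le.1 hneg)
      simp only [← hpe, hR00, hRp, Prod.fst_zero] at h5
      linarith

theorem IsConjugacy.eventually_conj {Δ : ℝ → ℝ} {U : Set (ℝ × ℝ)} {T R : ℝ × ℝ → ℝ × ℝ}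
    (h : D.IsConjugacy i Δ U R) (hT : ContinuousAt T 0) (hT0 : T 0 = 0)
    (hsq : ∀ᶠ p in 𝓝 (0 : ℝ × ℝ), D.SquareMap i p (T p)) :
    ∀ᶠ p in 𝓝 (0 : ℝ × ℝ), R (T p) = normalForm Δ (R p) := by
  have hU : U ∈ 𝓝 (0 : ℝ × ℝ) := h.isOpen.mem_nhds h.zero_mem
  have hTt : Tendsto T (𝓝 0) (𝓝 0) := by simpa [hT0] using hT.tendsto
  filter_upwards [hU, hTt hU, hsq] with p h1 h2 h3
  exact h.conj p h1 _ h2 h3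

theorem IsConjugacy.eventually_det {Δ : ℝ → ℝ} {U : Set (ℝ × ℝ)} {R : ℝ × ℝ → ℝ × ℝ}
    (h : D.IsConjugacy i Δ U R) : ∀ᶠ p in 𝓝 (0 : ℝ × ℝ), (fderiv ℝ R p).det = 1 := by
  filter_upwards [h.isOpen.mem_nhds h.zero_mem] with p hp using h.symplectic p hp

theorem IsCanonicalConjugacy.eventually_diagonal {Δ : ℝ → ℝ} {U : Set (ℝ × ℝ)}
    {R : ℝ × ℝ → ℝ × ℝ} (h : D.IsCanonicalConjugacy i Δ U R) :
    ∀ᶠ s in 𝓝 (0 : ℝ), 0 ≤ s → 0 ≤ (R (s, 0)).1 ∧ (R (s, 0)).1 = (R (s, 0)).2 := by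
  have hin : Tendsto (fun s : ℝ => (s, (0 : ℝ))) (𝓝 0) (𝓝 0) :=
    Continuous.tendsto' (by fun_prop) 0 0 rfl
  filter_upwards [hin (h.1.isOpen.mem_nhds h.1.zero_mem)] with s hs h0
  have h1 : R (s, 0) ∈ R '' (U ∩ {p | ∃ s : ℝ, 0 ≤ s ∧ p = (s, 0)}) := ⟨_, ⟨hs, s, h0, rfl⟩, rfl⟩
  rw [h.2] at h1
  obtain ⟨-, ξ, hξ, he⟩ := h1
  rw [he]
  exact ⟨hξ, rfl⟩

end BilliardTable

theorem mainTheorem10 (m : ℕ) (hm : 3 ≤ m) (D : BilliardTable m) (i j : Fin m) (hij : i ≠ j)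
    (b : ℝ) (hijb : D.Bounce ⟨i, 0, 0⟩ ⟨j, b, 0⟩) (hjib : D.Bounce ⟨j, b, 0⟩ ⟨i, 0, 0⟩) :
    (∃ Δ : ℝ → ℝ, D.IsBirkhoffNormalForm i Δ) ∧
    (∀ Δ₁ Δ₂ : ℝ → ℝ, D.IsBirkhoffNormalForm i Δ₁ → D.IsBirkhoffNormalForm i Δ₂ →
      Δ₁ =ᶠ[𝓝 0] Δ₂) ∧
    ∀ Δ : ℝ → ℝ, D.IsBirkhoffNormalForm i Δ → (∃ k : ℕ, 1 ≤ k ∧ birkhoffInvariant Δ k ≠ 0) →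
      (∃ (U₀ : Set (ℝ × ℝ)) (R₀ : ℝ × ℝ → ℝ × ℝ), D.IsCanonicalConjugacy i Δ U₀ R₀) ∧
      ∀ (U₁ U₂ : Set (ℝ × ℝ)) (R₁ R₂ : ℝ × ℝ → ℝ × ℝ),
        D.IsCanonicalConjugacy i Δ U₁ R₁ → D.IsCanonicalConjugacy i Δ U₂ R₂ →
        EqOn R₁ R₂ (connectedComponentIn (U₁ ∩ U₂) (0, 0)) := by
  obtain ⟨T, hT, hT0, hTdet, hrev, ⟨A, P, β, γ, hA, hA1, hA2, hβ, hγ, hP⟩, hsq⟩ :=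
    BilliardTable.exists_squareMap hij hijb
  obtain ⟨Δ, R, hΔ, hΔ0, hΔ1, hR, hR0, hRdet, hconj, hswap, hpos⟩ :=
    exists_reversible_normalForm hT hT0 hTdet hrev hA hA1 hA2 hβ hγ hP
  have hcan : ∀ Δ', AnalyticAt ℝ Δ' 0 → 0 < Δ' 0 → Δ =ᶠ[𝓝 0] Δ' →
      ∃ U, D.IsCanonicalConjugacy i Δ' U R := fun Δ' h1 h2 h3 =>
    BilliardTable.exists_isCanonicalConjugacy hm hT.continuousAt hT0 hsq hR hR0 hRdet hconj hswap
      hpos h1 h2.ne' h3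
  have hbnf : D.IsBirkhoffNormalForm i Δ := by
    obtain ⟨U, hU⟩ := hcan Δ hΔ hΔ0 EventuallyEq.rfl
    exact ⟨hΔ, hΔ0, hΔ1, U, R, hU.1⟩
  have huniq : ∀ Δ₁ Δ₂ U₁ U₂ R₁ R₂, AnalyticAt ℝ Δ₁ 0 → 0 < Δ₁ 0 → Δ₁ 0 < 1 →
      AnalyticAt ℝ Δ₂ 0 → 0 < Δ₂ 0 → Δ₂ 0 < 1 → D.IsConjugacy i Δ₁ U₁ R₁ →
      D.IsConjugacy i Δ₂ U₂ R₂ → _ := fun Δ₁ Δ₂ U₁ U₂ R₁ R₂ h₁ h₁0 h₁1 h₂ h₂0 h₂1 c₁ c₂ =>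
    conjugacy_unique hT.continuousAt hT0 (c₁.analytic _ c₁.zero_mem) c₁.map_zero c₁.eventually_det
      (c₂.analytic _ c₂.zero_mem) c₂.map_zero c₂.eventually_det h₁ h₁0 h₁1 h₂ h₂0 h₂1
      (c₁.eventually_conj hT.continuousAt hT0 hsq) (c₂.eventually_conj hT.continuousAt hT0 hsq)
  have hgerm : ∀ Δ₁ Δ₂ : ℝ → ℝ, D.IsBirkhoffNormalForm i Δ₁ → D.IsBirkhoffNormalForm i Δ₂ →
      Δ₁ =ᶠ[𝓝 0] Δ₂ := by
    rintro Δ₁ Δ₂ ⟨h₁, h₁0, h₁1, U₁, R₁, c₁⟩ ⟨h₂, h₂0, h₂1, U₂, R₂, c₂⟩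
    exact (huniq Δ₁ Δ₂ U₁ U₂ R₁ R₂ h₁ h₁0 h₁1 h₂ h₂0 h₂1 c₁ c₂).1
  refine ⟨⟨Δ, hbnf⟩, hgerm, fun Δ' hΔ' _ => ⟨?_, fun U₁ U₂ R₁ R₂ c₁ c₂ => ?_⟩⟩
  · obtain ⟨U, hU⟩ := hcan Δ' hΔ'.1 hΔ'.2.1 (hgerm _ _ hbnf hΔ')
    exact ⟨U, R, hU⟩
  · obtain ⟨h, h0, h1, -⟩ := hΔ'
    obtain ⟨-, F, G, hF, -, hFG, hRR⟩ := huniq Δ' Δ' U₁ U₂ R₁ R₂ h h0 h1 h h0 h1 c₁.1 c₂.1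
    have heq : R₁ =ᶠ[𝓝 0] R₂ :=
      conjugacy_unique_of_diagonal (c₁.1.analytic _ c₁.1.zero_mem) c₁.1.map_zero
        (c₁.1.symplectic _ c₁.1.zero_mem) hF hFG hRR c₁.eventually_diagonal c₂.eventually_diagonal
    have hsub := connectedComponentIn_subset (U₁ ∩ U₂) ((0, 0) : ℝ × ℝ)
    -- The germs at (0, 0) agree, and the identity theorem propagates the equality over the
    -- connected component.
    exact (c₁.1.analytic.mono (hsub.trans inter_subset_left)).eqOn_of_preconnected_of_eventuallyEq
      (c₂.1.analytic.mono (hsub.trans inter_subset_right)) isPreconnected_connectedComponentIn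
      (mem_connectedComponentIn ⟨c₁.1.zero_mem, c₂.1.zero_mem⟩) heq
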